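/- **Conventions.** Let $\mathcal H=[0,1]^{\{0,1,2,\dots\}}$ be the Hilbert cube with the metric $d(x,y)=\sum_{i\ge 0}2^{-(i+1)}|x_i-y_i|$, let $d_H$ be the Hausdorff metric, $G=[0,1]\times\{0\}^\infty\subset\mathcal H$, and $\tfrac12\theta(x_0,x_1,\dots)=(0,\tfrac12x_0,\tfrac12x_1,\dots)$. A continuum is a compact connected metrizable space; a topological graph is a finite union of arcs meeting only at common endpoints. A continuum $X$ is a *tranched graph* if there are a topological graph $Y$ and a continuous map $\phi$ of $X$ onto $Y$ with connected fibers such that the union of the one-point fibers is dense in $X$. The nondegenerate fibers of such maps are called the *tranches* of $X$. The continuum $X$ is a *generalized $\sin(1/x)$-type continuum* if $\phi$ can be chosen so that moreover every fiber is nowhere dense and, for every subcontinuum $K$ of a fiber and every $\varepsilon>0$, there is an arc $J\subset Y$ with $d_H(K,\phi^{-1}(J))<\varepsilon$. The *depth* of $X$ is the supremum of all $n$ for which there is a chain $X=T_0\supset T_1\supset\dots\supset T_n$ such that each $T_{k+1}$ is a tranche of the tranched graph $T_k$. A *quasi-arc* $L$ is the image of a continuous injection $\varphi:[0,\infty)\to\mathcal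 H$ (we also parametrize by $(0,1]$, through $s\mapsto 1/(1+s)$); $\omega(L)=\bigcap_m\overline{\varphi([m,\infty))}$, and $L$ is *oscillatory* if $\omega(L)$ has more than one point. It is of *$\infty$-order* if for every $n$ there are oscillatory quasi-arcs $L=L_0,L_1,\dots,L_n$ with $L_{i+1}\subset\omega(L_i)$. Let $f(t)=\frac14(\sin\frac{\pi}{t}+1+3t)$ for $0<t\le\frac12$ and $f(t)=\frac54-\frac54t$ for $\frac12\le t\le1$. **Statement.** There are maps $\varphi_n:(0,1]\to\mathcal H$ ($n\ge0$) and $\varphi_\infty:(0,1]\to\mathcal H$ such that, with $L_n=\varphi_n((0,1])$, $X_n=G\cup\overline{L_n}$ for $0\le n\le\infty$: 1. $\varphi_0(t)=(t,f(t),0,0,\dots)$, so $X_0$ is the Warsaw circle; 2. for every finite $n$, $\varphi_n$ parametrizes an oscillatory quasi-arc $L_n$, all coordinates of $\varphi_n$ of index $>n+1$ vanish, $\varphi_{n+1}$ agrees with $\varphi_n$ in the coordinates of index $\le n+1$, and $\omega(L_{n+1})=\tfrac12\theta(X_n)$; 3. $\varphi_n\to\varphi_\infty$ uniformly and $d_H(X_n,X_\infty)\to0$;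 4. $X_\infty$ is an arcwise connected generalized $\sin(1/x)$-type continuum, and it is a tranched graph of infinite depth; 5. $X_\infty$ has exactly one tranche, namely $\omega(L_\infty)=\tfrac12\theta(X_\infty)$, and $L_\infty$ is an oscillatory quasi-arc of $\infty$-order. -/

import Mathlib

open Set Filter Topology
open scoped NNReal

/-! ### Arcs, topological graphs, continua -/

/-- A subset of a (Hausdorff) space is an arc if it is the image of a topological embedding
of the closed unit interval. -/
def IsArc {Y : Type*} [TopologicalSpace Y] (J : Set Y) : Prop :=
  ∃ γ : unitInterval → Y, IsEmbedding γ ∧ range γ = J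

/-- A topological graph: a (Hausdorff) union of finitely many arcs, any two of which meet only at
points that are endpoints of both. -/
def IsTopologicalGraph (Y : Type*) [TopologicalSpace Y] : Prop :=
  T2Space Y ∧ ∃ (n : ℕ) (e : Fin n → unitInterval → Y),
    (∀ i, IsEmbedding (e i)) ∧ (⋃ i, range (e i)) = univ ∧
    ∀ i j, i ≠ j → ∀ x ∈ range (e i) ∩ range (e j),
      (x = e i 0 ∨ x = e i 1) ∧ (x = e j 0 ∨ x = e j 1)

/-- A continuum: a compact connected (nonempty) space. Metrizability comes from the ambient
metric in all uses below. -/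
def IsContinuum (X : Type*) [TopologicalSpace X] : Prop :=
  CompactSpace X ∧ ConnectedSpace X

/-- Arcwise connectedness: any two distinct points are the endpoints of an arc. -/
def IsArcwiseConnected (X : Type*) [TopologicalSpace X] : Prop :=
  Nonempty X ∧ ∀ x y : X, x ≠ y → ∃ γ : unitInterval → X, IsEmbedding γ ∧ γ 0 = x ∧ γ 1 = y

/-! ### Tranched graphs, generalized `sin(1/x)`-type continua -/

/-- The maps in the definition of a tranched graph: `φ` is a continuous monotone map (all fibers
are connected, in particular nonempty, so `φ` is onto) onto a topological graph, and the union of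
the degenerate fibers is dense. -/
structure IsTranchingMap {X Y : Type*} [TopologicalSpace X] [TopologicalSpace Y]
    (φ : X → Y) : Prop where
  graph : IsTopologicalGraph Y
  continuous : Continuous φ
  monotone : ∀ y, IsConnected (φ ⁻¹' {y})
  dense : Dense (φ ⁻¹' {y | (φ ⁻¹' {y}).Subsingleton})

/-- A tranched graph. -/
def IsTranchedGraph (X : Type*) [TopologicalSpace X] : Prop :=
  IsContinuum X ∧ ∃ (Y : Type) (_ : TopologicalSpace Y) (φ : X → Y), IsTranchingMap φ

/-- A generalized `sin(1/x)`-type continuum: there is a continuous monotone map onto a topological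
graph whose fibers are nowhere dense, with a dense union of degenerate fibers, and with the
approximation property: each subcontinuum of each fiber is, in the Hausdorff metric, arbitrarily
close to the preimage of an arc. -/
def IsGeneralizedSinContinuum (X : Type*) [MetricSpace X] : Prop :=
  IsContinuum X ∧ ∃ (Y : Type) (_ : TopologicalSpace Y) (φ : X → Y), IsTranchingMap φ ∧
    (∀ y, IsNowhereDense (φ ⁻¹' {y})) ∧
    ∀ y, ∀ K : Set X, K ⊆ φ ⁻¹' {y} → IsCompact K → IsConnected K → ∀ ε > 0,
      ∃ J : Set Y, IsArc J ∧ Metric.hausdorffDist K (φ ⁻¹' J) < ε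

/-- `T` is a tranche (a nondegenerate fiber) of the tranched graph `S`. -/
def IsTranche {E : Type*} [TopologicalSpace E] (T S : Set E) : Prop :=
  IsContinuum S ∧ ∃ (Y : Type) (_ : TopologicalSpace Y) (φ : S → Y), IsTranchingMap φ ∧
    ∃ y, T = Subtype.val '' (φ ⁻¹' {y}) ∧ T.Nontrivial

/-- The sets `T` that end a chain `X = T₀ ⊃ T₁ ⊃ … ⊃ Tₙ = T` in which each set is a tranche of
the preceding one. -/
def level {E : Type*} [TopologicalSpace E] (X : Set E) : ℕ → Set (Set E)
  | 0 => {X}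
  | n + 1 => {T | ∃ S ∈ level X n, IsTranche T S}

/-- The depth of `X`: the supremum of the lengths of chains of successive tranches. -/
noncomputable def depth {E : Type*} [TopologicalSpace E] (X : Set E) : ℕ∞ :=
  ⨆ n ∈ {n : ℕ | (level X n).Nonempty}, (n : ℕ∞)

/-! ### Quasi-arcs -/

/-- The limit set `⋂ₘ closure (γ [m, ∞))`. -/
def limitSet {E : Type*} [TopologicalSpace E] (γ : ℝ≥0 → E) : Set E :=
  ⋂ m : ℝ≥0, closure (γ '' Ici m)

/-- `γ` parametrizes an oscillatory quasi-arc (namely `range γ`): it is a continuous injection,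
and its limit set has more than one point. -/
def IsOscillatoryQuasiArc {E : Type*} [TopologicalSpace E] (γ : ℝ≥0 → E) : Prop :=
  Continuous γ ∧ Function.Injective γ ∧ (limitSet γ).Nontrivial

/-- `γ` parametrizes an oscillatory quasi-arc of `∞`-order: for every `n` there are oscillatory
quasi-arcs `L₀ = range γ, L₁, …, Lₙ`, each contained in the limit set of the preceding one. -/
def IsInftyOrder {E : Type*} [TopologicalSpace E] (γ : ℝ≥0 → E) : Prop :=
  ∀ n : ℕ, ∃ Λ : Fin (n + 1) → ℝ≥0 → E, Λ 0 = γ ∧ (∀ i, IsOscillatoryQuasiArc (Λ i)) ∧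
    ∀ i : Fin n, range (Λ i.succ) ⊆ limitSet (Λ i.castSucc)

/-! ### The Hilbert cube -/

/-- The Hilbert cube `[0,1]^ℕ`, with coordinates `x₀, x₁, …`. -/
def HilbertCube : Type := ℕ → unitInterval

namespace HilbertCube

theorem summable_aux (x y : HilbertCube) :
    Summable fun i : ℕ => (1 / 2 : ℝ) ^ (i + 1) * |(x i : ℝ) - y i| := by
  have h : Summable fun i : ℕ => (1 / 2 : ℝ) ^ (i + 1) :=
    (summable_nat_add_iff 1).2 summable_geometric_two
  refine Summable.of_nonneg_of_le (fun i => by positivity) (fun i => ?_) h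
  have h1 := (x i).2
  have h2 := (y i).2
  have : |(x i : ℝ) - y i| ≤ 1 := by
    rw [abs_le]; constructor <;> linarith [h1.1, h1.2, h2.1, h2.2]
  exact mul_le_of_le_one_right (by positivity) this

/-- The metric `d(x, y) = ∑ 2^{-(i+1)} |xᵢ - yᵢ|`; it induces the product topology. -/
noncomputable instance : MetricSpace HilbertCube where
  dist x y := ∑' i : ℕ, (1 / 2 : ℝ) ^ (i + 1) * |(x i : ℝ) - y i|
  dist_self x := by simp
  dist_comm x y := by simp only [abs_sub_comm]
  dist_triangle x y z := by
    rw [← (summable_aux x y).tsum_add (summable_aux y z)]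
    refine (summable_aux x z).tsum_le_tsum (fun i => ?_)
      ((summable_aux x y).add (summable_aux y z))
    rw [← mul_add]
    exact mul_le_mul_of_nonneg_left (abs_sub_le _ _ _) (by positivity)
  eq_of_dist_eq_zero {x y} h := by
    have h0 := (hasSum_zero_iff_of_nonneg
      (fun i : ℕ => by positivity)).1 (h ▸ (summable_aux x y).hasSum)
    funext i
    have hi := congrFun h0 i
    simp only [Pi.zero_apply, mul_eq_zero, abs_eq_zero] at hi
    rcases hi with hi | hi
    · exact absurd hi (by positivity)
    · exact Subtype.ext (by linarith)

/-- The scaled shift `(x₀, x₁, …) ↦ (0, x₀ / 2, x₁ / 2, …)`. -/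
noncomputable def halfShift (x : HilbertCube) : HilbertCube
  | 0 => 0
  | i + 1 => ⟨(x i : ℝ) / 2, by
      have h := (x i).2
      exact ⟨by linarith [h.1], by linarith [h.2]⟩⟩

/-- The edge `[0,1] × {0}^∞`. -/
def baseEdge : Set HilbertCube := {x | ∀ i, 1 ≤ i → x i = 0}

end HilbertCube

/-! ### The Warsaw circle and its lifts -/

/-- The function whose graph over `(0,1]` is the oscillating part of the Warsaw circle. -/
noncomputable def warsawFun (t : ℝ) : ℝ :=
  if t ≤ 1 / 2 then (1 / 4) * (Real.sin (Real.pi / t) + 1 + 3 * t) else 5 / 4 - 5 / 4 * t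

/-- The homeomorphism `s ↦ 1 / (1 + s)` of `[0, ∞)` onto `(0, 1]`, used to regard a map on
`(0, 1]` as a parametrization of a quasi-arc. -/
noncomputable def rayParam (s : ℝ≥0) : Ioc (0 : ℝ) 1 :=
  ⟨1 / (1 + (s : ℝ)), by positivity, by
    rw [div_le_one (by positivity)]; linarith [s.2]⟩

/-- The set `[0,1] × {0}^∞ ∪ closure (φ((0,1]))`. -/
def edgeUnionClosure (φ : Ioc (0 : ℝ) 1 → HilbertCube) : Set HilbertCube :=
  HilbertCube.baseEdge ∪ closure (range φ)

/-! ### The topology of the Hilbert cube -/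

namespace HilbertCube

/-! One explicit ray carries the whole theorem. Its point at time `t` is `(t, c₀ t, c₁ t, …)`, where
`c₀` is the Warsaw function and `cᵢ₊₁ t` is half of `cᵢ` at another time `r t`, multiplied by a
cut-off. During one period of the phase the ray descends a scaled copy of the base edge to the
neighbourhood of the origin; then the cut-off opens and, after a small excursion, the ray climbs a
scaled copy of itself, from far out back to time 1. The errors tend to zero along the ray, so its
limit set is `halfShift '' X`, where `X` is the limit continuum (`limitSet_quasiArc`). Hence `X` is
the union of the half-open arc `circuit '' Ico 0 1` (the edge followed by the ray) and of `halfShift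
'' X`, and the two meet only at the origin (`limitContinuum_eq_union`, `circuit_ne_halfShift`).

The rest exploits this self-similarity. Collapsing `halfShift '' X` to a point turns `X` into a
simple closed curve, which gives the tranching map. No other tranche can arise: degenerate fibers
are dense, so no fiber contains an arc of the circuit, and a graph has small connected
neighbourhoods, so the oscillating ray cannot have two limit values (`eq_of_isTranche`). Iterating
the shift gives infinite depth and infinite order. Iterated copies of the circuit cover `X` and
share only the origin, so any two points are joined by an arc inside two copies.

The delicate point is the approximation of every subcontinuum of the tranche by arcs of the ray. A
subcontinuum `K` of `X` that avoids the origin is an arc of the circuit or lies in the scaled copy.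
If it contains the origin, it is an initial arc of the circuit together with either the closure of a
tail or `halfShift '' L`, where `L` is again a subcontinuum through the origin
(`subcontinuum_of_origin_mem`). The excursions serve the last case: every grid arc of the ray around
a half-integer phase has a code `k`, and the ray visits a scaled copy of that arc just after phase
`k + 1/2`. An approximation for `L` thus becomes one for `K` with half the error, and induction on
the error finishes (`frequently_close`).

The finite stages are coordinate truncations of the limit ray. Truncation commutes with the shift up
to one index and with limit sets by compactness, so their properties follow from those of the limit.
-/

theorem dist_eq_tsum (x y : HilbertCube) :
    dist x y = ∑' i : ℕ, (1 / 2 : ℝ) ^ (i + 1) * |(x i : ℝ) - y i| := rfl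

theorem hasSum_half_pow : HasSum (fun i : ℕ => (1 / 2 : ℝ) ^ (i + 1)) 1 := by
  have := hasSum_geometric_two.mul_left (1 / 2 : ℝ)
  simpa [pow_succ, mul_comm] using this

theorem abs_sub_le_one (x y : HilbertCube) (i : ℕ) : |(x i : ℝ) - y i| ≤ 1 := by
  have h1 := (x i).2
  have h2 := (y i).2
  rw [abs_le]; constructor <;> linarith [h1.1, h1.2, h2.1, h2.2]

/-- A coordinatewise bound is a bound for the distance. -/
theorem dist_le_of_forall {x y : HilbertCube} {ε : ℝ} (h : ∀ i, |(x i : ℝ) - y i| ≤ ε) :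
    dist x y ≤ ε := by
  have h1 := hasSum_half_pow.mul_right ε
  rw [one_mul] at h1
  exact hasSum_le (fun i => mul_le_mul_of_nonneg_left (h i) (by positivity))
    (summable_aux x y).hasSum h1

theorem dist_le_one (x y : HilbertCube) : dist x y ≤ 1 :=
  dist_le_of_forall (abs_sub_le_one x y)

theorem abs_sub_le_dist (x y : HilbertCube) (i : ℕ) :
    |(x i : ℝ) - y i| ≤ 2 ^ (i + 1) * dist x y := by
  have h := (summable_aux x y).le_tsum i (fun j _ => by positivity)
  rw [← dist_eq_tsum] at h
  have h2 : (2 : ℝ) ^ (i + 1) * ((1 / 2 : ℝ) ^ (i + 1) * |(x i : ℝ) - y i|)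
      = |(x i : ℝ) - y i| := by
    rw [← mul_assoc, ← mul_pow]; norm_num
  rw [← h2]
  exact mul_le_mul_of_nonneg_left h (by positivity)

@[fun_prop]
theorem continuous_coord (i : ℕ) : Continuous fun x : HilbertCube => (x i : ℝ) := by
  rw [Metric.continuous_iff]
  intro x ε hε
  refine ⟨ε / 2 ^ (i + 1), by positivity, fun y hy => ?_⟩
  rw [Real.dist_eq]
  refine (abs_sub_le_dist y x i).trans_lt ?_
  rw [lt_div_iff₀ (by positivity)] at hy
  linarith

/-- A sequence in the unit interval as a point of the Hilbert cube. -/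
def ofFun (x : ℕ → unitInterval) : HilbertCube := x

/-- The metric is a uniformly convergent series of functions continuous in the product topology.
This direction suffices: it yields compactness by Tychonoff and the coordinatewise criterion for
continuity. -/
theorem continuous_ofFun : Continuous ofFun := by
  have key : Continuous fun p : (ℕ → unitInterval) × (ℕ → unitInterval) =>
      ∑' i : ℕ, (1 / 2 : ℝ) ^ (i + 1) * |(p.1 i : ℝ) - p.2 i| := by
    refine continuous_tsum (fun i => by fun_prop) hasSum_half_pow.summable fun i p => ?_
    rw [Real.norm_of_nonneg (by positivity)]
    exact mul_le_of_le_one_right (by positivity) (abs_sub_le_one p.1 p.2 i)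
  rw [continuous_iff_continuousAt]
  intro x
  rw [ContinuousAt, tendsto_iff_dist_tendsto_zero]
  have h2 : Continuous fun y : ℕ → unitInterval => (y, x) := by fun_prop
  have h3 := (key.comp h2).tendsto x
  have h4 : ((fun p : (ℕ → unitInterval) × (ℕ → unitInterval) =>
      ∑' i : ℕ, (1 / 2 : ℝ) ^ (i + 1) * |(p.1 i : ℝ) - p.2 i|) ∘ fun y => (y, x)) x = 0 := by
    simp
  rw [h4] at h3
  exact h3

instance : CompactSpace HilbertCube :=
  ⟨by
    have := isCompact_univ.image continuous_ofFun
    rwa [image_univ, (show Function.Surjective ofFun from fun x => ⟨x, rfl⟩).range_eq] at this⟩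

/-- A map into the Hilbert cube is continuous on a set if its coordinates are. -/
theorem continuousOn_of_coord {E : Type*} [TopologicalSpace E] {g : E → HilbertCube} {s : Set E}
    (h : ∀ i, ContinuousOn (fun a => (g a i : ℝ)) s) : ContinuousOn g s := by
  have : ContinuousOn (fun a i => (g a i : unitInterval)) s :=
    continuousOn_pi.2 fun i => Topology.IsInducing.subtypeVal.continuousOn_iff.2 (h i)
  exact continuous_ofFun.comp_continuousOn this

theorem continuous_of_coord {E : Type*} [TopologicalSpace E] {g : E → HilbertCube}
    (h : ∀ i, Continuous fun a => (g a i : ℝ)) : Continuous g := by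
  rw [← continuousOn_univ]
  exact continuousOn_of_coord fun i => (h i).continuousOn

theorem ext_coord {x y : HilbertCube} (h : ∀ i, (x i : ℝ) = y i) : x = y :=
  funext fun i => Subtype.ext (h i)

/-! ### The scaled shift -/

@[simp] theorem halfShift_zero (x : HilbertCube) : (halfShift x 0 : ℝ) = 0 := rfl

@[simp] theorem halfShift_succ (x : HilbertCube) (i : ℕ) :
    (halfShift x (i + 1) : ℝ) = x i / 2 := rfl

theorem halfShift_injective : Function.Injective halfShift := fun x y h =>
  ext_coord fun i => by
    have := congrArg (fun z : HilbertCube => (z (i + 1) : ℝ)) h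
    simp only [halfShift_succ] at this
    linarith

theorem dist_halfShift (x y : HilbertCube) :
    dist (halfShift x) (halfShift y) = dist x y / 4 := by
  have h1 := (summable_aux (halfShift x) (halfShift y)).tsum_eq_zero_add
  rw [← dist_eq_tsum] at h1
  have h2 : ∀ i : ℕ, (1 / 2 : ℝ) ^ (i + 1 + 1) *
      |(halfShift x (i + 1) : ℝ) - halfShift y (i + 1)| =
      1 / 4 * ((1 / 2 : ℝ) ^ (i + 1) * |(x i : ℝ) - y i|) := fun i => by
    rw [halfShift_succ, halfShift_succ, ← sub_div, abs_div, abs_of_pos (by norm_num : (0 : ℝ) < 2)]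
    ring
  simp only [h2] at h1
  rw [h1, tsum_mul_left, ← dist_eq_tsum, halfShift_zero, halfShift_zero]
  simp only [sub_self, abs_zero, mul_zero, zero_add]
  ring

@[fun_prop]
theorem continuous_halfShift : Continuous halfShift :=
  LipschitzWith.continuous (K := 1) <| LipschitzWith.of_dist_le_mul fun x y => by
    rw [dist_halfShift]
    have := dist_nonneg (x := x) (y := y)
    simp only [NNReal.coe_one, one_mul]; linarith

theorem isClosedEmbedding_halfShift : IsClosedEmbedding halfShift :=
  continuous_halfShift.isClosedEmbedding halfShift_injective

/-! ### Points of the base edge and truncation -/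

/-- The point `(u, 0, 0, …)` with `u` clamped to the unit interval. -/
noncomputable def edgePoint (u : ℝ) : HilbertCube
  | 0 => projIcc 0 1 zero_le_one u
  | _ + 1 => 0

theorem edgePoint_zero {u : ℝ} (h0 : 0 ≤ u) (h1 : u ≤ 1) : (edgePoint u 0 : ℝ) = u := by
  change ((projIcc (0 : ℝ) 1 zero_le_one u : unitInterval) : ℝ) = u
  rw [projIcc_of_mem zero_le_one ⟨h0, h1⟩]

@[simp] theorem edgePoint_succ (u : ℝ) (i : ℕ) : (edgePoint u (i + 1) : ℝ) = 0 := rfl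

@[fun_prop]
theorem continuous_edgePoint : Continuous edgePoint :=
  continuous_of_coord fun i => by
    cases i with
    | zero => exact continuous_subtype_val.comp (continuous_projIcc (h := zero_le_one))
    | succ i => exact continuous_const

theorem halfShift_edgePoint_zero : halfShift (edgePoint 0) = edgePoint 0 :=
  ext_coord fun i => by
    match i with
    | 0 => simp [edgePoint_zero]
    | 1 => simp [edgePoint_zero]
    | i + 2 => simp

theorem baseEdge_eq_image : baseEdge = edgePoint '' Icc 0 1 := by
  ext x
  constructor
  · intro hx
    refine ⟨x 0, (x 0).2, ext_coord fun i => ?_⟩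
    cases i with
    | zero => exact edgePoint_zero (x 0).2.1 (x 0).2.2
    | succ i => rw [hx (i + 1) (by omega)]; rfl
  · rintro ⟨u, -, rfl⟩ i hi
    obtain ⟨j, rfl⟩ := Nat.exists_eq_add_of_le' hi
    rfl

theorem isCompact_baseEdge : IsCompact baseEdge := by
  rw [baseEdge_eq_image]
  exact isCompact_Icc.image continuous_edgePoint

/-- Replace the coordinates of index at least `n` by zero. -/
noncomputable def trunc (n : ℕ) (x : HilbertCube) : HilbertCube := fun i => if i < n then x i else 0

theorem trunc_of_lt {n i : ℕ} (h : i < n) (x : HilbertCube) : trunc n x i = x i := if_pos h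

theorem trunc_of_le {n i : ℕ} (h : n ≤ i) (x : HilbertCube) : trunc n x i = 0 :=
  if_neg (not_lt.2 h)

@[fun_prop]
theorem continuous_trunc (n : ℕ) : Continuous (trunc n) :=
  continuous_of_coord fun i => by
    rcases lt_or_ge i n with h | h
    · simpa only [trunc_of_lt h] using continuous_coord i
    · simpa only [trunc_of_le h] using continuous_const

/-- This is how the finite stages inherit self-similarity: the limit set of one stage is the scaled
copy of the preceding one. -/
theorem trunc_halfShift (n : ℕ) (x : HilbertCube) :
    trunc (n + 1) (halfShift x) = halfShift (trunc n x) :=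
  ext_coord fun i => by
    cases i with
    | zero => rw [trunc_of_lt (by omega)]; rfl
    | succ i =>
      rw [halfShift_succ]
      rcases lt_or_ge i n with h | h
      · rw [trunc_of_lt h, trunc_of_lt (by omega), halfShift_succ]
      · rw [trunc_of_le h, trunc_of_le (by omega)]; simp

theorem trunc_eq_self_of_mem_baseEdge {n : ℕ} (hn : 1 ≤ n) {x : HilbertCube} (hx : x ∈ baseEdge) :
    trunc n x = x := by
  funext i
  rcases lt_or_ge i n with h | h
  · exact trunc_of_lt h x
  · rw [trunc_of_le h, hx i (by omega)]

theorem dist_trunc_le (n : ℕ) (x : HilbertCube) : dist (trunc n x) x ≤ (1 / 2) ^ n := by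
  have h1 : HasSum (fun i : ℕ => (1 / 2 : ℝ) ^ n * (1 / 2 : ℝ) ^ (i + 1)) ((1 / 2) ^ n) := by
    simpa using hasSum_half_pow.mul_left ((1 / 2 : ℝ) ^ n)
  rw [dist_eq_tsum, ← (summable_aux _ _).sum_add_tsum_nat_add n,
    Finset.sum_eq_zero fun i hi => by
      rw [trunc_of_lt (Finset.mem_range.1 hi), sub_self, abs_zero, mul_zero], zero_add]
  refine hasSum_le (fun i => ?_) ((summable_nat_add_iff n).2 (summable_aux _ _)).hasSum h1
  rw [← pow_add, show n + (i + 1) = i + n + 1 by ring]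
  exact mul_le_of_le_one_right (by positivity) (abs_sub_le_one _ _ _)

end HilbertCube

/-! ### The construction of the ray

The point at time `t` is `(t, c₀ t, c₁ t, …)` with `c₀ = warsawFun` and
`cᵢ₊₁ t = σ t * cᵢ (r t) / 2`. In the phase variable `w`, with `t = 2 / (1 + 4 w)`, the second
coordinate is close to `height w / 2`. In the first half of the period `[k, k + 1]` the cut-off `σ`
vanishes, and the point moves along a scaled copy of the base edge; in the second half it follows
a scaled copy of the ray itself, after an excursion, close to the limit set, that moves along the
portion of the ray between the phases `gridLeft m j` and `gridRight m l` encoded by `k`. -/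

namespace WarsawTower

/-- The retraction of the line onto the unit interval. -/
noncomputable def clamp (y : ℝ) : ℝ := max 0 (min 1 y)

theorem clamp_nonneg (y : ℝ) : 0 ≤ clamp y := le_max_left _ _

theorem clamp_le_one (y : ℝ) : clamp y ≤ 1 := max_le zero_le_one (min_le_left _ _)

theorem clamp_of_le {y : ℝ} (h : y ≤ 0) : clamp y = 0 := max_eq_left ((min_le_right _ _).trans h)

theorem clamp_of_ge {y : ℝ} (h : 1 ≤ y) : clamp y = 1 := by
  rw [clamp, min_eq_left h, max_eq_right zero_le_one]

@[fun_prop]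
theorem continuous_clamp : Continuous clamp := by unfold clamp; fun_prop

/-! ### Times, phases and the Warsaw function -/

/-- The time with a given phase. -/
noncomputable def time (w : ℝ) : ℝ := 2 / (1 + 4 * w)

/-- The phase of a given time. -/
noncomputable def phase (t : ℝ) : ℝ := 1 / (2 * t) - 1 / 4

theorem phase_time {w : ℝ} (h : 0 ≤ w) : phase (time w) = w := by
  have : 1 + 4 * w ≠ 0 := by positivity
  unfold phase time
  field_simp
  ring

theorem time_phase {t : ℝ} (h : 0 < t) : time (phase t) = t := by
  have : t ≠ 0 := h.ne'
  unfold phase time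
  field_simp
  ring_nf

theorem time_pos {w : ℝ} (h : 0 ≤ w) : 0 < time w := by unfold time; positivity

theorem time_le_one {w : ℝ} (h : 1 / 4 ≤ w) : time w ≤ 1 := by
  unfold time
  rw [div_le_one (by linarith)]
  linarith

theorem time_le_time {v w : ℝ} (hv : 0 ≤ v) (h : v ≤ w) : time w ≤ time v := by
  unfold time
  gcongr

theorem phase_le_phase {s t : ℝ} (hs : 0 < s) (h : s ≤ t) : phase t ≤ phase s := by
  unfold phase
  gcongr

theorem continuousOn_phase : ContinuousOn phase (Ioi 0) := by
  unfold phase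
  refine (continuousOn_const.div (by fun_prop) fun w hw => ?_).sub continuousOn_const
  have : (0 : ℝ) < w := hw
  positivity

theorem tendsto_time : Tendsto time atTop (𝓝 0) := by
  unfold time
  exact tendsto_const_nhds.div_atTop
    (tendsto_atTop_add_const_left _ _ (tendsto_id.const_mul_atTop (by norm_num)))

/-- Twice the limit value of the second coordinate in a given phase. -/
noncomputable def height (x : ℝ) : ℝ := (1 + Real.cos (2 * Real.pi * x)) / 2

@[fun_prop]
theorem continuous_height : Continuous height := by unfold height; fun_prop

theorem height_nonneg (x : ℝ) : 0 ≤ height x := by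
  unfold height; linarith [Real.neg_one_le_cos (2 * Real.pi * x)]

theorem height_le_one (x : ℝ) : height x ≤ 1 := by
  unfold height; linarith [Real.cos_le_one (2 * Real.pi * x)]

theorem height_nat_add (k : ℕ) (x : ℝ) : height (k + x) = height x := by
  unfold height
  rw [show 2 * Real.pi * (k + x) = 2 * Real.pi * x + k * (2 * Real.pi) by ring,
    Real.cos_add_nat_mul_two_pi]

theorem height_one : height 1 = 1 := by simp [height]

/-- In the phase variable `π / t = 2πw + π/2`, so the sine becomes a cosine of period one. The phase
of `t = 1/2`, where the formula for the function changes, is `3/4`. -/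
theorem warsawFun_time {w : ℝ} (h : 3 / 4 ≤ w) :
    warsawFun (time w) = height w / 2 + 3 / 4 * time w := by
  have h1 : time w ≤ 1 / 2 := by
    unfold time
    rw [div_le_div_iff₀ (by linarith) (by norm_num)]
    linarith
  have h2 : Real.pi / time w = 2 * Real.pi * w + Real.pi / 2 := by
    have : 1 + 4 * w ≠ 0 := by linarith
    unfold time
    field_simp
    ring
  rw [warsawFun, if_pos h1, h2, Real.sin_add_pi_div_two, height]
  ring

theorem warsawFun_one : warsawFun 1 = 0 := by norm_num [warsawFun]

theorem warsawFun_pos {t : ℝ} (h0 : 0 < t) (h1 : t < 1) : 0 < warsawFun t := by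
  unfold warsawFun
  split_ifs
  · linarith [Real.neg_one_le_sin (Real.pi / t)]
  · linarith

theorem warsawFun_le_one (t : ℝ) : warsawFun t ≤ 1 := by
  unfold warsawFun
  split_ifs
  · linarith [Real.sin_le_one (Real.pi / t)]
  · linarith

theorem warsawFun_nonneg {t : ℝ} (h0 : 0 ≤ t) (h1 : t ≤ 1) : 0 ≤ warsawFun t := by
  unfold warsawFun
  split_ifs
  · linarith [Real.neg_one_le_sin (Real.pi / t)]
  · linarith

theorem continuousOn_warsawFun : ContinuousOn warsawFun (Ioi 0) := by
  have h1 : ContinuousOn (fun t : ℝ => (1 / 4) * (Real.sin (Real.pi / t) + 1 + 3 * t)) (Ioi 0) := by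
    refine ContinuousOn.mul continuousOn_const (((Real.continuous_sin.comp_continuousOn
      (continuousOn_const.div continuousOn_id fun t ht => (ne_of_gt ht))).add
      continuousOn_const).add (by fun_prop))
  unfold warsawFun
  refine ContinuousOn.if' ?_ ?_ (h1.mono inter_subset_left) (by fun_prop)
  all_goals
    rintro t ⟨ht, hf⟩
    have : t = 1 / 2 := by
      have h2 := frontier_Iic (a := (1 / 2 : ℝ))
      rw [show {a : ℝ | a ≤ 1 / 2} = Iic (1 / 2) from rfl, h2] at hf
      exact hf
    subst this
  · rw [if_pos le_rfl]
    exact (h1 _ ht).mono inter_subset_left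
  · have h3 : Real.sin (Real.pi / (1 / 2)) = 0 := by
      rw [show Real.pi / (1 / 2) = 2 * Real.pi by ring, Real.sin_two_pi]
    rw [if_pos le_rfl, h3]
    have : Continuous fun t : ℝ => 5 / 4 - 5 / 4 * t := by fun_prop
    have h4 := (this.tendsto (1 / 2)).mono_left (nhdsWithin_le_nhds (s := Ioi 0 ∩ {a | ¬a ≤ 1 / 2}))
    convert h4 using 2
    norm_num

/-! ### Coding of excursions by natural numbers -/

/-- The phase at the left end of an excursion. -/
noncomputable def gridLeft (m j : ℕ) : ℝ := m + 1 / 2 - j / (2 * (m + 2))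

/-- The phase at the right end of an excursion. -/
noncomputable def gridRight (m l : ℕ) : ℝ := m + 1 / 2 + l / (2 * (m + 2))

/-- The code of an excursion. -/
def code (m j l : ℕ) : ℕ := (m ^ 2 + j) ^ 2 + l

/-- The period visited by the excursion with code `k`. -/
def codePeriod (k : ℕ) : ℕ := k.sqrt.sqrt

noncomputable def codeLeft (k : ℕ) : ℝ := gridLeft (codePeriod k) (k.sqrt - codePeriod k ^ 2)

noncomputable def codeRight (k : ℕ) : ℝ := gridRight (codePeriod k) (k - k.sqrt ^ 2)

section Code

variable {m j l : ℕ}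

/-- Integer square roots decode: `n ^ 2 + i` has root `n` as long as `i ≤ 2 * n`, and here `l ≤ 2 *
m ≤ 2 * (m ^ 2 + j)`. -/
theorem sqrt_code (hl : l ≤ 2 * m) : (code m j l).sqrt = m ^ 2 + j :=
  Nat.sqrt_add_eq' _ (by nlinarith)

theorem codePeriod_code (hj : j ≤ 2 * m) (hl : l ≤ 2 * m) : codePeriod (code m j l) = m := by
  rw [codePeriod, sqrt_code hl]
  exact Nat.sqrt_add_eq' _ (by omega)

theorem codeLeft_code (hj : j ≤ 2 * m) (hl : l ≤ 2 * m) :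
    codeLeft (code m j l) = gridLeft m j := by
  rw [codeLeft, codePeriod_code hj hl, sqrt_code hl, Nat.add_sub_cancel_left]

theorem codeRight_code (hj : j ≤ 2 * m) (hl : l ≤ 2 * m) :
    codeRight (code m j l) = gridRight m l := by
  rw [codeRight, codePeriod_code hj hl, sqrt_code hl, code, Nat.add_sub_cancel_left]

/-- An excursion to a far period takes place in a period at least as far, so the induction in
`frequently_close` can be kept beyond any bound. -/
theorem le_code (m j l : ℕ) : m ≤ code m j l := by
  unfold code
  nlinarith [Nat.le_self_pow (n := 2) (by norm_num) m,
    Nat.le_self_pow (n := 2) (by norm_num) (m ^ 2 + j)]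

end Code

theorem gridLeft_le (m j : ℕ) : gridLeft m j ≤ m + 1 / 2 := by
  unfold gridLeft
  have : (0 : ℝ) ≤ j / (2 * (m + 2)) := by positivity
  linarith

theorem le_gridRight (m l : ℕ) : m + 1 / 2 ≤ gridRight m l := by
  unfold gridRight
  have : (0 : ℝ) ≤ l / (2 * (m + 2)) := by positivity
  linarith

theorem codeLeft_le (k : ℕ) : codeLeft k ≤ codePeriod k + 1 / 2 := gridLeft_le _ _

theorem le_codeRight (k : ℕ) : codePeriod k + 1 / 2 ≤ codeRight k := le_gridRight _ _

/-- This makes all excursions, for every `k`, tend to time zero. The right end needs no such bound,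
since larger phases have smaller times. -/
theorem le_codeLeft (k : ℕ) : codePeriod k - 1 / 2 ≤ codeLeft k := by
  have h : k.sqrt - codePeriod k ^ 2 ≤ 2 * codePeriod k := by
    have h1 := Nat.sqrt_le_add k.sqrt
    rw [codePeriod, sq]
    omega
  have h2 : ((k.sqrt - codePeriod k ^ 2 : ℕ) : ℝ) ≤ 2 * codePeriod k := by exact_mod_cast h
  have h3 : ((k.sqrt - codePeriod k ^ 2 : ℕ) : ℝ) / (2 * (codePeriod k + 2)) ≤ 1 := by
    rw [div_le_one (by positivity)]; linarith
  unfold codeLeft gridLeft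
  linarith

theorem half_le_codeLeft (k : ℕ) : 1 / 2 ≤ codeLeft k := by
  rcases Nat.eq_zero_or_pos (codePeriod k) with h | h
  · have h1 : k.sqrt = 0 := by
      have h2 := Nat.sqrt_le_add k.sqrt
      unfold codePeriod at h
      rw [h] at h2
      omega
    simp [codeLeft, gridLeft, h, h1]
  · have h1 : (1 : ℝ) ≤ codePeriod k := by exact_mod_cast h
    linarith [le_codeLeft k]

theorem tendsto_codePeriod : Tendsto codePeriod atTop atTop := by
  have h : Tendsto Nat.sqrt atTop atTop :=
    tendsto_atTop_atTop.2 fun b => ⟨b * b, fun a ha => Nat.le_sqrt.2 ha⟩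
  exact h.comp h

theorem codeLeft_nonneg (k : ℕ) : 0 ≤ codeLeft k := by linarith [half_le_codeLeft k]

theorem codeRight_nonneg (k : ℕ) : 0 ≤ codeRight k := by
  have : (0 : ℝ) ≤ codePeriod k := by positivity
  linarith [le_codeRight k]

/-! ### The cut-off and the visited times -/

/-- The rescaled position in the second half of the `k`-th period; the excursion takes place
in `[0, 1]`. -/
noncomputable def window (k : ℕ) (x : ℝ) : ℝ := 2 * (k + 2) * (x - 1 / 2)

/-- The cut-off in the `k`-th period. -/
noncomputable def cutoff (k : ℕ) (x : ℝ) : ℝ := clamp (3 * window k x)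

/-- The times visited during the excursion in the `k`-th period. -/
noncomputable def excursion (k : ℕ) (x : ℝ) : ℝ :=
  -- One leg for each third of the window: rest at a half-integer phase, where the ray is near the
  -- origin, while the cut-off opens; move to `codeLeft k`; sweep to `codeRight k`.
  time (codePeriod k + 1 / 2)
    + (time (codeLeft k) - time (codePeriod k + 1 / 2)) * clamp (3 * window k x - 1)
    - (time (codeLeft k) - time (codeRight k)) * clamp (3 * window k x - 2)

/-- The times visited in the second half of the `k`-th period. -/
noncomputable def visit (k : ℕ) (x : ℝ) : ℝ :=
  -- The second entry is zero until the window reaches 1 and equals the height from 2 on. The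
  -- excursion keeps the maximum positive, so that a point of the ray is always visited.
  max (excursion k x) (clamp (window k x - 1) * height x)

@[fun_prop]
theorem continuous_window (k : ℕ) : Continuous (window k) := by unfold window; fun_prop

@[fun_prop]
theorem continuous_cutoff (k : ℕ) : Continuous (cutoff k) := by unfold cutoff; fun_prop

@[fun_prop]
theorem continuous_excursion (k : ℕ) : Continuous (excursion k) := by unfold excursion; fun_prop

@[fun_prop]
theorem continuous_visit (k : ℕ) : Continuous (visit k) := by unfold visit; fun_prop

theorem time_codeRight_le (k : ℕ) : time (codeRight k) ≤ time (codePeriod k + 1 / 2) :=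
  time_le_time (by positivity) (le_codeRight k)

theorem le_time_codeLeft (k : ℕ) : time (codePeriod k + 1 / 2) ≤ time (codeLeft k) :=
  time_le_time (codeLeft_nonneg k) (codeLeft_le k)

theorem excursion_mem (k : ℕ) (x : ℝ) :
    excursion k x ∈ Icc (time (codeRight k)) (time (codeLeft k)) := by
  have h1 := time_codeRight_le k
  have h2 := le_time_codeLeft k
  unfold excursion
  rcases le_total (3 * window k x) 2 with h | h
  · rw [clamp_of_le (y := 3 * window k x - 2) (by linarith)]
    have h3 := clamp_nonneg (3 * window k x - 1)
    have h4 := clamp_le_one (3 * window k x - 1)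
    constructor <;> nlinarith
  · rw [clamp_of_ge (y := 3 * window k x - 1) (by linarith)]
    have h3 := clamp_nonneg (3 * window k x - 2)
    have h4 := clamp_le_one (3 * window k x - 2)
    constructor <;> nlinarith

theorem visit_pos (k : ℕ) (x : ℝ) : 0 < visit k x :=
  (time_pos (codeRight_nonneg k)).trans_le ((excursion_mem k x).1.trans (le_max_left _ _))

theorem visit_le_one (k : ℕ) (x : ℝ) : visit k x ≤ 1 :=
  max_le ((excursion_mem k x).2.trans (time_le_one (by linarith [half_le_codeLeft k])))
    (mul_le_one₀ (clamp_le_one _) (height_nonneg x) (height_le_one x))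

theorem visit_one (k : ℕ) : visit k 1 = 1 := by
  refine le_antisymm (visit_le_one k 1) (le_trans ?_ (le_max_right _ _))
  rw [height_one, clamp_of_ge, mul_one]
  have : (0 : ℝ) ≤ k := by positivity
  unfold window
  linarith

theorem cutoff_of_le {k : ℕ} {x : ℝ} (h : x ≤ 1 / 2) : cutoff k x = 0 := by
  refine clamp_of_le ?_
  unfold window
  have : (0 : ℝ) ≤ k := by positivity
  nlinarith

/-! ### The coordinates of the ray and their continuity -/

/-- The coordinates of index at least one of the ray. -/
noncomputable def coord : ℕ → ℝ → ℝ
  | 0, t => warsawFun t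
  | i + 1, t => cutoff ⌊phase t⌋.toNat (Int.fract (phase t)) *
      coord i (visit ⌊phase t⌋.toNat (Int.fract (phase t))) / 2

theorem coord_mem (i : ℕ) {t : ℝ} (h0 : 0 < t) (h1 : t ≤ 1) : coord i t ∈ Icc (0 : ℝ) 1 := by
  induction i generalizing t with
  | zero => exact ⟨warsawFun_nonneg h0.le h1, warsawFun_le_one t⟩
  | succ i ih =>
    have h := ih (visit_pos ⌊phase t⌋.toNat (Int.fract (phase t))) (visit_le_one _ _)
    have h2 := clamp_nonneg (3 * window ⌊phase t⌋.toNat (Int.fract (phase t)))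
    have h3 := clamp_le_one (3 * window ⌊phase t⌋.toNat (Int.fract (phase t)))
    rw [← cutoff] at h2 h3
    rw [coord]
    constructor
    · have := mul_nonneg h2 h.1
      linarith
    · have := mul_le_one₀ h3 h.1 h.2
      linarith

/-- A function that is continuous on each period and vanishes at the integers is continuous. -/
theorem continuous_glue {g : ℕ → ℝ → ℝ} (hg : ∀ k, ContinuousOn (g k) (Icc 0 1))
    (h0 : ∀ k, g k 0 = 0) (h1 : ∀ k, g k 1 = 0) :
    Continuous fun w : ℝ => g ⌊w⌋.toNat (Int.fract w) := by
  have key : ∀ n : ℤ, ContinuousOn (fun w : ℝ => g ⌊w⌋.toNat (Int.fract w)) (Icc n (n + 1)) := by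
    intro n
    have h2 : ContinuousOn (fun w : ℝ => g n.toNat (w - n)) (Icc n (n + 1)) :=
      (hg n.toNat).comp (by fun_prop) fun w hw => ⟨by linarith [hw.1], by linarith [hw.2]⟩
    refine h2.congr fun w hw => ?_
    -- At the right endpoint the floor jumps to the next period; both formulas give zero there.
    rcases eq_or_lt_of_le hw.2 with h | h
    · subst h
      have h3 : ⌊(n : ℝ) + 1⌋ = n + 1 := by
        rw [Int.floor_eq_iff]; push_cast; constructor <;> linarith
      simp [h1, h0]
    · have h3 : ⌊w⌋ = n := Int.floor_eq_iff.2 ⟨hw.1, h⟩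
      simp only [Int.fract, h3]
  rw [continuous_iff_continuousAt]
  intro w
  have h2 := (key (⌊w⌋ - 1)).union_of_isClosed (key ⌊w⌋) isClosed_Icc isClosed_Icc
  refine h2.continuousAt ?_
  have h3 := Int.floor_le w
  have h4 := Int.lt_floor_add_one w
  have h5 : Ioo ((⌊w⌋ : ℝ) - 1) (⌊w⌋ + 1) ∈ 𝓝 w := Ioo_mem_nhds (by linarith) h4
  filter_upwards [h5] with v hv
  push_cast
  rw [sub_add_cancel]
  rcases le_total v ⌊w⌋ with h | h
  · exact Or.inl ⟨hv.1.le, h⟩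
  · exact Or.inr ⟨h, hv.2.le⟩

theorem phase_one : phase 1 = 1 / 4 := by norm_num [phase]

/-- Time 1 has phase `1/4`, in the half period where the cut-off vanishes. Since each period ends
with a visit to time 1, consecutive periods fit together. -/
theorem coord_one (i : ℕ) : coord i 1 = 0 := by
  cases i with
  | zero => exact warsawFun_one
  | succ i =>
    have h : ⌊(1 / 4 : ℝ)⌋ = 0 := by norm_num
    rw [coord, phase_one, cutoff_of_le]
    · simp
    · rw [Int.fract, h]; norm_num

theorem continuousOn_coord (i : ℕ) : ContinuousOn (coord i) (Ioc 0 1) := by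
  induction i with
  | zero => exact continuousOn_warsawFun.mono fun t ht => ht.1
  | succ i ih =>
    have h := continuous_glue (g := fun k x => cutoff k x * coord i (visit k x) / 2)
      (fun k => ((continuous_cutoff k).continuousOn.mul (ih.comp (continuous_visit k).continuousOn
        fun x _ => ⟨visit_pos k x, visit_le_one k x⟩)).div_const 2)
      (fun k => by simp [cutoff_of_le]) (fun k => by simp [visit_one, coord_one])
    exact h.comp_continuousOn (continuousOn_phase.mono fun t ht => ht.1)

/-- The ray, parametrized by the time in `(0, 1]`. -/
noncomputable def ray (t : ℝ) : HilbertCube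
  | 0 => projIcc 0 1 zero_le_one t
  | i + 1 => projIcc 0 1 zero_le_one (coord i t)

section Ray

variable {t : ℝ}

theorem ray_zero (h0 : 0 < t) (h1 : t ≤ 1) : (ray t 0 : ℝ) = t := by
  change ((projIcc (0 : ℝ) 1 zero_le_one t : unitInterval) : ℝ) = t
  rw [projIcc_of_mem zero_le_one ⟨h0.le, h1⟩]

theorem ray_succ (h0 : 0 < t) (h1 : t ≤ 1) (i : ℕ) : (ray t (i + 1) : ℝ) = coord i t := by
  change ((projIcc (0 : ℝ) 1 zero_le_one (coord i t) : unitInterval) : ℝ) = coord i t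
  rw [projIcc_of_mem zero_le_one (coord_mem i h0 h1)]

theorem ray_one : ray 1 = HilbertCube.edgePoint 1 :=
  HilbertCube.ext_coord fun i => by
    cases i with
    | zero => rw [ray_zero one_pos le_rfl, HilbertCube.edgePoint_zero zero_le_one le_rfl]
    | succ i => rw [ray_succ one_pos le_rfl, coord_one, HilbertCube.edgePoint_succ]

theorem continuousOn_ray : ContinuousOn ray (Ioc 0 1) :=
  HilbertCube.continuousOn_of_coord fun i => by
    cases i with
    | zero => exact continuousOn_id.congr fun t ht => ray_zero ht.1 ht.2
    | succ i => exact (continuousOn_coord i).congr fun t ht => ray_succ ht.1 ht.2 i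

end Ray

/-- The ray in the phase variable. -/
noncomputable def phaseRay (w : ℝ) : HilbertCube := ray (time w)

theorem phaseRay_zero {w : ℝ} (h : 1 / 4 ≤ w) : (phaseRay w 0 : ℝ) = time w :=
  ray_zero (time_pos (by linarith)) (time_le_one h)

theorem phaseRay_one {w : ℝ} (h : 3 / 4 ≤ w) :
    (phaseRay w 1 : ℝ) = height w / 2 + 3 / 4 * time w := by
  rw [← warsawFun_time h]
  exact ray_succ (time_pos (by linarith)) (time_le_one (by linarith)) 0

theorem phaseRay_succ_succ {k : ℕ} {x : ℝ} (hx0 : 0 ≤ x) (hx1 : x ≤ 1) (h : 1 / 4 ≤ k + x) (i : ℕ) :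
    (phaseRay (k + x) (i + 2) : ℝ) = cutoff k x * coord i (visit k x) / 2 := by
  have h2 : (phaseRay (k + x) (i + 2) : ℝ) = coord (i + 1) (time (k + x)) :=
    ray_succ (time_pos (by linarith)) (time_le_one h) (i + 1)
  rw [h2, coord, phase_time (by linarith)]
  rcases eq_or_lt_of_le hx1 with rfl | hx
  · have h3 : ⌊(k : ℝ) + 1⌋ = k + 1 := by
      rw [Int.floor_eq_iff]; push_cast; constructor <;> linarith
    rw [Int.fract, h3, visit_one, coord_one, cutoff_of_le]
    · simp
    · push_cast; linarith
  · have h3 : ⌊(k : ℝ) + x⌋ = k := by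
      rw [Int.floor_eq_iff]; push_cast; constructor <;> linarith
    rw [Int.fract, h3, Int.toNat_natCast, Int.cast_natCast, add_sub_cancel_left]

open HilbertCube

/-! ### The asymptotic behaviour of the ray -/

/-- The height has a double zero at `1/2`: it is at most `π² e²`, and the crude bound `10 e` is
enough. -/
theorem height_half_add_le {k : ℕ} {e : ℝ} (h0 : 0 ≤ e) (h1 : e ≤ 1 / (k + 2)) :
    height (1 / 2 + e) ≤ 10 / (k + 2) := by
  have h2 : height (1 / 2 + e) = (1 - Real.cos (2 * Real.pi * e)) / 2 := by
    unfold height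
    rw [show 2 * Real.pi * (1 / 2 + e) = 2 * Real.pi * e + Real.pi by ring, Real.cos_add_pi]
    ring
  have h3 := Real.one_sub_sq_div_two_le_cos (x := 2 * Real.pi * e)
  have h4 : Real.pi ^ 2 ≤ 10 := by nlinarith [Real.pi_lt_d2, Real.pi_pos]
  have h5 : e ≤ 1 := h1.trans (by
    rw [div_le_one (by positivity)]
    have : (0 : ℝ) ≤ k := by positivity
    linarith)
  have h6 : e ^ 2 ≤ e := by nlinarith
  have h7 : Real.pi ^ 2 * e ^ 2 ≤ 10 * e :=
    mul_le_mul h4 h6 (by positivity) (by norm_num)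
  have h8 : (10 : ℝ) / (k + 2) = 10 * (1 / (k + 2)) := by ring
  rw [h2, h8]
  nlinarith

/-- The error of the approximation of the ray by its scaled copy in the `k`-th period. -/
noncomputable def err (k : ℕ) : ℝ := time k + time (codeLeft k) + 10 / (k + 2)

theorem tendsto_codeLeft : Tendsto codeLeft atTop atTop := by
  refine tendsto_atTop_mono le_codeLeft ?_
  exact tendsto_atTop_add_const_right _ _
    (tendsto_natCast_atTop_atTop.comp tendsto_codePeriod)

theorem tendsto_err : Tendsto err atTop (𝓝 0) := by
  have h1 : Tendsto (fun k : ℕ => time (k : ℝ)) atTop (𝓝 0) :=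
    tendsto_time.comp tendsto_natCast_atTop_atTop
  have h2 : Tendsto (fun k : ℕ => time (codeLeft k)) atTop (𝓝 0) :=
    tendsto_time.comp tendsto_codeLeft
  have h3 : Tendsto (fun k : ℕ => (10 : ℝ) / (k + 2)) atTop (𝓝 0) :=
    tendsto_const_nhds.div_atTop
      (tendsto_atTop_add_const_right _ _ tendsto_natCast_atTop_atTop)
  have h4 := (h1.add h2).add h3
  rw [add_zero, add_zero] at h4
  exact h4

section Estimates

variable {k : ℕ} {x : ℝ}

theorem le_of_window_le {c : ℝ} (h : window k x ≤ c) : x - 1 / 2 ≤ c / 2 * (1 / (k + 2)) := by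
  unfold window at h
  have : (0 : ℝ) < k + 2 := by positivity
  rw [mul_one_div, le_div_iff₀ this]
  linarith

theorem visit_le_max : visit k x ≤ max (time (codeLeft k)) (height x) :=
  max_le_max (excursion_mem k x).2 (mul_le_of_le_one_left (height_nonneg x) (clamp_le_one _))

theorem visit_of_window_le_one (h : window k x ≤ 1) : visit k x = excursion k x := by
  rw [visit, clamp_of_le (by linarith), zero_mul]
  exact max_eq_left ((time_pos (codeRight_nonneg k)).le.trans (excursion_mem k x).1)

theorem excursion_of_one_le_window (h : 1 ≤ window k x) : excursion k x = time (codeRight k) := by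
  rw [excursion, clamp_of_ge (by linarith), clamp_of_ge (by linarith)]
  ring

theorem visit_of_two_le_window (h : 2 ≤ window k x) (h2 : time (codeRight k) ≤ height x) :
    visit k x = height x := by
  rw [visit, excursion_of_one_le_window (by linarith), clamp_of_ge (by linarith), one_mul,
    max_eq_right h2]

/-- The visited time exceeds the height only through the excursion, and falls below it only while
the window is at most 2, where the height itself is of order `1/k`. -/
theorem abs_height_sub_visit_le (hx : 1 / 2 ≤ x) :
    |height x - visit k x| ≤ time (codeLeft k) + 10 / (k + 2) := by
  have h1 : visit k x ≤ time (codeLeft k) + height x :=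
    visit_le_max.trans (max_le_add_of_nonneg (time_pos (codeLeft_nonneg k)).le (height_nonneg x))
  have h2 : (0 : ℝ) ≤ 10 / (k + 2) := by positivity
  have h3 := (time_pos (codeLeft_nonneg k)).le
  rw [abs_le]
  refine ⟨by linarith, ?_⟩
  rcases le_total (window k x) 2 with h | h
  · have h4 := le_of_window_le h
    have h5 := height_half_add_le (k := k) (e := x - 1 / 2) (by linarith) (by linarith)
    rw [add_sub_cancel] at h5
    linarith [visit_pos k x]
  · have h4 : clamp (window k x - 1) * height x ≤ visit k x := le_max_right _ _
    rw [clamp_of_ge (by linarith), one_mul] at h4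
    linarith

/-- Intermediate value theorem on the last leg of the excursion, window `2/3` to `1`. The weaker
lower bound `1/3` is the one required by `dist_phaseRay_ray_le`. -/
theorem exists_visit_eq {r : ℝ} (h : r ∈ Icc (time (codeRight k)) (time (codeLeft k))) :
    ∃ x, 1 / 3 ≤ window k x ∧ window k x ≤ 1 ∧ visit k x = r := by
  have hN : (0 : ℝ) < k + 2 := by positivity
  have hw : ∀ c : ℝ, window k (1 / 2 + c / (2 * (k + 2))) = c := fun c => by
    unfold window
    field_simp
    ring
  have hle : (1 / 2 + (2 / 3) / (2 * (k + 2)) : ℝ) ≤ 1 / 2 + 1 / (2 * (k + 2)) := by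
    gcongr; norm_num
  have hmono : ∀ x ∈ Icc (1 / 2 + (2 / 3) / (2 * (k + 2)) : ℝ) (1 / 2 + 1 / (2 * (k + 2))),
      1 / 3 ≤ window k x ∧ window k x ≤ 1 := by
    rintro x ⟨hx1, hx2⟩
    have h1 : window k (1 / 2 + (2 / 3) / (2 * (k + 2))) ≤ window k x := by
      unfold window; gcongr
    have h2 : window k x ≤ window k (1 / 2 + 1 / (2 * (k + 2))) := by
      unfold window; gcongr
    rw [hw] at h1 h2
    exact ⟨by linarith, h2⟩
  have hivt := intermediate_value_Icc' hle (continuous_excursion k).continuousOn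
  have hA : excursion k (1 / 2 + (2 / 3) / (2 * (k + 2))) = time (codeLeft k) := by
    rw [excursion, hw, clamp_of_ge (by norm_num), clamp_of_le (by norm_num)]
    ring
  have hB : excursion k (1 / 2 + 1 / (2 * (k + 2))) = time (codeRight k) :=
    excursion_of_one_le_window (hw 1).ge
  rw [hA, hB] at hivt
  obtain ⟨x, hx, rfl⟩ := hivt h
  exact ⟨x, (hmono x hx).1, (hmono x hx).2, visit_of_window_le_one (hmono x hx).2⟩

theorem one_le_of_codePeriod (hk : 1 ≤ codePeriod k) : (1 : ℝ) ≤ k := by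
  have h1 : 1 ≤ k := hk.trans ((Nat.sqrt_le_self _).trans (Nat.sqrt_le_self _))
  exact_mod_cast h1

theorem time_add_le (hx : 0 ≤ x) : time (k + x) ≤ time k :=
  time_le_time (by positivity) (by linarith)

theorem dist_phaseRay_edge_le (hk : 1 ≤ codePeriod k) (h0 : 0 ≤ x) (h1 : x ≤ 1 / 2) :
    dist (phaseRay (k + x)) (halfShift (edgePoint (height x))) ≤ err k := by
  have hk1 := one_le_of_codePeriod hk
  have ht := time_add_le (k := k) h0
  have ht0 := (time_pos (w := k + x) (by linarith)).le
  have hA := (time_pos (codeLeft_nonneg k)).le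
  have h2 : (0 : ℝ) ≤ 10 / (k + 2) := by positivity
  have herr : time (k + x) ≤ err k := by unfold err; linarith
  refine dist_le_of_forall fun i => ?_
  match i with
  | 0 =>
    rw [phaseRay_zero (by linarith), halfShift_zero, sub_zero, abs_of_nonneg ht0]
    exact herr
  | 1 =>
    rw [phaseRay_one (by linarith), halfShift_succ,
      edgePoint_zero (height_nonneg x) (height_le_one x), height_nat_add, add_sub_cancel_left,
      abs_of_nonneg (by positivity)]
    linarith
  | i + 2 =>
    rw [phaseRay_succ_succ h0 (by linarith) (by linarith), cutoff_of_le h1, halfShift_succ,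
      edgePoint_succ]
    simpa using ht0.trans herr

/-- At half-integer phases the height and the cut-off both vanish, so the ray is close to the
origin. This is why the cut-off may open while such a time is being visited. -/
theorem coord_special {m : ℕ} (hm : 1 ≤ m) (i : ℕ) :
    coord i (time (m + 1 / 2)) ≤ time (m + 1 / 2) := by
  have hm1 : (1 : ℝ) ≤ m := by exact_mod_cast hm
  have ht0 := (time_pos (w := m + 1 / 2) (by linarith)).le
  cases i with
  | zero =>
    have h1 := phaseRay_one (w := m + 1 / 2) (by linarith)
    have h2 : height (m + 1 / 2) = 0 := by
      rw [height_nat_add, height, show 2 * Real.pi * (1 / 2) = Real.pi by ring, Real.cos_pi]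
      norm_num
    rw [coord, warsawFun_time (by linarith), h2]
    linarith
  | succ i =>
    have h3 : ⌊(m : ℝ) + 1 / 2⌋ = m := by
      rw [Int.floor_eq_iff]; push_cast; constructor <;> linarith
    rw [coord, phase_time (by linarith), cutoff_of_le]
    · simpa using ht0
    · rw [Int.fract, h3]; push_cast; linarith

/-- While the cut-off opens, the visited time rests at a half-integer phase, and `coord_special`
makes the higher coordinates small whatever the cut-off is. -/
theorem dist_phaseRay_corner_le (hk : 1 ≤ codePeriod k) (h0 : 1 / 2 ≤ x) (hx1 : x ≤ 1)
    (h1 : window k x ≤ 1 / 3) :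
    dist (phaseRay (k + x)) (edgePoint 0) ≤ err k := by
  have hk1 := one_le_of_codePeriod hk
  have ht := time_add_le (k := k) (x := x) (by linarith)
  have ht0 := (time_pos (w := k + x) (by linarith)).le
  have hA := (time_pos (codeLeft_nonneg k)).le
  have h2 : (0 : ℝ) ≤ 10 / (k + 2) := by positivity
  have herr : time (k + x) ≤ err k := by unfold err; linarith
  refine dist_le_of_forall fun i => ?_
  match i with
  | 0 =>
    rw [phaseRay_zero (by linarith), edgePoint_zero le_rfl zero_le_one, sub_zero,
      abs_of_nonneg ht0]
    exact herr
  | 1 =>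
    have h4 := le_of_window_le h1
    have h6 : (0 : ℝ) ≤ 1 / (k + 2) := by positivity
    have h5 := height_half_add_le (k := k) (e := x - 1 / 2) (by linarith) (by linarith)
    rw [add_sub_cancel] at h5
    have h7 := height_nonneg x
    rw [phaseRay_one (by linarith), edgePoint_succ, height_nat_add, sub_zero,
      abs_of_nonneg (by positivity)]
    unfold err
    linarith
  | i + 2 =>
    have h3 : visit k x = time (codePeriod k + 1 / 2) := by
      rw [visit_of_window_le_one (by linarith), excursion, clamp_of_le (by linarith),
        clamp_of_le (by linarith)]
      ring
    have h4 := coord_special hk i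
    have h5 := (coord_mem i (visit_pos k x) (visit_le_one k x)).1
    have h6 := clamp_nonneg (3 * window k x)
    have h7 := clamp_le_one (3 * window k x)
    rw [← cutoff] at h6 h7
    rw [phaseRay_succ_succ (by linarith) hx1 (by linarith), edgePoint_succ, sub_zero,
      abs_of_nonneg (by positivity)]
    have h8 : cutoff k x * coord i (visit k x) ≤ coord i (visit k x) :=
      mul_le_of_le_one_left h5 h7
    rw [h3] at h8 h5 ⊢
    have h9 := le_time_codeLeft k
    unfold err
    linarith [time_pos (w := k) (by linarith)]

/-- The cut-off is now 1, so coordinates of index at least 2 agree exactly; the error comes from the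
time and from the difference of height and visited time. -/
theorem dist_phaseRay_ray_le (hk : 1 ≤ codePeriod k) (hx1 : x ≤ 1) (h1 : 1 / 3 ≤ window k x) :
    dist (phaseRay (k + x)) (halfShift (ray (visit k x))) ≤ err k := by
  have hx : 1 / 2 ≤ x := by
    by_contra! hlt
    have : window k x < 0 := by
      unfold window
      have : (0 : ℝ) < 2 * (k + 2) := by positivity
      nlinarith
    linarith
  have hk1 := one_le_of_codePeriod hk
  have ht := time_add_le (k := k) (x := x) (by linarith)
  have ht0 := (time_pos (w := k + x) (by linarith)).le
  have hA := (time_pos (codeLeft_nonneg k)).le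
  have h2 : (0 : ℝ) ≤ 10 / (k + 2) := by positivity
  have herr : time (k + x) ≤ err k := by unfold err; linarith
  refine dist_le_of_forall fun i => ?_
  match i with
  | 0 =>
    rw [phaseRay_zero (by linarith), halfShift_zero, sub_zero, abs_of_nonneg ht0]
    exact herr
  | 1 =>
    have h3 := abs_height_sub_visit_le (k := k) hx
    rw [phaseRay_one (by linarith), halfShift_succ, ray_zero (visit_pos k x) (visit_le_one k x),
      height_nat_add]
    rw [abs_le] at h3 ⊢
    unfold err
    constructor <;> linarith [h3.1, h3.2]
  | i + 2 =>
    rw [phaseRay_succ_succ (by linarith) hx1 (by linarith), halfShift_succ,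
      ray_succ (visit_pos k x) (visit_le_one k x), cutoff, clamp_of_ge (by linarith)]
    simpa using ht0.trans herr

end Estimates

/-! ### The circuit and its shadowing by the ray -/

/-- The arc in the limit continuum that runs through the base edge and then, backwards, through
the ray. -/
noncomputable def circuit (d : ℝ) : HilbertCube :=
  if d ≤ 1 / 2 then edgePoint (height (1 / 2 + d)) else ray (height (1 / 2 + d))

theorem circuit_of_le {d : ℝ} (h : d ≤ 1 / 2) : circuit d = edgePoint (height (1 / 2 + d)) :=
  if_pos h

theorem circuit_of_ge {d : ℝ} (h : 1 / 2 ≤ d) : circuit d = ray (height (1 / 2 + d)) := by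
  rcases eq_or_lt_of_le h with rfl | h
  · rw [circuit_of_le le_rfl, show (1 / 2 + 1 / 2 : ℝ) = 1 by norm_num, height_one, ray_one]
  · exact if_neg (not_le.2 h)

theorem height_half_sub (d : ℝ) : height (1 / 2 - d) = height (1 / 2 + d) := by
  unfold height
  rw [← Real.cos_neg, show -(2 * Real.pi * (1 / 2 - d)) = 2 * Real.pi * (1 / 2 + d) - 2 * Real.pi
    by ring, Real.cos_sub_two_pi]

theorem height_three_half_sub (d : ℝ) : height (3 / 2 - d) = height (1 / 2 + d) := by
  rw [← height_half_sub, ← height_nat_add 1 (1 / 2 - d)]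
  congr 1
  push_cast
  ring

theorem height_eq_sq (d : ℝ) : height (1 / 2 + d) = Real.sin (Real.pi * d) ^ 2 := by
  unfold height
  rw [show 2 * Real.pi * (1 / 2 + d) = 2 * (Real.pi * d) + Real.pi by ring, Real.cos_add_pi,
    Real.cos_two_mul, Real.sin_sq]
  ring

theorem height_pos {d : ℝ} (h0 : 0 < d) (h1 : d < 1) : 0 < height (1 / 2 + d) := by
  rw [height_eq_sq]
  have := Real.sin_pos_of_pos_of_lt_pi (x := Real.pi * d) (by positivity)
    (by nlinarith [Real.pi_pos])
  positivity

theorem height_le_height {b d : ℝ} (hb : 1 / 2 ≤ b) (hbd : b ≤ d) (hd : d ≤ 1) :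
    height (1 / 2 + d) ≤ height (1 / 2 + b) := by
  unfold height
  have hpi := Real.pi_pos
  have h1 : ∀ c : ℝ, Real.cos (2 * Real.pi * (1 / 2 + c)) = Real.cos (2 * Real.pi * (c - 1 / 2)) :=
    fun c => by
      rw [← Real.cos_sub_two_pi]
      congr 1
      ring
  rw [h1, h1]
  have := Real.cos_le_cos_of_nonneg_of_le_pi (x := 2 * Real.pi * (b - 1 / 2))
    (y := 2 * Real.pi * (d - 1 / 2)) (by nlinarith) (by nlinarith) (by nlinarith)
  linarith

/-- Far out, the ray follows the scaled copy of the circuit, backwards. -/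
theorem eventually_dist_circuit_lt {D ε : ℝ} (hD : D < 1) (hε : 0 < ε) :
    ∀ᶠ k : ℕ in atTop, ∀ d ∈ Icc 0 D,
      dist (phaseRay (k + 1 / 2 - d)) (halfShift (circuit d)) < ε := by
  have hD' : max D (1 / 2) < 1 := max_lt hD (by norm_num)
  have hDpos : (0 : ℝ) < max D (1 / 2) := lt_max_of_lt_right (by norm_num)
  have hcode : Tendsto (fun k => time (codeRight k)) atTop (𝓝 0) := by
    refine squeeze_zero (fun k => (time_pos (codeRight_nonneg k)).le)
      (fun k => (time_codeRight_le k).trans (le_time_codeLeft k))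
      (tendsto_time.comp tendsto_codeLeft)
  have h1 : ∀ᶠ k : ℕ in atTop, 1 ≤ codePeriod k := tendsto_codePeriod.eventually_ge_atTop 1
  have h2 : ∀ᶠ k : ℕ in atTop, err k < ε := tendsto_err.eventually_lt_const hε
  have h3 : ∀ᶠ k : ℕ in atTop, time (codeRight k) < height (1 / 2 + max D (1 / 2)) :=
    hcode.eventually_lt_const (height_pos hDpos hD')
  have h4 : ∀ᶠ k : ℕ in atTop, 1 / (1 - max D (1 / 2)) ≤ (k : ℝ) :=
    tendsto_natCast_atTop_atTop.eventually_ge_atTop _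
  obtain ⟨N, hN⟩ := eventually_atTop.1 (((h1.and h2).and h3).and h4)
  filter_upwards [eventually_ge_atTop (N + 1)] with k hk d hd
  rcases le_total d (1 / 2) with hd2 | hd2
  · obtain ⟨⟨⟨hk1, hk2⟩, -⟩, -⟩ := hN k (by omega)
    rw [circuit_of_le hd2, ← height_half_sub, add_sub_assoc]
    exact (dist_phaseRay_edge_le hk1 (by linarith) (by linarith [hd.1])).trans_lt hk2
  · obtain ⟨n, rfl⟩ := Nat.exists_eq_add_of_le' (show 1 ≤ k by omega)
    obtain ⟨⟨⟨hk1, hk2⟩, hk3⟩, hk4⟩ := hN n (by omega)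
    have hdD : d ≤ max D (1 / 2) := hd.2.trans (le_max_left _ _)
    rw [div_le_iff₀ (by linarith)] at hk4
    -- The window is `2 (n + 2) (1 - d)` and `d` stays away from 1, so far out the excursion is over
    -- and the visited time equals the height.
    have hw : 2 ≤ window n (3 / 2 - d) := by
      unfold window
      have : (0 : ℝ) ≤ n := by positivity
      nlinarith
    have hv : visit n (3 / 2 - d) = height (1 / 2 + d) := by
      rw [visit_of_two_le_window hw, height_three_half_sub]
      rw [height_three_half_sub]
      exact hk3.le.trans (height_le_height hd2 hdD hD'.le)
    have h5 := dist_phaseRay_ray_le (k := n) (x := 3 / 2 - d) hk1 (by linarith) (by linarith)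
    rw [hv, ← circuit_of_ge hd2] at h5
    push_cast
    rw [show (n : ℝ) + 1 + 1 / 2 - d = n + (3 / 2 - d) by ring]
    exact h5.trans_lt hk2

/-! ### The limit continuum and its circuit -/

/-- The origin of the Hilbert cube. -/
noncomputable abbrev origin : HilbertCube := edgePoint 0

/-- The limit continuum. -/
def limitContinuum : Set HilbertCube := edgeUnionClosure fun t => ray t

theorem height_half_add_half : height (1 / 2 + 1 / 2) = 1 := by
  rw [show (1 / 2 + 1 / 2 : ℝ) = 1 by norm_num, height_one]

theorem height_half_add_zero : height (1 / 2 + 0) = 0 := by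
  rw [height_eq_sq]; simp

theorem height_half_add_one : height (1 / 2 + 1) = 0 := by
  rw [height_eq_sq]; simp

theorem circuit_zero : circuit 0 = origin := by
  rw [circuit_of_le (by norm_num), height_half_add_zero]

theorem height_mem {d : ℝ} (h : d ∈ Ico (1 / 2 : ℝ) 1) : height (1 / 2 + d) ∈ Ioc (0 : ℝ) 1 :=
  ⟨height_pos (by linarith [h.1]) h.2, height_le_one _⟩

theorem continuousOn_circuit : ContinuousOn circuit (Ico 0 1) := by
  unfold circuit
  refine ContinuousOn.if ?_ (by fun_prop) ?_
  · rintro d ⟨-, hd⟩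
    rw [show {a : ℝ | a ≤ 1 / 2} = Iic (1 / 2) from rfl, frontier_Iic] at hd
    rw [mem_singleton_iff.1 hd, height_half_add_half, ray_one]
  · refine continuousOn_ray.comp (by fun_prop) ?_
    rintro d ⟨hd, hd2⟩
    simp only [not_le] at hd2
    rw [show {a : ℝ | 1 / 2 < a} = Ioi (1 / 2) from rfl, closure_Ioi] at hd2
    exact height_mem ⟨hd2, hd.2⟩

theorem circuit_apply_zero {d : ℝ} (h : d ∈ Ico (0 : ℝ) 1) :
    (circuit d 0 : ℝ) = height (1 / 2 + d) := by
  rcases le_total d (1 / 2) with hd | hd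
  · rw [circuit_of_le hd, edgePoint_zero (height_nonneg _) (height_le_one _)]
  · rw [circuit_of_ge hd, ray_zero (height_mem ⟨hd, h.2⟩).1 (height_le_one _)]

theorem baseEdge_eq_circuit : baseEdge = circuit '' Icc 0 (1 / 2) := by
  rw [baseEdge_eq_image]
  apply Subset.antisymm
  · rintro _ ⟨u, hu, rfl⟩
    have h := intermediate_value_Icc (show (0 : ℝ) ≤ 1 / 2 by norm_num)
      (f := fun d => height (1 / 2 + d)) (by fun_prop)
    simp only [height_half_add_zero, height_half_add_half] at h
    obtain ⟨d, hd, rfl⟩ := h hu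
    exact ⟨d, hd, circuit_of_le hd.2⟩
  · rintro _ ⟨d, hd, rfl⟩
    exact ⟨_, ⟨height_nonneg _, height_le_one _⟩, (circuit_of_le hd.2).symm⟩

theorem exists_circuit_eq_ray {b t : ℝ} (hb : b ∈ Ico (1 / 2 : ℝ) 1) (h0 : 0 < t)
    (h1 : t ≤ height (1 / 2 + b)) : ∃ d ∈ Ico b 1, circuit d = ray t ∧ height (1 / 2 + d) = t := by
  have h := intermediate_value_Icc' hb.2.le (f := fun d => height (1 / 2 + d)) (by fun_prop)
  simp only [height_half_add_one] at h
  obtain ⟨d, hd, rfl⟩ := h ⟨h0.le, h1⟩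
  refine ⟨d, ⟨hd.1, hd.2.lt_of_ne ?_⟩, circuit_of_ge (hb.1.trans hd.1), rfl⟩
  rintro rfl
  simp only [height_half_add_one, lt_irrefl] at h0

theorem ray_image_eq_circuit : ray '' Ioc 0 1 = circuit '' Ico (1 / 2) 1 := by
  apply Subset.antisymm
  · rintro _ ⟨t, ht, rfl⟩
    obtain ⟨d, hd, h, -⟩ := exists_circuit_eq_ray (b := 1 / 2) (by norm_num) ht.1
      (by rw [height_half_add_half]; exact ht.2)
    exact ⟨d, hd, h⟩
  · rintro _ ⟨d, hd, rfl⟩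
    exact ⟨_, height_mem hd, (circuit_of_ge hd.1).symm⟩

theorem range_ray_eq : (range fun t : Ioc (0 : ℝ) 1 => ray t) = circuit '' Ico (1 / 2) 1 := by
  rw [← ray_image_eq_circuit, image_eq_range]

theorem limitContinuum_eq_closure : limitContinuum = closure (circuit '' Ico 0 1) := by
  rw [limitContinuum, edgeUnionClosure, range_ray_eq, ← isCompact_baseEdge.isClosed.closure_eq,
    ← closure_union, baseEdge_eq_circuit, ← image_union,
    Icc_union_Ico_eq_Ico (by norm_num) (by norm_num)]

theorem isCompact_limitContinuum : IsCompact limitContinuum := by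
  rw [limitContinuum_eq_closure]
  exact isClosed_closure.isCompact

theorem circuit_mem {d : ℝ} (h : d ∈ Ico (0 : ℝ) 1) : circuit d ∈ limitContinuum := by
  rw [limitContinuum_eq_closure]
  exact subset_closure (mem_image_of_mem _ h)

theorem ray_mem {t : ℝ} (h : t ∈ Ioc (0 : ℝ) 1) : ray t ∈ limitContinuum :=
  Or.inr (subset_closure ⟨⟨t, h⟩, rfl⟩)

theorem edgePoint_mem {u : ℝ} (h : u ∈ Icc (0 : ℝ) 1) : edgePoint u ∈ limitContinuum :=
  Or.inl (baseEdge_eq_image ▸ mem_image_of_mem _ h)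

theorem origin_mem : origin ∈ limitContinuum := edgePoint_mem (by simp)

theorem isConnected_limitContinuum : IsConnected limitContinuum := by
  rw [limitContinuum_eq_closure]
  exact ((isConnected_Ico zero_lt_one).image _ continuousOn_circuit).closure

/-! ### The limit set of the ray -/

theorem mem_limitSet_iff {E : Type*} [PseudoMetricSpace E] {γ : ℝ≥0 → E} {x : E} :
    x ∈ limitSet γ ↔ ∀ m : ℝ≥0, ∀ ε > 0, ∃ s ≥ m, dist x (γ s) < ε := by
  simp only [limitSet, mem_iInter, Metric.mem_closure_iff, exists_mem_image, mem_Ici, ge_iff_le]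

theorem closure_range_eq {E : Type*} [PseudoMetricSpace E] [T2Space E] {γ : ℝ≥0 → E}
    (hγ : Continuous γ) : closure (range γ) = range γ ∪ limitSet γ := by
  apply Subset.antisymm
  · intro x hx
    by_contra! hx2
    rw [mem_union, not_or, limitSet, mem_iInter, not_forall] at hx2
    obtain ⟨h1, m, h2⟩ := hx2
    have h3 : range γ ⊆ γ '' Icc 0 m ∪ γ '' Ici m := by
      rintro _ ⟨s, rfl⟩
      rcases le_total s m with h | h
      · exact Or.inl ⟨s, ⟨zero_le, h⟩, rfl⟩
      · exact Or.inr ⟨s, h, rfl⟩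
    have h4 := closure_mono h3 hx
    rw [closure_union, (isCompact_Icc.image hγ).isClosed.closure_eq] at h4
    rcases h4 with h4 | h4
    · exact h1 (image_subset_range _ _ h4)
    · exact h2 h4
  · refine union_subset subset_closure ?_
    exact (iInter_subset _ 0).trans (closure_mono (image_subset_range _ _))

theorem eventually_exists_dist_lt {ε : ℝ} (hε : 0 < ε) :
    ∀ᶠ w : ℝ in atTop, ∃ z ∈ limitContinuum, dist (phaseRay w) (halfShift z) < ε := by
  have h1 : ∀ᶠ k : ℕ in atTop, 1 ≤ codePeriod k := tendsto_codePeriod.eventually_ge_atTop 1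
  have h2 : ∀ᶠ k : ℕ in atTop, err k < ε := tendsto_err.eventually_lt_const hε
  obtain ⟨N, hN⟩ := eventually_atTop.1 (h1.and h2)
  filter_upwards [eventually_ge_atTop (N : ℝ)] with w hw
  have hw0 : 0 ≤ w := le_trans (by positivity) hw
  obtain ⟨hk1, hk2⟩ := hN ⌊w⌋₊ (Nat.le_floor hw)
  obtain ⟨x, hx⟩ : ∃ x, x = w - ⌊w⌋₊ := ⟨_, rfl⟩
  have hx0 : 0 ≤ x := by linarith [Nat.floor_le hw0]
  have hx1 : x ≤ 1 := by linarith [Nat.lt_floor_add_one w]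
  rw [show w = ⌊w⌋₊ + x by linarith]
  generalize ⌊w⌋₊ = k at hk1 hk2
  rcases le_total x (1 / 2) with h | h
  · exact ⟨_, edgePoint_mem ⟨height_nonneg x, height_le_one x⟩,
      (dist_phaseRay_edge_le hk1 hx0 h).trans_lt hk2⟩
  rcases le_total (window k x) (1 / 3) with h3 | h3
  · refine ⟨_, origin_mem, ?_⟩
    rw [halfShift_edgePoint_zero]
    exact (dist_phaseRay_corner_le hk1 h hx1 h3).trans_lt hk2
  · exact ⟨_, ray_mem ⟨visit_pos k x, visit_le_one k x⟩,
      (dist_phaseRay_ray_le hk1 hx1 h3).trans_lt hk2⟩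

/-- The ray as a quasi-arc. -/
noncomputable def quasiArc (s : ℝ≥0) : HilbertCube := ray (rayParam s)

theorem rayParam_eq_time (s : ℝ≥0) : (rayParam s : ℝ) = time (1 / 4 + s / 2) := by
  have : (0 : ℝ) ≤ s := s.2
  unfold time
  change 1 / (1 + (s : ℝ)) = _
  field_simp
  ring

theorem quasiArc_eq (s : ℝ≥0) : quasiArc s = phaseRay (1 / 4 + s / 2) := by
  rw [quasiArc, rayParam_eq_time, phaseRay]

theorem continuous_rayParam : Continuous rayParam := by
  refine Continuous.subtype_mk (continuous_const.div (by fun_prop) fun s => ?_) _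
  have : (0 : ℝ) ≤ s := s.2
  positivity

theorem continuous_quasiArc : Continuous quasiArc :=
  continuousOn_ray.comp_continuous (continuous_subtype_val.comp continuous_rayParam)
    fun s => (rayParam s).2

theorem surjective_rayParam : Function.Surjective rayParam := by
  rintro ⟨t, h0, h1⟩
  have h2 : 0 ≤ 1 / t - 1 := by
    rw [sub_nonneg, le_div_iff₀ h0]; linarith
  refine ⟨⟨1 / t - 1, h2⟩, Subtype.ext ?_⟩
  change 1 / (1 + (1 / t - 1)) = t
  field_simp
  ring

theorem injective_rayParam : Function.Injective rayParam := by
  intro s s' h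
  have h2 : 1 / (1 + (s : ℝ)) = 1 / (1 + (s' : ℝ)) := congrArg Subtype.val h
  have : (0 : ℝ) ≤ s := s.2
  have : (0 : ℝ) ≤ s' := s'.2
  rw [one_div, one_div, inv_inj] at h2
  exact NNReal.coe_injective (by linarith)

theorem range_quasiArc : range quasiArc = circuit '' Ico (1 / 2) 1 := by
  rw [← range_ray_eq, ← surjective_rayParam.range_comp]
  rfl

theorem isClosed_limitSet {E : Type*} [TopologicalSpace E] (γ : ℝ≥0 → E) : IsClosed (limitSet γ) :=
  isClosed_iInter fun _ => isClosed_closure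

/-- Every far point of the ray is near the scaled copy, which is closed; conversely each point of
the scaled circuit is approached once in every far period, and the circuit is dense in the
continuum. -/
theorem limitSet_quasiArc : limitSet quasiArc = halfShift '' limitContinuum := by
  apply Subset.antisymm
  · intro x hx
    rw [← (isCompact_limitContinuum.image continuous_halfShift).isClosed.closure_eq,
      Metric.mem_closure_iff]
    intro ε hε
    obtain ⟨W, hW⟩ := eventually_atTop.1 (eventually_exists_dist_lt (half_pos hε))
    obtain ⟨s, hs, h1⟩ := mem_limitSet_iff.1 hx (2 * W).toNNReal (ε / 2) (half_pos hε)
    have h2 : 2 * W ≤ s := (Real.le_coe_toNNReal _).trans (NNReal.coe_le_coe.2 hs)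
    obtain ⟨z, hz, h3⟩ := hW (1 / 4 + s / 2) (by linarith)
    rw [quasiArc_eq] at h1
    refine ⟨_, mem_image_of_mem _ hz, (dist_triangle _ _ _).trans_lt (add_lt_add h1 h3) |>.trans_eq
      (add_halves ε)⟩
  · rw [limitContinuum_eq_closure]
    refine (image_closure_subset_closure_image continuous_halfShift).trans
      (closure_minimal ?_ (isClosed_limitSet _))
    rintro _ ⟨_, ⟨d, hd, rfl⟩, rfl⟩
    rw [mem_limitSet_iff]
    intro m ε hε
    have h1 := eventually_dist_circuit_lt hd.2 hε
    obtain ⟨k, hk, hk2⟩ := (h1.and (tendsto_natCast_atTop_atTop.eventually_ge_atTop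
      ((m : ℝ) + 1))).exists
    have hm : (0 : ℝ) ≤ m := m.2
    have h0 : (m : ℝ) ≤ 2 * (k + 1 / 2 - d - 1 / 4) := by linarith [hd.2]
    obtain ⟨s, hs⟩ : ∃ s : ℝ≥0, (s : ℝ) = 2 * (k + 1 / 2 - d - 1 / 4) :=
      CanLift.prf _ (hm.trans h0)
    refine ⟨s, NNReal.coe_le_coe.1 (hs ▸ h0), ?_⟩
    rw [quasiArc_eq, dist_comm, hs,
      show (1 / 4 : ℝ) + (2 * (k + 1 / 2 - d - 1 / 4)) / 2 = k + 1 / 2 - d by ring]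
    exact hk d ⟨hd.1, le_rfl⟩

/-- Closing the ray adds precisely its limit set, a scaled copy of the whole. All later arguments
rest on this recursion. -/
theorem limitContinuum_eq_union :
    limitContinuum = circuit '' Ico 0 1 ∪ halfShift '' limitContinuum := by
  conv_lhs => rw [limitContinuum, edgeUnionClosure, range_ray_eq, ← range_quasiArc,
    closure_range_eq continuous_quasiArc, limitSet_quasiArc, range_quasiArc, baseEdge_eq_circuit,
    ← union_assoc, ← image_union, Icc_union_Ico_eq_Ico (by norm_num) (by norm_num)]

theorem halfShift_mem {x : HilbertCube} (hx : x ∈ limitContinuum) :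
    halfShift x ∈ limitContinuum := by
  rw [limitContinuum_eq_union]
  exact Or.inr (mem_image_of_mem _ hx)

theorem halfShift_image_subset_closure {b : ℝ} (hb : b < 1) :
    halfShift '' limitContinuum ⊆ closure (circuit '' Ico b 1) := by
  rw [← limitSet_quasiArc]
  have hb' : max b (1 / 2) < 1 := max_lt hb (by norm_num)
  have hpos := (height_mem ⟨le_max_right b (1 / 2), hb'⟩).1
  have hlarge : ∃ m : ℝ≥0, 1 / height (1 / 2 + max b (1 / 2)) ≤ m :=
    ⟨Real.toNNReal _, Real.le_coe_toNNReal _⟩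
  obtain ⟨m, hm⟩ := hlarge
  refine (iInter_subset _ m).trans (closure_mono ?_)
  rintro _ ⟨s, hs, rfl⟩
  have hs' : (m : ℝ) ≤ s := NNReal.coe_le_coe.2 hs
  have h1 : (rayParam s : ℝ) ≤ height (1 / 2 + max b (1 / 2)) := by
    change 1 / (1 + (s : ℝ)) ≤ _
    have : (0 : ℝ) ≤ s := s.2
    rw [div_le_iff₀ hpos] at hm
    rw [div_le_iff₀ (by positivity)]
    nlinarith
  obtain ⟨d, hd, h2, -⟩ := exists_circuit_eq_ray ⟨le_max_right b (1 / 2), hb'⟩ (rayParam s).2.1 h1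
  exact ⟨d, ⟨(le_max_left _ _).trans hd.1, hd.2⟩, h2⟩

/-! ### The loop below the limit continuum -/

/-- The map of the limit continuum onto a simple closed curve. -/
noncomputable def proj (x : HilbertCube) : ℝ × ℝ := (x 0, x 0 * x 1)

@[fun_prop]
theorem continuous_proj : Continuous proj := by unfold proj; fun_prop

/-- The simple closed curve, parametrized by the unit interval. -/
noncomputable def loop (d : ℝ) : ℝ × ℝ :=
  (height (1 / 2 + d),
    if d ≤ 1 / 2 then 0 else height (1 / 2 + d) * warsawFun (height (1 / 2 + d)))

theorem proj_circuit {d : ℝ} (h : d ∈ Ico (0 : ℝ) 1) : proj (circuit d) = loop d := by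
  unfold proj loop
  rw [circuit_apply_zero h]
  split_ifs with hd
  · rw [circuit_of_le hd, edgePoint_succ, mul_zero]
  · have h2 : d ∈ Ico (1 / 2 : ℝ) 1 := ⟨(not_le.1 hd).le, h.2⟩
    rw [circuit_of_ge h2.1]
    congr 2
    exact ray_succ (height_mem h2).1 (height_mem h2).2 0

/-- The factor `x 0` in the second coordinate of `proj` serves this purpose: the plain projection to
two coordinates would keep the limit segment of the Warsaw circle. -/
theorem proj_halfShift (x : HilbertCube) : proj (halfShift x) = 0 := by
  simp [proj]

theorem loop_zero : loop 0 = 0 := by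
  unfold loop
  rw [if_pos (by norm_num), height_half_add_zero]
  rfl

theorem loop_one : loop 1 = 0 := by
  unfold loop
  rw [if_neg (by norm_num), height_half_add_one, zero_mul]
  rfl

theorem continuousOn_mul_warsawFun : ContinuousOn (fun u => u * warsawFun u) (Icc 0 1) := by
  intro u hu
  rcases eq_or_lt_of_le hu.1 with rfl | h
  · rw [ContinuousWithinAt, zero_mul]
    refine squeeze_zero_norm' (a := fun u => u) ?_ (tendsto_id.mono_left nhdsWithin_le_nhds)
    filter_upwards [self_mem_nhdsWithin] with u hu
    rw [Real.norm_of_nonneg (mul_nonneg hu.1 (warsawFun_nonneg hu.1 hu.2))]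
    exact mul_le_of_le_one_right hu.1 (warsawFun_le_one u)
  · exact (continuousAt_id.mul
      (continuousOn_warsawFun.continuousAt (Ioi_mem_nhds h))).continuousWithinAt

theorem continuous_loop : Continuous loop := by
  unfold loop
  refine Continuous.prodMk (by fun_prop) (Continuous.if ?_ continuous_const ?_)
  · intro d hd
    rw [show {a : ℝ | a ≤ 1 / 2} = Iic (1 / 2) from rfl, frontier_Iic] at hd
    rw [mem_singleton_iff.1 hd, height_half_add_half, warsawFun_one, mul_zero]
  · exact continuousOn_mul_warsawFun.comp_continuous (by fun_prop)
      fun d => ⟨height_nonneg _, height_le_one _⟩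

theorem height_injOn_left : InjOn (fun d => height (1 / 2 + d)) (Icc 0 (1 / 2)) := by
  intro d hd e he h
  have hpi := Real.pi_pos
  have h1 : ∀ c : ℝ, Real.cos (2 * Real.pi * (1 / 2 + c)) = -Real.cos (2 * Real.pi * c) :=
    fun c => by
      rw [← Real.cos_add_pi]
      congr 1
      ring
  simp only [height, h1] at h
  have hmem : ∀ c ∈ Icc (0 : ℝ) (1 / 2), 2 * Real.pi * c ∈ Icc 0 Real.pi := fun c hc =>
    ⟨by nlinarith [hc.1], by nlinarith [hc.2]⟩
  exact mul_left_cancel₀ (by positivity)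
    (Real.injOn_cos (hmem d hd) (hmem e he) (by linarith))

theorem height_injOn_right : InjOn (fun d => height (1 / 2 + d)) (Icc (1 / 2) 1) := by
  intro d hd e he h
  have h1 : ∀ c : ℝ, height (1 / 2 + c) = height (1 / 2 + (1 - c)) := fun c => by
    rw [height_eq_sq, height_eq_sq, mul_one_sub, Real.sin_pi_sub]
  have h2 : (1 : ℝ) - d = 1 - e :=
    height_injOn_left ⟨by linarith [hd.2], by linarith [hd.1]⟩
      ⟨by linarith [he.2], by linarith [he.1]⟩ (by
        change height (1 / 2 + (1 - d)) = height (1 / 2 + (1 - e))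
        rw [← h1, ← h1]
        exact h)
  linarith

/-- The second coordinate vanishes on the edge, but is positive on the ray at times strictly between
0 and 1. -/
theorem loop_ne_of_le_of_lt {d e : ℝ} (hd0 : 0 ≤ d) (hd : d ≤ 1 / 2) (he : 1 / 2 < e) (he1 : e ≤ 1)
    (h : loop d = loop e) : d = 0 ∧ e = 1 := by
  have h1 : height (1 / 2 + d) = height (1 / 2 + e) := congrArg Prod.fst h
  have h2 := congrArg Prod.snd h
  simp only [loop, if_pos hd, if_neg (not_le.2 he)] at h2
  rcases eq_or_lt_of_le he1 with rfl | he2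
  · rw [height_half_add_one, ← height_half_add_zero] at h1
    exact ⟨height_injOn_left ⟨hd0, hd⟩ (by simp) h1, rfl⟩
  · have h3 := height_pos (by linarith) he2
    have h4 : height (1 / 2 + e) < 1 := (height_le_one _).lt_of_ne fun h5 => by
      have h6 : (1 / 2 : ℝ) ∈ Icc (1 / 2 : ℝ) 1 := by norm_num
      exact he.ne' (height_injOn_right ⟨he.le, he1⟩ h6 (h5.trans height_half_add_half.symm))
    exact absurd h2.symm (mul_pos h3 (warsawFun_pos h3 h4)).ne'

theorem loop_injOn {d e : ℝ} (hd : d ∈ Icc (0 : ℝ) 1) (he : e ∈ Icc (0 : ℝ) 1)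
    (h : loop d = loop e) : d = e ∨ d = 0 ∧ e = 1 ∨ d = 1 ∧ e = 0 := by
  have h1 : height (1 / 2 + d) = height (1 / 2 + e) := congrArg Prod.fst h
  rcases le_or_gt d (1 / 2) with hd2 | hd2 <;> rcases le_or_gt e (1 / 2) with he2 | he2
  · exact Or.inl (height_injOn_left ⟨hd.1, hd2⟩ ⟨he.1, he2⟩ h1)
  · exact Or.inr (Or.inl (loop_ne_of_le_of_lt hd.1 hd2 he2 he.2 h))
  · exact Or.inr (Or.inr (loop_ne_of_le_of_lt he.1 he2 hd2 hd.2 h.symm).symm)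
  · exact Or.inl (height_injOn_right ⟨hd2.le, hd.2⟩ ⟨he2.le, he.2⟩ h1)

theorem eq_of_loop_eq {d e : ℝ} (hd : d ∈ Icc (0 : ℝ) 1) (he : e ∈ Ioo (0 : ℝ) 1)
    (h : loop d = loop e) : d = e := by
  rcases loop_injOn hd ⟨he.1.le, he.2.le⟩ h with h | h | h
  · exact h
  · exact absurd h.2 he.2.ne
  · exact absurd h.2 he.1.ne'

theorem circuit_injOn : InjOn circuit (Ico 0 1) := by
  intro d hd e he h
  have h2 : loop d = loop e := by rw [← proj_circuit hd, ← proj_circuit he, h]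
  rcases loop_injOn ⟨hd.1, hd.2.le⟩ ⟨he.1, he.2.le⟩ h2 with h | h | h
  · exact h
  · exact absurd h.2 he.2.ne
  · exact absurd h.1 hd.2.ne

theorem proj_mem_loop {x : HilbertCube} (hx : x ∈ limitContinuum) : ∃ d ∈ Ico (0 : ℝ) 1,
    proj x = loop d := by
  rw [limitContinuum_eq_union] at hx
  rcases hx with ⟨d, hd, rfl⟩ | ⟨x, -, rfl⟩
  · exact ⟨d, hd, proj_circuit hd⟩
  · exact ⟨0, by simp, by rw [proj_halfShift, loop_zero]⟩

theorem eq_circuit_of_proj_eq {x : HilbertCube} (hx : x ∈ limitContinuum) {d : ℝ}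
    (hd : d ∈ Ioo (0 : ℝ) 1) (h : proj x = loop d) : x = circuit d := by
  rw [limitContinuum_eq_union] at hx
  rcases hx with ⟨e, he, rfl⟩ | ⟨x, -, rfl⟩
  · rw [proj_circuit he] at h
    rw [eq_of_loop_eq ⟨he.1, he.2.le⟩ hd h]
  · rw [proj_halfShift] at h
    exact absurd (congrArg Prod.fst h) (height_pos hd.1 hd.2).ne

theorem circuit_ne_halfShift {d : ℝ} (hd : d ∈ Ioo (0 : ℝ) 1) (x : HilbertCube) :
    circuit d ≠ halfShift x := fun h => by
  have h2 := circuit_apply_zero ⟨hd.1.le, hd.2⟩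
  rw [h, halfShift_zero] at h2
  exact (height_pos hd.1 hd.2).ne h2

/-- A connected subset that misses two points of the open circuit lies between them or misses
the arc between them. -/
theorem subset_or_forall_notMem {K : Set HilbertCube} (hK : IsPreconnected K)
    (hKX : K ⊆ limitContinuum) {a b : ℝ} (h0 : 0 < a) (hab : a ≤ b) (h1 : b < 1)
    (ha : circuit a ∉ K) (hb : circuit b ∉ K) :
    K ⊆ circuit '' Ioo a b ∨ ∀ d ∈ Icc a b, circuit d ∉ K := by
  -- The points of parameters `a` and `b` cut the closed curve into two closed arcs with no other
  -- common point. Since `K` avoids both, the complements of the arcs pull back to disjoint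
  -- relatively open pieces covering `K`.
  have hA : IsClosed (loop '' Icc a b) := (isCompact_Icc.image continuous_loop).isClosed
  have hB : IsClosed (loop '' (Icc 0 a ∪ Icc b 1)) :=
    ((isCompact_Icc.union isCompact_Icc).image continuous_loop).isClosed
  have key : K ⊆ proj ⁻¹' (loop '' (Icc 0 a ∪ Icc b 1))ᶜ ∪ proj ⁻¹' (loop '' Icc a b)ᶜ := by
    intro x hx
    by_contra! h
    simp only [mem_union, mem_preimage, mem_compl_iff, not_or, not_not] at h
    obtain ⟨⟨d, hd, h2⟩, ⟨e, he, h3⟩⟩ := h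
    have he' : e ∈ Ioo (0 : ℝ) 1 := ⟨h0.trans_le he.1, he.2.trans_lt h1⟩
    have hd' : d ∈ Icc (0 : ℝ) 1 := by
      rcases hd with hd | hd
      · exact ⟨hd.1, by linarith [hd.2]⟩
      · exact ⟨by linarith [hd.1], hd.2⟩
    have h4 := eq_of_loop_eq hd' he' (h2.trans h3.symm)
    subst h4
    have h5 := eq_circuit_of_proj_eq (hKX hx) he' h2.symm
    rcases hd with hd | hd
    · exact ha (le_antisymm hd.2 he.1 ▸ h5 ▸ hx)
    · exact hb (le_antisymm he.2 hd.1 ▸ h5 ▸ hx)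
  have hdisj : K ∩ (proj ⁻¹' (loop '' (Icc 0 a ∪ Icc b 1))ᶜ ∩ proj ⁻¹' (loop '' Icc a b)ᶜ) = ∅ := by
    rw [eq_empty_iff_forall_notMem]
    rintro x ⟨hx, h2, h3⟩
    obtain ⟨d, hd, h4⟩ := proj_mem_loop (hKX hx)
    rcases le_total d a with h | h
    · exact h2 ⟨d, Or.inl ⟨hd.1, h⟩, h4.symm⟩
    rcases le_total b d with h5 | h5
    · exact h2 ⟨d, Or.inr ⟨h5, hd.2.le⟩, h4.symm⟩
    · exact h3 ⟨d, ⟨h, h5⟩, h4.symm⟩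
  rcases isPreconnected_iff_subset_of_disjoint.1 hK _ _ (hB.isOpen_compl.preimage continuous_proj)
    (hA.isOpen_compl.preimage continuous_proj) key hdisj with h | h
  · left
    intro x hx
    obtain ⟨d, hd, h4⟩ := proj_mem_loop (hKX hx)
    have h5 : d ∈ Ioo a b := by
      constructor
      · by_contra! h6
        exact h hx ⟨d, Or.inl ⟨hd.1, h6⟩, h4.symm⟩
      · by_contra! h6
        exact h hx ⟨d, Or.inr ⟨h6, hd.2.le⟩, h4.symm⟩
    exact ⟨d, h5, (eq_circuit_of_proj_eq (hKX hx) ⟨h0.trans h5.1, h5.2.trans h1⟩ h4).symm⟩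
  · right
    intro d hd hdK
    exact h hdK ⟨d, hd, (proj_circuit ⟨h0.le.trans hd.1, hd.2.trans_lt h1⟩).symm⟩

/-! ### Subcontinua of the limit continuum -/

theorem isCompact_circuit_image {a b : ℝ} (ha : 0 ≤ a) (hb : b < 1) :
    IsCompact (circuit '' Icc a b) :=
  isCompact_Icc.image_of_continuousOn
    (continuousOn_circuit.mono fun _ hd => ⟨ha.trans hd.1, hd.2.trans_lt hb⟩)

theorem isCompact_circuit_preimage {K : Set HilbertCube} (hK : IsClosed K) {a b : ℝ} (ha : 0 ≤ a)
    (hb : b < 1) : IsCompact (Icc a b ∩ circuit ⁻¹' K) :=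
  isCompact_Icc.of_isClosed_subset ((continuousOn_circuit.mono fun _ hd =>
    ⟨ha.trans hd.1, hd.2.trans_lt hb⟩).preimage_isClosed_of_isClosed isClosed_Icc hK)
    inter_subset_left

theorem mem_limitContinuum_cases {x : HilbertCube} (hx : x ∈ limitContinuum) :
    (∃ d ∈ Ioo (0 : ℝ) 1, circuit d = x) ∨ x ∈ halfShift '' limitContinuum := by
  rw [limitContinuum_eq_union] at hx
  rcases hx with ⟨d, hd, rfl⟩ | hx
  · rcases eq_or_lt_of_le hd.1 with rfl | h
    · exact Or.inr ⟨origin, origin_mem, by rw [circuit_zero, halfShift_edgePoint_zero]⟩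
    · exact Or.inl ⟨d, ⟨h, hd.2⟩, rfl⟩
  · exact Or.inr hx

theorem origin_notMem_circuit_image {a b : ℝ} (ha : 0 ≤ a) (hb : b ≤ 1) :
    origin ∉ circuit '' Ioo a b := by
  rintro ⟨d, hd, h⟩
  refine circuit_ne_halfShift ⟨ha.trans_lt hd.1, hd.2.trans_le hb⟩ origin ?_
  rw [h, halfShift_edgePoint_zero]

/-- If a subcontinuum consists of an arc of the circuit starting at the origin and of a subset of
the scaled copy, then this subset is connected. -/
theorem isPreconnected_inter {K : Set HilbertCube} (hK : IsPreconnected K) (hc : IsClosed K)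
    (h0 : origin ∈ K) {c : ℝ} (hc1 : c < 1)
    (h : K = circuit '' Icc 0 c ∪ K ∩ halfShift '' limitContinuum) :
    IsPreconnected (K ∩ halfShift '' limitContinuum) := by
  have hM : IsClosed (K ∩ halfShift '' limitContinuum) :=
    hc.inter (isCompact_limitContinuum.image continuous_halfShift).isClosed
  have hR := (isCompact_circuit_image le_rfl hc1).isClosed
  -- The arc of the circuit meets the scaled copy only at the origin. Adding it to the closed piece
  -- that contains the origin turns a separation of the intersection into one of `K`.
  have key : ∀ t t' : Set HilbertCube, IsClosed t → IsClosed t' →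
      K ∩ halfShift '' limitContinuum ⊆ t ∪ t' → origin ∈ t →
      (K ∩ halfShift '' limitContinuum ∩ t').Nonempty →
      (K ∩ halfShift '' limitContinuum ∩ (t ∩ t')).Nonempty := by
    intro t t' ht ht' hsub hot ⟨z, hz, hzt⟩
    obtain ⟨x, hx, hxA, hxM, hxt⟩ := isPreconnected_closed_iff.1 hK
      (K ∩ halfShift '' limitContinuum ∩ t ∪ circuit '' Icc 0 c)
      (K ∩ halfShift '' limitContinuum ∩ t') ((hM.inter ht).union hR) (hM.inter ht')
      (by
        intro x hx
        have hx2 := hx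
        rw [h] at hx2
        rcases hx2 with h1 | h1
        · exact Or.inl (Or.inr h1)
        · rcases hsub h1 with h2 | h2
          · exact Or.inl (Or.inl ⟨h1, h2⟩)
          · exact Or.inr ⟨h1, h2⟩)
      ⟨origin, h0, Or.inl ⟨⟨h0, origin, origin_mem, halfShift_edgePoint_zero⟩, hot⟩⟩
      ⟨z, hz.1, hz, hzt⟩
    refine ⟨x, hxM, ?_, hxt⟩
    rcases hxA with hxA | ⟨d, hd, rfl⟩
    · exact hxA.2
    · rcases eq_or_lt_of_le hd.1 with rfl | hd0
      · rwa [circuit_zero]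
      · obtain ⟨y, -, hy⟩ := hxM.2
        exact absurd hy.symm (circuit_ne_halfShift ⟨hd0, hd.2.trans_lt hc1⟩ y)
  refine isPreconnected_closed_iff.2 fun t t' ht ht' hsub h1 h2 => ?_
  rcases hsub ⟨h0, origin, origin_mem, halfShift_edgePoint_zero⟩ with h3 | h3
  · exact key t t' ht ht' hsub h3 h2
  · rw [inter_comm t t']
    exact key t' t ht' ht (by rwa [union_comm]) h3 h1

theorem exists_eq_halfShift_image {K : Set HilbertCube} (hc : IsClosed K) (hK : IsConnected K)
    (h : K ⊆ halfShift '' limitContinuum) :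
    ∃ L ⊆ limitContinuum, IsClosed L ∧ IsConnected L ∧ K = halfShift '' L := by
  obtain ⟨L, hL, rfl⟩ := subset_image_iff.1 h
  refine ⟨L, hL, (isClosedEmbedding_halfShift.isClosed_iff_image_isClosed).2 hc,
    ⟨hK.1.of_image, ?_⟩, rfl⟩
  exact isClosedEmbedding_halfShift.isInducing.isPreconnected_image.1 hK.2

/-- The subcontinua that contain the origin. -/
theorem subcontinuum_of_origin_mem {K : Set HilbertCube} (hc : IsClosed K) (hK : IsConnected K)
    (hKX : K ⊆ limitContinuum) (h0 : origin ∈ K) :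
    (∃ c ∈ Ico (0 : ℝ) 1, ∃ L ⊆ limitContinuum, IsClosed L ∧ IsConnected L ∧ origin ∈ L ∧
      K = circuit '' Icc 0 c ∪ halfShift '' L) ∨
    ∃ c b : ℝ, 0 ≤ c ∧ c ≤ b ∧ 0 < b ∧ b < 1 ∧
      K = circuit '' Icc 0 c ∪ closure (circuit '' Ico b 1) := by
  have htail : ∀ b : ℝ, b < 1 → circuit '' Ico b 1 ⊆ K →
      halfShift '' limitContinuum ⊆ closure (circuit '' Ico b 1) ∧
        closure (circuit '' Ico b 1) ⊆ K := fun b hb h =>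
    ⟨halfShift_image_subset_closure hb, closure_minimal h hc⟩
  by_cases hD : ∃ d ∈ Ioo (0 : ℝ) 1, circuit d ∉ K
  · obtain ⟨d, hd, hdK⟩ := hD
    -- `K` contains the origin, which is not on the open circuit, so it cannot lie between two
    -- missed points.
    have hsep : ∀ a b : ℝ, 0 < a → a ≤ b → b < 1 → circuit a ∉ K → circuit b ∉ K →
        ∀ e ∈ Icc a b, circuit e ∉ K := by
      intro a b ha hab hb haK hbK
      refine (subset_or_forall_notMem hK.2 hKX ha hab hb haK hbK).resolve_left fun h => ?_
      exact origin_notMem_circuit_image ha.le hb.le (h h0)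
    obtain ⟨c, ⟨hc1, hc2⟩, hc3⟩ := (isCompact_circuit_preimage hc le_rfl hd.2).exists_isGreatest
      ⟨0, ⟨le_rfl, hd.1.le⟩, by rwa [mem_preimage, circuit_zero]⟩
    have hcd : c < d := hc1.2.lt_of_ne fun h => hdK (h ▸ hc2)
    have hleft : ∀ e ∈ Icc 0 c, circuit e ∈ K := by
      intro e he
      by_contra h
      have he0 : 0 < e := he.1.lt_of_ne fun h2 => h (by rwa [← h2, circuit_zero])
      exact hsep e d he0 (he.2.trans hcd.le) hd.2 h hdK c ⟨he.2, hcd.le⟩ hc2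
    have hgap : ∀ e ∈ Ioc c d, circuit e ∉ K := fun e he heK =>
      absurd (hc3 ⟨⟨hc1.1.trans he.1.le, he.2⟩, heK⟩) (not_le.2 he.1)
    -- If `K` meets the circuit again beyond the gap at `d`, it contains a whole tail and therefore
    -- the entire limit set. Otherwise the rest of `K` lies in the scaled copy.
    by_cases hE : ∃ e ∈ Ico d 1, circuit e ∈ K
    · obtain ⟨e, he, heK⟩ := hE
      obtain ⟨b, ⟨hb1, hb2⟩, hb3⟩ :=
        (isCompact_circuit_preimage hc hd.1.le he.2).exists_isLeast ⟨e, ⟨he.1, le_rfl⟩, heK⟩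
      have hb : b < 1 := hb1.2.trans_lt he.2
      have hright : circuit '' Ico b 1 ⊆ K := by
        rintro _ ⟨f, hf, rfl⟩
        by_contra h
        exact hsep d f hd.1 (hb1.1.trans hf.1) hf.2 hdK h b ⟨hb1.1, hf.1⟩ hb2
      obtain ⟨ht1, ht2⟩ := htail b hb hright
      refine Or.inr ⟨c, b, hc1.1, hcd.le.trans hb1.1, hd.1.trans_le hb1.1, hb, Subset.antisymm ?_
        (union_subset (image_subset_iff.2 hleft) ht2)⟩
      intro x hx
      rcases mem_limitContinuum_cases (hKX hx) with ⟨f, hf, rfl⟩ | h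
      · rcases le_or_gt f c with h1 | h1
        · exact Or.inl ⟨f, ⟨hf.1.le, h1⟩, rfl⟩
        rcases le_or_gt f d with h2 | h2
        · exact absurd hx (hgap f ⟨h1, h2⟩)
        rcases le_or_gt b f with h3 | h3
        · exact Or.inr (subset_closure ⟨f, ⟨h3, hf.2⟩, rfl⟩)
        · exact absurd (hb3 ⟨⟨h2.le, h3.le.trans hb1.2⟩, hx⟩) (not_le.2 h3)
      · exact Or.inr (ht1 h)
    · push Not at hE
      have hKeq : K = circuit '' Icc 0 c ∪ K ∩ halfShift '' limitContinuum := by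
        refine Subset.antisymm ?_ (union_subset (image_subset_iff.2 hleft) inter_subset_left)
        intro x hx
        rcases mem_limitContinuum_cases (hKX hx) with ⟨f, hf, rfl⟩ | h
        · rcases le_or_gt f c with h1 | h1
          · exact Or.inl ⟨f, ⟨hf.1.le, h1⟩, rfl⟩
          rcases le_or_gt f d with h2 | h2
          · exact absurd hx (hgap f ⟨h1, h2⟩)
          · exact absurd hx (hE f ⟨h2.le, hf.2⟩)
        · exact Or.inr ⟨hx, h⟩
      have horig : origin ∈ K ∩ halfShift '' limitContinuum :=
        ⟨h0, origin, origin_mem, halfShift_edgePoint_zero⟩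
      obtain ⟨L, hL1, hL2, hL3, hL4⟩ := exists_eq_halfShift_image
        (hc.inter (isCompact_limitContinuum.image continuous_halfShift).isClosed)
        ⟨⟨_, horig⟩, isPreconnected_inter hK.2 hc h0 (hcd.trans hd.2) hKeq⟩ inter_subset_right
      refine Or.inl ⟨c, ⟨hc1.1, hcd.trans hd.2⟩, L, hL1, hL2, hL3, ?_, hL4 ▸ hKeq⟩
      rw [hL4] at horig
      obtain ⟨y, hy, hy2⟩ := horig
      rwa [halfShift_injective (hy2.trans halfShift_edgePoint_zero.symm)] at hy
  · push Not at hD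
    have hall : ∀ d ∈ Ico (0 : ℝ) 1, circuit d ∈ K := by
      intro d hd
      rcases eq_or_lt_of_le hd.1 with rfl | h
      · rwa [circuit_zero]
      · exact hD d ⟨h, hd.2⟩
    -- Here `K` contains the whole circuit and hence is everything: the second form with `c = b =
    -- 1/2`.
    obtain ⟨ht1, ht2⟩ := htail (1 / 2) (by norm_num) (image_subset_iff.2 fun d hd =>
      hall d ⟨by linarith [hd.1], hd.2⟩)
    refine Or.inr ⟨1 / 2, 1 / 2, by norm_num, le_rfl, by norm_num, by norm_num, Subset.antisymm ?_
      (union_subset (image_subset_iff.2 fun d hd => hall d ⟨hd.1, by linarith [hd.2]⟩) ht2)⟩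
    intro x hx
    rcases mem_limitContinuum_cases (hKX hx) with ⟨f, hf, rfl⟩ | h
    · rcases le_total f (1 / 2) with h1 | h1
      · exact Or.inl ⟨f, ⟨hf.1.le, h1⟩, rfl⟩
      · exact Or.inr (subset_closure ⟨f, ⟨h1, hf.2⟩, rfl⟩)
    · exact Or.inr (ht1 h)

/-- The subcontinua that do not contain the origin. -/
theorem subcontinuum_of_origin_notMem {K : Set HilbertCube} (hc : IsClosed K) (hK : IsConnected K)
    (hKX : K ⊆ limitContinuum) (h0 : origin ∉ K) :
    K ⊆ halfShift '' limitContinuum ∨ ∃ a b : ℝ, 0 < a ∧ a ≤ b ∧ b < 1 ∧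
      K = circuit '' Icc a b := by
  by_cases h : K ⊆ halfShift '' limitContinuum
  · exact Or.inl h
  right
  obtain ⟨x, hx, hxT⟩ := not_subset.1 h
  obtain ⟨d, hd, rfl⟩ := (mem_limitContinuum_cases (hKX hx)).resolve_right hxT
  -- `K` misses circuit points on both sides of `d`: near parameter 0 because the circuit starts at
  -- the origin, and near parameter 1 because a full tail would force the limit set, with the
  -- origin, into `K`.
  obtain ⟨p, hp, hpK⟩ : ∃ p ∈ Ioo 0 d, circuit p ∉ K := by
    have h1 : ContinuousWithinAt circuit (Ico 0 1) 0 := continuousOn_circuit 0 (by simp)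
    have h2 : Tendsto circuit (𝓝[>] 0) (𝓝 (circuit 0)) := by
      refine h1.mono_left ?_
      rw [← nhdsWithin_Ioo_eq_nhdsGT (zero_lt_one : (0 : ℝ) < 1)]
      exact nhdsWithin_mono _ Ioo_subset_Ico_self
    rw [circuit_zero] at h2
    obtain ⟨p, hpK, hp⟩ := ((h2.eventually (hc.isOpen_compl.mem_nhds h0)).and
      (Ioo_mem_nhdsGT hd.1)).exists
    exact ⟨p, hp, hpK⟩
  obtain ⟨q, hq, hqK⟩ : ∃ q ∈ Ioo d 1, circuit q ∉ K := by
    by_contra! h1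
    have h2 : circuit '' Ico d 1 ⊆ K := by
      rintro _ ⟨e, he, rfl⟩
      rcases eq_or_lt_of_le he.1 with rfl | h3
      · exact hx
      · exact h1 e ⟨h3, he.2⟩
    exact h0 (closure_minimal h2 hc (halfShift_image_subset_closure hd.2
      ⟨origin, origin_mem, halfShift_edgePoint_zero⟩))
  have hpd := hp.2
  have hdq := hq.1
  have hsub : K ⊆ circuit '' Ioo p q :=
    (subset_or_forall_notMem hK.2 hKX hp.1 (hpd.trans hdq).le hq.2 hpK hqK).resolve_right
      fun h1 => h1 d ⟨hpd.le, hdq.le⟩ hx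
  have hcomp := isCompact_circuit_preimage hc hp.1.le hq.2
  have hne : (Icc p q ∩ circuit ⁻¹' K).Nonempty := ⟨d, ⟨hpd.le, hdq.le⟩, hx⟩
  obtain ⟨a, ⟨ha1, ha2⟩, ha3⟩ := hcomp.exists_isLeast hne
  obtain ⟨b, ⟨hb1, hb2⟩, hb3⟩ := hcomp.exists_isGreatest hne
  have ha0 : 0 < a := hp.1.trans_le ha1.1
  have hb0 : b < 1 := hb1.2.trans_lt hq.2
  refine ⟨a, b, ha0, ha3 ⟨hb1, hb2⟩, hb0, Subset.antisymm ?_ ?_⟩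
  · intro x hx
    obtain ⟨e, he, rfl⟩ := hsub hx
    have he2 : e ∈ Icc p q ∩ circuit ⁻¹' K := ⟨⟨he.1.le, he.2.le⟩, hx⟩
    exact ⟨e, ⟨ha3 he2, hb3 he2⟩, rfl⟩
  · rintro _ ⟨e, he, rfl⟩
    by_contra heK
    have he0 : 0 < e := ha0.trans_le he.1
    rcases subset_or_forall_notMem hK.2 hKX he0 (he.2.trans hb1.2) hq.2 heK hqK with h1 | h1
    · obtain ⟨f, hf, hfa⟩ := h1 ha2
      have := circuit_injOn ⟨he0.le.trans hf.1.le, hf.2.trans hq.2⟩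
        ⟨ha0.le, (ha3 ⟨hb1, hb2⟩).trans_lt hb0⟩ hfa
      linarith [he.1, hf.1]
    · exact h1 b ⟨he.2, hb1.2⟩ hb2

/-! ### Approximation of subcontinua by arcs of the ray -/

/-- Each point of each of the two sets is at distance less than `ε` from a point of the other. -/
def HausdorffClose {E : Type*} [PseudoMetricSpace E] (ε : ℝ) (A B : Set E) : Prop :=
  (∀ a ∈ A, ∃ b ∈ B, dist a b < ε) ∧ ∀ b ∈ B, ∃ a ∈ A, dist a b < ε

section HausdorffClose

variable {E : Type*} [PseudoMetricSpace E] {A B C : Set E} {δ ε : ℝ}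

theorem HausdorffClose.mono (h : HausdorffClose δ A B) (hδ : δ ≤ ε) : HausdorffClose ε A B :=
  ⟨fun a ha => (h.1 a ha).imp fun _ hb => ⟨hb.1, hb.2.trans_le hδ⟩,
    fun b hb => (h.2 b hb).imp fun _ ha => ⟨ha.1, ha.2.trans_le hδ⟩⟩

theorem HausdorffClose.trans (h : HausdorffClose δ A B) (h' : HausdorffClose ε B C) :
    HausdorffClose (δ + ε) A C := by
  constructor
  · intro a ha
    obtain ⟨b, hb, h1⟩ := h.1 a ha
    obtain ⟨c, hc, h2⟩ := h'.1 b hb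
    exact ⟨c, hc, (dist_triangle a b c).trans_lt (add_lt_add h1 h2)⟩
  · intro c hc
    obtain ⟨b, hb, h1⟩ := h'.2 c hc
    obtain ⟨a, ha, h2⟩ := h.2 b hb
    exact ⟨a, ha, (dist_triangle a b c).trans_lt (add_lt_add h2 h1)⟩

theorem HausdorffClose.hausdorffDist_le (h : HausdorffClose ε A B) (hε : 0 ≤ ε) :
    Metric.hausdorffDist B A ≤ ε :=
  Metric.hausdorffDist_le_of_mem_dist hε
    (fun b hb => (h.2 b hb).imp fun a ha => ⟨ha.1, (dist_comm b a).trans_le ha.2.le⟩)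
    (fun a ha => (h.1 a ha).imp fun _ hb => ⟨hb.1, hb.2.le⟩)

end HausdorffClose

theorem HausdorffClose.halfShift {A B : Set HilbertCube} {ε : ℝ} (h : HausdorffClose ε A B) :
    HausdorffClose (ε / 4) (halfShift '' A) (halfShift '' B) := by
  constructor
  · rintro _ ⟨a, ha, rfl⟩
    obtain ⟨b, hb, h1⟩ := h.1 a ha
    exact ⟨_, mem_image_of_mem _ hb, by rw [dist_halfShift]; linarith⟩
  · rintro _ ⟨b, hb, rfl⟩
    obtain ⟨a, ha, h1⟩ := h.2 b hb
    exact ⟨_, mem_image_of_mem _ ha, by rw [dist_halfShift]; linarith⟩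

/-- The cube has diameter at most 1. This is the base case of the inductions on the error. -/
theorem hausdorffClose_two {A B : Set HilbertCube} (hA : A.Nonempty) (hB : B.Nonempty) :
    HausdorffClose 2 A B := by
  obtain ⟨a, ha⟩ := hA
  obtain ⟨b, hb⟩ := hB
  exact ⟨fun x _ => ⟨b, hb, (dist_le_one x b).trans_lt (by norm_num)⟩,
    fun x _ => ⟨a, ha, (dist_le_one a x).trans_lt (by norm_num)⟩⟩

/-- Pointwise approximation on a dense subset implies uniform approximation. -/
theorem eventually_forall_of_dense {D K : Set HilbertCube} (hK : K ⊆ closure D)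
    {P : ℕ → Set HilbertCube}
    (h : ∀ z ∈ D, ∀ ε > 0, ∀ᶠ k in atTop, ∃ a ∈ P k, dist a (halfShift z) < ε) {ε : ℝ}
    (hε : 0 < ε) : ∀ᶠ k in atTop, ∀ z ∈ K, ∃ a ∈ P k, dist a (halfShift z) < ε := by
  have hD : TotallyBounded D := isCompact_univ.totallyBounded.subset (subset_univ D)
  obtain ⟨t, htD, htf, ht⟩ := Metric.finite_approx_of_totallyBounded hD (ε / 3) (by positivity)
  have h1 : ∀ᶠ k in atTop, ∀ y ∈ t, ∃ a ∈ P k, dist a (halfShift y) < ε / 3 :=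
    (eventually_all_finite htf).2 fun y hy => h y (htD hy) _ (by positivity)
  filter_upwards [h1] with k hk z hz
  obtain ⟨d, hd, hzd⟩ := Metric.mem_closure_iff.1 (hK hz) (ε / 3) (by positivity)
  obtain ⟨y, hy, hdy⟩ := mem_iUnion₂.1 (ht hd)
  obtain ⟨a, ha, hay⟩ := hk y hy
  refine ⟨a, ha, ?_⟩
  have h2 : dist y z < 2 * (ε / 3) := by
    have := dist_triangle_left y z d
    rw [Metric.mem_ball] at hdy
    rw [dist_comm z d] at hzd
    linarith
  have h3 := dist_triangle a (halfShift y) (halfShift z)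
  rw [dist_halfShift] at h3
  linarith

/-! ### Rounding to the grid and transfer of approximations between scales -/

/-- The index of the last grid point before a given offset. -/
noncomputable def gridFloor (k : ℕ) (c : ℝ) : ℕ := ⌊2 * (k + 2) * c⌋₊

theorem gridFloor_div_le (k : ℕ) {c : ℝ} (hc : 0 ≤ c) :
    (gridFloor k c : ℝ) / (2 * (k + 2)) ≤ c := by
  rw [div_le_iff₀ (by positivity)]
  have := Nat.floor_le (show 0 ≤ 2 * ((k : ℝ) + 2) * c by positivity)
  unfold gridFloor
  linarith

theorem eventually_le_gridFloor_div {c d : ℝ} (h : d < c) :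
    ∀ᶠ k : ℕ in atTop, d ≤ gridFloor k c / (2 * (k + 2)) := by
  filter_upwards [tendsto_natCast_atTop_atTop.eventually_ge_atTop (1 / (c - d))] with k hk
  rw [div_le_iff₀ (by linarith)] at hk
  rw [le_div_iff₀ (by positivity)]
  have h1 := Nat.lt_floor_add_one (2 * ((k : ℝ) + 2) * c)
  unfold gridFloor
  nlinarith

theorem eventually_gridFloor_le {c : ℝ} (h : c < 1) :
    ∀ᶠ k : ℕ in atTop, gridFloor k c ≤ 2 * k := by
  filter_upwards [tendsto_natCast_atTop_atTop.eventually_ge_atTop (2 * c / (1 - c))] with k hk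
  rw [div_le_iff₀ (by linarith)] at hk
  refine Nat.floor_le_of_le ?_
  push_cast
  nlinarith

theorem eventually_left_subset {c ε : ℝ} (hc : c ∈ Ico (0 : ℝ) 1) (hε : 0 < ε) :
    ∀ᶠ k : ℕ in atTop, ∀ w ∈ Icc (gridLeft k (gridFloor k c)) (k + 1 / 2),
      ∃ z ∈ circuit '' Icc 0 c, dist (phaseRay w) (halfShift z) < ε := by
  filter_upwards [eventually_dist_circuit_lt hc.2 hε] with k hk w hw
  have h1 : k + 1 / 2 - w ∈ Icc 0 c := by
    have h2 := gridFloor_div_le k hc.1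
    have h3 := hw.1
    unfold gridLeft at h3
    exact ⟨by linarith [hw.2], by linarith⟩
  refine ⟨_, mem_image_of_mem _ h1, ?_⟩
  have h2 := hk _ h1
  rwa [sub_sub_cancel] at h2

/-- Rounding `c` down to the grid may cut off the end of the arc, but by an amount tending to zero;
uniform continuity of the circuit on `[0, c]` absorbs it. -/
theorem eventually_left_superset {c ε : ℝ} (hc : c ∈ Ico (0 : ℝ) 1) (hε : 0 < ε) :
    ∀ᶠ k : ℕ in atTop, ∀ z ∈ circuit '' Icc 0 c,
      ∃ w ∈ Icc (gridLeft k (gridFloor k c)) (k + 1 / 2),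
        dist (phaseRay w) (halfShift z) < ε := by
  have hu := (isCompact_Icc (a := (0 : ℝ)) (b := c)).uniformContinuousOn_of_continuous
    (continuousOn_circuit.mono fun d hd => ⟨hd.1, hd.2.trans_lt hc.2⟩)
  obtain ⟨δ, hδ, hu⟩ := Metric.uniformContinuousOn_iff.1 hu (ε / 2) (by positivity)
  filter_upwards [eventually_dist_circuit_lt hc.2 (half_pos hε),
    eventually_le_gridFloor_div (show c - δ / 2 < c by linarith)] with k hk hk2
  rintro _ ⟨d, hd, rfl⟩
  have h1 := gridFloor_div_le k hc.1
  have h2 : (0 : ℝ) ≤ gridFloor k c / (2 * (k + 2)) := by positivity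
  have h3 : min d (gridFloor k c / (2 * (k + 2))) ∈ Icc 0 c :=
    ⟨le_min hd.1 h2, (min_le_left _ _).trans hd.2⟩
  refine ⟨k + 1 / 2 - min d (gridFloor k c / (2 * (k + 2))), ⟨?_, by linarith [h3.1]⟩, ?_⟩
  · unfold gridLeft
    linarith [min_le_right d (gridFloor k c / (2 * (k + 2)) : ℝ)]
  · have h4 : dist (min d (gridFloor k c / (2 * (k + 2)))) d < δ := by
      rw [Real.dist_eq, abs_lt]
      constructor
      · have : d - δ / 2 ≤ min d (gridFloor k c / (2 * (k + 2))) :=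
          le_min (by linarith) (by linarith [hd.2])
        linarith
      · linarith [min_le_left d (gridFloor k c / (2 * (k + 2)) : ℝ)]
    have h5 := hu _ h3 d hd h4
    have h6 := dist_triangle (phaseRay (k + 1 / 2 - min d (gridFloor k c / (2 * (k + 2)))))
      (halfShift (circuit (min d (gridFloor k c / (2 * (k + 2)))))) (halfShift (circuit d))
    rw [dist_halfShift] at h6
    linarith [hk _ h3, dist_nonneg (x := circuit (min d (gridFloor k c / (2 * (k + 2)))))
      (y := circuit d)]

theorem half_le_of_window_nonneg {k : ℕ} {x : ℝ} (h : 0 ≤ window k x) : 1 / 2 ≤ x := by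
  unfold window at h
  have : (0 : ℝ) < 2 * (k + 2) := by positivity
  by_contra! h2
  nlinarith

theorem le_one_of_window_le_one {k : ℕ} {x : ℝ} (h : window k x ≤ 1) : x ≤ 1 := by
  have h1 := le_of_window_le h
  have h2 : (1 : ℝ) / (k + 2) ≤ 1 := by
    rw [div_le_one (by positivity)]
    have : (0 : ℝ) ≤ k := by positivity
    linarith
  linarith

/-- The excursion of the `k`-th period transfers an approximation to the next scale. -/
theorem eventually_close_of_code {c ε : ℝ} (hc : c ∈ Ico (0 : ℝ) 1) (hε : 0 < ε) :
    ∀ᶠ k : ℕ in atTop, ∀ L : Set HilbertCube, origin ∈ L →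
      HausdorffClose ε (phaseRay '' Icc (codeLeft k) (codeRight k)) (halfShift '' L) →
      HausdorffClose (ε / 2) (phaseRay '' Icc (gridLeft k (gridFloor k c)) (gridRight k 1))
        (halfShift '' (circuit '' Icc 0 c ∪ halfShift '' L)) := by
  filter_upwards [eventually_left_subset hc (half_pos hε), eventually_left_superset hc (half_pos hε),
    tendsto_codePeriod.eventually_ge_atTop 1,
    tendsto_err.eventually_lt_const (show 0 < ε / 4 by positivity)] with k hk1 hk2 hk3 hk4 L hL h
  have hLR : gridLeft k (gridFloor k c) ≤ k + 1 / 2 := gridLeft_le _ _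
  have hRR : (k : ℝ) + 1 / 2 ≤ gridRight k 1 := le_gridRight _ _
  -- The first grid point to the right of `k + 1/2` is where the excursion ends, so the grid arc
  -- contains the excursion and nothing after it.
  have hwin : ∀ x : ℝ, k + x ≤ gridRight k 1 ↔ window k x ≤ 1 := fun x => by
    have h1 : (0 : ℝ) < 2 * (k + 2) := by positivity
    unfold gridRight window
    rw [Nat.cast_one, add_assoc, add_le_add_iff_left, ← sub_le_iff_le_add', le_div_iff₀ h1,
      mul_comm]
  constructor
  · rintro _ ⟨w, hw, rfl⟩
    rcases le_total w (k + 1 / 2) with h1 | h1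
    · obtain ⟨z, hz, h2⟩ := hk1 w ⟨hw.1, h1⟩
      exact ⟨_, mem_image_of_mem _ (Or.inl hz), h2⟩
    obtain ⟨x, rfl⟩ : ∃ x, w = k + x := ⟨w - k, by ring⟩
    have hx1 : window k x ≤ 1 := (hwin x).1 hw.2
    have hx := le_one_of_window_le_one hx1
    rcases le_total (window k x) (1 / 3) with h3 | h3
    · refine ⟨halfShift origin, mem_image_of_mem _
        (Or.inl ⟨0, ⟨le_rfl, hc.1⟩, circuit_zero⟩), ?_⟩
      rw [halfShift_edgePoint_zero]
      linarith [dist_phaseRay_corner_le hk3 (by linarith) hx h3]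
    · have h4 := dist_phaseRay_ray_le hk3 hx h3
      have h5 := excursion_mem k x
      rw [← visit_of_window_le_one hx1] at h5
      have hv := visit_pos k x
      have h6 : phase (visit k x) ∈ Icc (codeLeft k) (codeRight k) := by
        have h7 := phase_le_phase (time_pos (codeRight_nonneg k)) h5.1
        have h8 := phase_le_phase hv h5.2
        rw [phase_time (codeRight_nonneg k)] at h7
        rw [phase_time (codeLeft_nonneg k)] at h8
        exact ⟨h8, h7⟩
      obtain ⟨z, hz, h7⟩ := h.1 _ (mem_image_of_mem _ h6)
      rw [phaseRay, time_phase hv] at h7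
      refine ⟨halfShift z, mem_image_of_mem _ (Or.inr hz), ?_⟩
      -- The shift divides `ε` by 4 and `err k` adds less than `ε / 4`, whence the halved error.
      have h8 := dist_triangle (phaseRay (k + x)) (halfShift (ray (visit k x))) (halfShift z)
      rw [dist_halfShift] at h8
      linarith
  · rintro _ ⟨z, hz | hz, rfl⟩
    · obtain ⟨w, hw, h2⟩ := hk2 z hz
      exact ⟨_, mem_image_of_mem _ ⟨hw.1, hw.2.trans hRR⟩, h2⟩
    · obtain ⟨_, ⟨v, hv, rfl⟩, h2⟩ := h.2 z hz
      have hv0 := (codeLeft_nonneg k).trans hv.1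
      obtain ⟨x, hx1, hx2, hx3⟩ := exists_visit_eq (k := k) (r := time v)
        ⟨time_le_time hv0 hv.2, time_le_time (codeLeft_nonneg k) hv.1⟩
      have hx := half_le_of_window_nonneg (k := k) (x := x) (by linarith)
      refine ⟨_, mem_image_of_mem _ ⟨hLR.trans (by linarith : _ ≤ (k : ℝ) + x), (hwin x).2 hx2⟩, ?_⟩
      have h4 := dist_phaseRay_ray_le hk3 (le_one_of_window_le_one hx2) hx1
      rw [hx3] at h4
      have h8 := dist_triangle (phaseRay (k + x)) (halfShift (ray (time v))) (halfShift z)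
      rw [dist_halfShift] at h8
      rw [phaseRay] at h2
      linarith

/-- Approximation of the subcontinua that contain a tail of the circuit. -/
theorem eventually_close_tail {b c ε : ℝ} (hc : 0 ≤ c) (hcb : c ≤ b) (hb : b < 1) (hε : 0 < ε) :
    ∀ᶠ k : ℕ in atTop,
      HausdorffClose ε
        (phaseRay '' Icc (gridLeft k (gridFloor k c)) (gridRight k (gridFloor k (1 - b))))
        (halfShift '' (circuit '' Icc 0 c ∪ closure (circuit '' Ico b 1))) := by
  have hc' : c ∈ Ico (0 : ℝ) 1 := ⟨hc, hcb.trans_lt hb⟩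
  have hB1 : max b (3 / 4) < 1 := max_lt hb (by norm_num)
  have hB0 : 3 / 4 ≤ max b (3 / 4) := le_max_right _ _
  have hpos : 0 < height (1 / 2 + max b (3 / 4)) := height_pos (by linarith) hB1
  have htail : ∀ᶠ k : ℕ in atTop, ∀ z ∈ closure (circuit '' Ico b 1),
      ∃ a ∈ phaseRay '' Icc (k + 1 / 2 : ℝ) (gridRight k (gridFloor k (1 - b))),
        dist a (halfShift z) < ε := by
    refine eventually_forall_of_dense Subset.rfl ?_ hε
    rintro _ ⟨d, hd, rfl⟩ η hη
    have hd0 : 0 ≤ d := (hc.trans hcb).trans hd.1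
    -- Moving `d` to a slightly larger `e` makes `1 - e < 1 - b` strict, which leaves room for
    -- rounding `1 - b` down to the grid.
    obtain ⟨e, hed, he⟩ : ∃ e, dist (circuit e) (circuit d) < η / 2 ∧ e ∈ Ioo d 1 := by
      have h1 : Tendsto circuit (𝓝[>] d) (𝓝 (circuit d)) := by
        refine (continuousOn_circuit d ⟨hd0, hd.2⟩).mono_left ?_
        rw [← nhdsWithin_Ioo_eq_nhdsGT hd.2]
        exact nhdsWithin_mono _ fun e he => ⟨hd0.trans he.1.le, he.2⟩
      exact ((h1.eventually (Metric.ball_mem_nhds _ (half_pos hη))).and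
        (Ioo_mem_nhdsGT hd.2)).exists
    obtain ⟨N, hN⟩ := eventually_atTop.1 (eventually_dist_circuit_lt he.2 (half_pos hη))
    filter_upwards [eventually_ge_atTop N, eventually_le_gridFloor_div
      (show 1 - e < 1 - b by linarith [he.1, hd.1])] with k hk hk2
    have h2 := hN (k + 1) (by omega) e ⟨hd0.trans he.1.le, le_rfl⟩
    refine ⟨phaseRay (((k + 1 : ℕ) : ℝ) + 1 / 2 - e), mem_image_of_mem _ ⟨?_, ?_⟩, ?_⟩
    · push_cast; linarith [he.2]
    · unfold gridRight; push_cast; linarith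
    · have h3 := dist_triangle (phaseRay (((k + 1 : ℕ) : ℝ) + 1 / 2 - e)) (halfShift (circuit e))
        (halfShift (circuit d))
      rw [dist_halfShift] at h3
      linarith [dist_nonneg (x := circuit e) (y := circuit d)]
  obtain ⟨N, hN⟩ := eventually_atTop.1
    (eventually_dist_circuit_lt (show (3 / 4 : ℝ) < 1 by norm_num) hε)
  have hA : ∀ᶠ k : ℕ in atTop, time (codeLeft k) < height (1 / 2 + max b (3 / 4)) :=
    (tendsto_time.comp tendsto_codeLeft).eventually_lt_const hpos
  filter_upwards [eventually_left_subset hc' hε, eventually_left_superset hc' hε, htail,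
    tendsto_codePeriod.eventually_ge_atTop 1, tendsto_err.eventually_lt_const hε,
    eventually_ge_atTop N, hA] with k hk1 hk2 hk3 hk4 hk5 hk6 hk7
  constructor
  · rintro _ ⟨w, hw, rfl⟩
    rcases le_total w (k + 1 / 2) with h1 | h1
    · obtain ⟨z, hz, h2⟩ := hk1 w ⟨hw.1, h1⟩
      exact ⟨_, mem_image_of_mem _ (Or.inl hz), h2⟩
    obtain ⟨x, rfl⟩ : ∃ x, w = k + x := ⟨w - k, by ring⟩
    have hx0 : 1 / 2 ≤ x := by linarith
    have hxb : x - 1 / 2 ≤ 1 - b := by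
      have h2 := gridFloor_div_le k (show 0 ≤ 1 - b by linarith)
      have h3 := hw.2
      unfold gridRight at h3
      linarith
    rcases le_total (window k x) (1 / 3) with h3 | h3
    · refine ⟨halfShift origin, mem_image_of_mem _
        (Or.inl ⟨0, ⟨le_rfl, hc⟩, circuit_zero⟩), ?_⟩
      rw [halfShift_edgePoint_zero]
      exact (dist_phaseRay_corner_le hk4 hx0 (le_one_of_window_le_one (by linarith)) h3).trans_lt hk5
    -- Close to `1/2` the excursion prevents an exact comparison, but the visited times are so small
    -- that they belong to the tail of the circuit. From `3/4` on, the ray shadows the circuit at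
    -- parameter `3/2 - x`, counted back from phase `k + 3/2`.
    rcases le_total x (3 / 4) with h4 | h4
    · have h5 : visit k x ≤ height (1 / 2 + max b (3 / 4)) := by
        refine visit_le_max.trans (max_le hk7.le ?_)
        have h6 := height_three_half_sub (3 / 2 - x)
        rw [sub_sub_cancel] at h6
        rw [h6]
        exact height_le_height (by linarith) (max_le (by linarith) (by linarith)) (by linarith)
      obtain ⟨d, hd, h6, -⟩ := exists_circuit_eq_ray ⟨by linarith, hB1⟩ (visit_pos k x) h5
      refine ⟨_, mem_image_of_mem _ (Or.inr (subset_closure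
        (mem_image_of_mem _ (⟨(le_max_left _ _).trans hd.1, hd.2⟩ : d ∈ Ico b 1)))), ?_⟩
      rw [h6]
      exact (dist_phaseRay_ray_le hk4 (by linarith) h3).trans_lt hk5
    · have h5 : 3 / 2 - x ∈ Icc (0 : ℝ) (3 / 4) :=
        ⟨by linarith [hc.trans hcb], by linarith⟩
      have h6 := hN (k + 1) (by omega) _ h5
      push_cast at h6
      rw [show (k : ℝ) + 1 + 1 / 2 - (3 / 2 - x) = k + x by ring] at h6
      exact ⟨_, mem_image_of_mem _ (Or.inr (subset_closure
        (mem_image_of_mem _ (⟨by linarith, by linarith⟩ : 3 / 2 - x ∈ Ico b 1)))), h6⟩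
  · rintro _ ⟨z, hz | hz, rfl⟩
    · obtain ⟨w, hw, h2⟩ := hk2 z hz
      exact ⟨_, mem_image_of_mem _ ⟨hw.1, hw.2.trans (le_gridRight _ _)⟩, h2⟩
    · obtain ⟨_, ⟨w, hw, rfl⟩, h2⟩ := hk3 z hz
      exact ⟨_, mem_image_of_mem _ ⟨(gridLeft_le _ _).trans hw.1, hw.2⟩, h2⟩

/-- For a subcontinuum through the origin, grid arcs far out on the ray approximate its scaled
copy. -/
theorem frequently_close {ε : ℝ} (hε : 0 < ε) {K : Set HilbertCube} (hc : IsClosed K)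
    (hK : IsConnected K) (hKX : K ⊆ limitContinuum) (h0 : origin ∈ K) :
    ∃ᶠ m : ℕ in atTop, ∃ j ≤ 2 * m, ∃ l ≤ 2 * m,
      HausdorffClose ε (phaseRay '' Icc (gridLeft m j) (gridRight m l)) (halfShift '' K) := by
  -- Induction on the error with `K` arbitrary: the passage from `K` to `L` may go on forever, so
  -- there is no descent on `K` itself.
  suffices h : ∀ n : ℕ, ∀ K : Set HilbertCube, IsClosed K → IsConnected K → K ⊆ limitContinuum →
      origin ∈ K → ∃ᶠ m : ℕ in atTop, ∃ j ≤ 2 * m, ∃ l ≤ 2 * m,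
        HausdorffClose (2 / 2 ^ n) (phaseRay '' Icc (gridLeft m j) (gridRight m l))
          (halfShift '' K) by
    obtain ⟨n, hn⟩ := exists_pow_lt_of_lt_one (show 0 < ε / 2 by positivity)
      (show (1 / 2 : ℝ) < 1 by norm_num)
    refine (h n K hc hK hKX h0).mono ?_
    rintro m ⟨j, hj, l, hl, h1⟩
    refine ⟨j, hj, l, hl, h1.mono ?_⟩
    rw [one_div, inv_pow] at hn
    rw [div_eq_mul_inv]
    linarith
  intro n
  induction n with
  | zero =>
    intro K _ hK _ _
    refine Frequently.of_forall fun m => ⟨0, by omega, 0, by omega, ?_⟩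
    rw [pow_zero, div_one]
    exact hausdorffClose_two ((nonempty_Icc.2 ((gridLeft_le m 0).trans (le_gridRight m 0))).image _)
      (hK.1.image _)
  | succ n ih =>
    intro K hc hK hKX h0
    have hε : (0 : ℝ) < 2 / 2 ^ n := by positivity
    rw [show (2 : ℝ) / 2 ^ (n + 1) = 2 / 2 ^ n / 2 by rw [pow_succ]; field_simp]
    rcases subcontinuum_of_origin_mem hc hK hKX h0 with
      ⟨c, hc1, L, hL1, hL2, hL3, hL4, rfl⟩ | ⟨c, b, hc1, hcb, hb0, hb, rfl⟩
    · obtain ⟨N, hN⟩ := eventually_atTop.1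
        ((eventually_close_of_code hc1 hε).and (eventually_gridFloor_le hc1.2))
      rw [frequently_atTop]
      intro M
      -- The transfer works only in late periods. The induction hypothesis supplies arbitrarily
      -- large `m`, and the code is at least `m`.
      obtain ⟨m, hm, j, hj, l, hl, h1⟩ := frequently_atTop.1 (ih L hL2 hL3 hL1 hL4) (M + N + 1)
      have hk := le_code m j l
      obtain ⟨h2, h3⟩ := hN (code m j l) (by omega)
      refine ⟨code m j l, by omega, _, h3, 1, by omega, h2 L hL4 ?_⟩
      rwa [codeLeft_code hj hl, codeRight_code hj hl]
    · refine Eventually.frequently ?_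
      filter_upwards [eventually_close_tail hc1 hcb hb (half_pos hε),
        eventually_gridFloor_le (hcb.trans_lt hb),
        eventually_gridFloor_le (show 1 - b < 1 by linarith)] with k hk1 hk2 hk3
      exact ⟨_, hk2, _, hk3, hk1⟩

theorem height_strictAnti {d e : ℝ} (hd : 1 / 2 ≤ d) (hde : d < e) (he : e ≤ 1) :
    height (1 / 2 + e) < height (1 / 2 + d) :=
  (height_le_height hd hde.le he).lt_of_ne fun h =>
    hde.ne' (height_injOn_right ⟨hd.trans hde.le, he⟩ ⟨hd, hde.le.trans he⟩ h)

/-- Arcs of the ray in the phase variable are arcs of the circuit. -/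
theorem exists_circuit_image_eq {a v w : ℝ} (ha : a ∈ Ico (1 / 2 : ℝ) 1) (hv : 1 / 4 ≤ v)
    (hvw : v ≤ w) (h : time v ≤ height (1 / 2 + a)) :
    ∃ d e : ℝ, a ≤ d ∧ d ≤ e ∧ e < 1 ∧ phaseRay '' Icc v w = circuit '' Icc d e := by
  have hv0 := time_pos (w := v) (by linarith)
  have hw0 := time_pos (w := w) (by linarith)
  obtain ⟨d, hd, -, hd2⟩ := exists_circuit_eq_ray ha hv0 h
  have hd' : d ∈ Ico (1 / 2 : ℝ) 1 := ⟨ha.1.trans hd.1, hd.2⟩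
  obtain ⟨e, he, -, he2⟩ := exists_circuit_eq_ray hd' hw0
    (hd2.symm ▸ time_le_time (by linarith) hvw)
  refine ⟨d, e, hd.1, he.1, he.2, Subset.antisymm ?_ ?_⟩
  · rintro _ ⟨u, hu, rfl⟩
    have hu0 := time_pos (w := u) (by linarith [hu.1])
    obtain ⟨f, hf, hf1, hf2⟩ := exists_circuit_eq_ray hd' hu0
      (hd2.symm ▸ time_le_time (by linarith) hu.1)
    refine ⟨f, ⟨hf.1, ?_⟩, hf1⟩
    by_contra! hlt
    have h1 := height_strictAnti (hd'.1.trans he.1) hlt hf.2.le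
    rw [hf2, he2] at h1
    exact absurd (time_le_time (by linarith [hu.1]) hu.2) (not_le.2 h1)
  · rintro _ ⟨f, hf, rfl⟩
    have hf' : f ∈ Ico (1 / 2 : ℝ) 1 := ⟨hd'.1.trans hf.1, hf.2.trans_lt he.2⟩
    have hf0 := (height_mem hf').1
    refine ⟨phase (height (1 / 2 + f)), ⟨?_, ?_⟩, ?_⟩
    · have h1 := phase_le_phase hf0 (height_le_height hd'.1 hf.1 hf'.2.le)
      rwa [hd2, phase_time (by linarith)] at h1
    · have h1 := phase_le_phase hw0 (he2 ▸ height_le_height hf'.1 hf.2 he.2.le)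
      rwa [phase_time (by linarith)] at h1
    · rw [phaseRay, time_phase hf0, circuit_of_ge hf'.1]

/-- The ray shadows the scaled arc `circuit '' Icc b c` once in each far period, and far phases
correspond to circuit parameters beyond `a`. -/
theorem exists_close_circuit {a b c ε : ℝ} (ha : a ∈ Ico (1 / 2 : ℝ) 1) (hb : 0 ≤ b) (hbc : b ≤ c)
    (hc : c < 1) (hε : 0 < ε) :
    ∃ d e : ℝ, a ≤ d ∧ d ≤ e ∧ e < 1 ∧
      HausdorffClose ε (circuit '' Icc d e) (halfShift '' (circuit '' Icc b c)) := by
  have h1 : ∀ᶠ k : ℕ in atTop, time ((k : ℝ) + -1 / 2) < height (1 / 2 + a) :=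
    (tendsto_time.comp (tendsto_atTop_add_const_right _ (-1 / 2 : ℝ)
      tendsto_natCast_atTop_atTop)).eventually_lt_const (height_mem ha).1
  obtain ⟨k, ⟨hk1, hk2⟩, hk3⟩ := (((eventually_dist_circuit_lt hc hε).and h1).and
    (eventually_ge_atTop 1)).exists
  have hk4 : (1 : ℝ) ≤ k := by exact_mod_cast hk3
  obtain ⟨d, e, had, hde, he, h2⟩ := exists_circuit_image_eq (v := k + 1 / 2 - c)
    (w := k + 1 / 2 - b) ha (by linarith) (by linarith)
    ((time_le_time (by linarith) (by linarith)).trans hk2.le)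
  refine ⟨d, e, had, hde, he, ?_⟩
  rw [← h2]
  constructor
  · rintro _ ⟨w, hw, rfl⟩
    have h3 : k + 1 / 2 - w ∈ Icc b c := ⟨by linarith [hw.2], by linarith [hw.1]⟩
    have h4 := hk1 _ ⟨hb.trans h3.1, h3.2⟩
    rw [sub_sub_cancel] at h4
    exact ⟨_, mem_image_of_mem _ (mem_image_of_mem _ h3), h4⟩
  · rintro _ ⟨_, ⟨f, hf, rfl⟩, rfl⟩
    exact ⟨_, mem_image_of_mem _ ⟨by linarith [hf.2], by linarith [hf.1]⟩,
      hk1 f ⟨hb.trans hf.1, hf.2⟩⟩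

/-- No excursion is needed: unscale `K` until it is an arc of the circuit or the permitted error is
trivial, and shadow the resulting arc once per scale on the way back. -/
theorem exists_close_of_origin_notMem {ε : ℝ} (hε : 0 < ε) {K : Set HilbertCube} (hc : IsClosed K)
    (hK : IsConnected K) (hKX : K ⊆ limitContinuum) (h0 : origin ∉ K) {a : ℝ}
    (ha : a ∈ Ico (1 / 2 : ℝ) 1) :
    ∃ d e : ℝ, a ≤ d ∧ d ≤ e ∧ e < 1 ∧
      HausdorffClose ε (circuit '' Icc d e) (halfShift '' K) := by
  suffices h : ∀ n : ℕ, ∀ K : Set HilbertCube, IsClosed K → IsConnected K → K ⊆ limitContinuum →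
      origin ∉ K → ∃ d e : ℝ, a ≤ d ∧ d ≤ e ∧ e < 1 ∧
      HausdorffClose (2 / 2 ^ n) (circuit '' Icc d e) (halfShift '' K) by
    obtain ⟨n, hn⟩ := exists_pow_lt_of_lt_one (show 0 < ε / 2 by positivity)
      (show (1 / 2 : ℝ) < 1 by norm_num)
    obtain ⟨d, e, had, hde, he, h1⟩ := h n K hc hK hKX h0
    refine ⟨d, e, had, hde, he, h1.mono ?_⟩
    rw [one_div, inv_pow] at hn
    rw [div_eq_mul_inv]
    linarith
  intro n
  induction n with
  | zero =>
    intro K _ hK _ _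
    refine ⟨a, a, le_rfl, le_rfl, ha.2, ?_⟩
    rw [pow_zero, div_one]
    exact hausdorffClose_two ((nonempty_Icc.2 le_rfl).image _) (hK.1.image _)
  | succ n ih =>
    intro K hc hK hKX h0
    have hε : (0 : ℝ) < 2 / 2 ^ n := by positivity
    rw [show (2 : ℝ) / 2 ^ (n + 1) = 2 / 2 ^ n / 2 by rw [pow_succ]; field_simp]
    rcases subcontinuum_of_origin_notMem hc hK hKX h0 with h | ⟨b, c, hb, hbc, hc1, rfl⟩
    · obtain ⟨L, hL1, hL2, hL3, rfl⟩ := exists_eq_halfShift_image hc hK h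
      have hL4 : origin ∉ L := fun h1 => h0 ⟨origin, h1, halfShift_edgePoint_zero⟩
      obtain ⟨b, c, hab, hbc, hc1, h1⟩ := ih L hL2 hL3 hL1 hL4
      obtain ⟨d, e, had, hde, he, h2⟩ := exists_close_circuit ha
        (by linarith [ha.1] : 0 ≤ b) hbc hc1 (show 0 < 2 / 2 ^ n / 4 by positivity)
      exact ⟨d, e, had, hde, he, (h2.trans h1.halfShift).mono (by linarith)⟩
    · exact exists_close_circuit ha hb.le hbc hc1 (half_pos hε)

/-- The scaled copy of a subcontinuum is approximated by nondegenerate arcs of the circuit. -/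
theorem exists_close {ε : ℝ} (hε : 0 < ε) {K : Set HilbertCube} (hc : IsClosed K)
    (hK : IsConnected K) (hKX : K ⊆ limitContinuum) :
    ∃ d e : ℝ, 0 < d ∧ d < e ∧ e < 1 ∧
      HausdorffClose ε (circuit '' Icc d e) (halfShift '' K) := by
  suffices h : ∃ d e : ℝ, 0 < d ∧ d ≤ e ∧ e < 1 ∧
      HausdorffClose ε (circuit '' Icc d e) (halfShift '' K) by
    obtain ⟨d, e, hd, hde, he, h1, h2⟩ := h
    -- A possibly degenerate arc is prolonged a little beyond `e`; by continuity the added points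
    -- stay close to the same point `b`.
    obtain ⟨b, hb, hb2⟩ := h1 _ (mem_image_of_mem _ (right_mem_Icc.2 hde))
    have h3 : Tendsto circuit (𝓝[≥] e) (𝓝 (circuit e)) := by
      have he0 : 0 ≤ e := hd.le.trans hde
      refine (continuousOn_circuit e ⟨he0, he⟩).mono_left ?_
      rw [← nhdsWithin_Ico_eq_nhdsGE he]
      exact nhdsWithin_mono _ fun f hf => ⟨he0.trans hf.1, hf.2⟩
    have h4 : ∀ᶠ f in 𝓝[≥] e, dist (circuit f) b < ε :=
      (h3.dist tendsto_const_nhds).eventually_lt_const hb2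
    obtain ⟨f, hf, hf2⟩ := (mem_nhdsGE_iff_exists_Icc_subset).1 h4
    have hf1 : e < min f ((e + 1) / 2) := lt_min hf (by linarith)
    refine ⟨d, min f ((e + 1) / 2), hd, hde.trans_lt hf1,
      (min_le_right _ _).trans_lt (by linarith), ?_, ?_⟩
    · rintro _ ⟨g, hg, rfl⟩
      rcases le_total g e with h5 | h5
      · exact h1 _ (mem_image_of_mem _ ⟨hg.1, h5⟩)
      · exact ⟨b, hb, hf2 ⟨h5, hg.2.trans (min_le_left _ _)⟩⟩
    · intro z hz
      obtain ⟨_, ⟨g, hg, rfl⟩, h5⟩ := h2 z hz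
      exact ⟨_, mem_image_of_mem _ ⟨hg.1, hg.2.trans hf1.le⟩, h5⟩
  have hhalf : (1 / 2 : ℝ) ∈ Ico (1 / 2 : ℝ) 1 := by norm_num
  by_cases h0 : origin ∈ K
  · obtain ⟨m, hm, j, hj, l, hl, h1⟩ :=
      frequently_atTop.1 (frequently_close hε hc hK hKX h0) 1
    have hm1 : (1 : ℝ) ≤ m := by exact_mod_cast hm
    have hj2 : (j : ℝ) ≤ 2 * m := by exact_mod_cast hj
    have h2 : 1 / 4 ≤ gridLeft m j := by
      have h3 : (j : ℝ) / (2 * (m + 2)) ≤ 1 := by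
        rw [div_le_one (by positivity)]; linarith
      unfold gridLeft
      linarith
    obtain ⟨d, e, had, hde, he, h3⟩ := exists_circuit_image_eq hhalf h2
      ((gridLeft_le m j).trans (le_gridRight m l))
      (by rw [height_half_add_half]; exact time_le_one h2)
    exact ⟨d, e, by linarith, hde, he, h3 ▸ h1⟩
  · obtain ⟨d, e, had, hde, he, h1⟩ := exists_close_of_origin_notMem hε hc hK hKX h0 hhalf
    exact ⟨d, e, by linarith, hde, he, h1⟩

end WarsawTower

/-! ### Topological graphs and tranching maps -/

/-- The trace of an arc on small neighbourhoods of a point. -/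
theorem exists_connected_trace {Y : Type*} [TopologicalSpace Y] [T2Space Y]
    {γ : unitInterval → Y} (hγ : IsEmbedding γ) {O : Set Y} (hO : IsOpen O) {y : Y} (hy : y ∈ O) :
    ∃ C Z : Set Y, IsClosed C ∧ IsClosed Z ∧ y ∈ C ∧ y ∉ Z ∧ IsPreconnected C ∧ C ⊆ O ∧
      range γ ⊆ C ∪ Z := by
  by_cases h : y ∈ range γ
  · obtain ⟨s, rfl⟩ := h
    have hg : Continuous fun u : ℝ => γ (projIcc 0 1 zero_le_one u) :=
      hγ.continuous.comp continuous_projIcc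
    have h1 : (fun u : ℝ => γ (projIcc 0 1 zero_le_one u)) ⁻¹' O ∈ 𝓝 (s : ℝ) := by
      refine (hO.preimage hg).mem_nhds ?_
      rwa [mem_preimage, projIcc_val]
    obtain ⟨δ, hδ, h2⟩ := Metric.nhds_basis_closedBall.mem_iff.1 h1
    rw [Real.closedBall_eq_Icc] at h2
    have hZ : IsCompact {u : unitInterval | δ ≤ dist u s} :=
      (isClosed_le continuous_const (continuous_id.dist continuous_const)).isCompact
    refine ⟨(fun u : ℝ => γ (projIcc 0 1 zero_le_one u)) '' Icc (s - δ) (s + δ),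
      γ '' {u : unitInterval | δ ≤ dist u s}, (isCompact_Icc.image hg).isClosed,
      (hZ.image hγ.continuous).isClosed, ⟨s, by constructor <;> linarith, by simp⟩, ?_,
      isPreconnected_Icc.image _ hg.continuousOn, image_subset_iff.2 h2, ?_⟩
    · rintro ⟨u, hu, h3⟩
      rw [hγ.injective h3, mem_ofPred_eq, dist_self] at hu
      linarith
    · rintro _ ⟨u, rfl⟩
      rcases le_total δ (dist u s) with h3 | h3
      · exact Or.inr ⟨u, h3, rfl⟩
      · refine Or.inl ⟨u, ?_, by simp⟩
        rw [Subtype.dist_eq, Real.dist_eq, abs_le] at h3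
        constructor <;> linarith [h3.1, h3.2]
  · exact ⟨{y}, range γ, isClosed_singleton, (isCompact_range hγ.continuous).isClosed, rfl, h,
      isPreconnected_singleton, singleton_subset_iff.2 hy, subset_union_right⟩

/-- The points of a topological graph have arbitrarily small closed connected neighbourhoods. -/
theorem IsTopologicalGraph.exists_connected_nhds {Y : Type*} [TopologicalSpace Y]
    (hY : IsTopologicalGraph Y) {O : Set Y} (hO : IsOpen O) {y : Y} (hy : y ∈ O) :
    ∃ V ∈ 𝓝 y, IsClosed V ∧ IsConnected V ∧ V ⊆ O := by
  obtain ⟨hT2, n, e, he, hcov, -⟩ := hY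
  choose C Z hC hZ hyC hyZ hconn hCO hsub using fun i => exists_connected_trace (he i) hO hy
  have hy2 : y ∈ ⋃ i, range (e i) := hcov ▸ mem_univ y
  obtain ⟨i₀, -⟩ := mem_iUnion.1 hy2
  refine ⟨⋃ i, C i, ?_, isClosed_iUnion_of_finite hC, ⟨⟨y, mem_iUnion.2 ⟨i₀, hyC i₀⟩⟩,
    isPreconnected_iUnion ⟨y, mem_iInter.2 hyC⟩ hconn⟩, iUnion_subset hCO⟩
  -- Points outside the finitely many closed sets `Z i`, none of which contains `y`, can only lie in
  -- some `C i`; the `C i` all contain `y`, so their union is connected.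
  have h1 : (⋃ i, Z i)ᶜ ∈ 𝓝 y := by
    refine (isClosed_iUnion_of_finite hZ).isOpen_compl.mem_nhds ?_
    rw [mem_compl_iff, mem_iUnion]
    rintro ⟨i, hi⟩
    exact hyZ i hi
  filter_upwards [h1] with z hz
  have hz2 : z ∈ ⋃ i, range (e i) := hcov ▸ mem_univ z
  obtain ⟨i, hi⟩ := mem_iUnion.1 hz2
  rcases hsub i hi with h2 | h2
  · exact mem_iUnion.2 ⟨i, h2⟩
  · exact absurd (mem_iUnion.2 ⟨i, h2⟩) hz

theorem IsTranchingMap.surjective {X Y : Type*} [TopologicalSpace X] [TopologicalSpace Y]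
    {φ : X → Y} (h : IsTranchingMap φ) : Function.Surjective φ := fun y => (h.monotone y).1

theorem IsTranchingMap.isConnected_preimage {X Y : Type*} [TopologicalSpace X]
    [TopologicalSpace Y] [CompactSpace X] {φ : X → Y} (h : IsTranchingMap φ) {V : Set Y}
    (hV : IsClosed V) (hc : IsConnected V) : IsConnected (φ ⁻¹' V) := by
  have := h.graph.1
  exact (h.continuous.isClosedMap.isQuotientMap h.continuous
    h.surjective).isCoinducing.isConnected_preimage_of_isClosed h.monotone hV hc

/-- Being a tranche is preserved by embeddings. -/
theorem IsTranche.image {E F : Type*} [TopologicalSpace E] [TopologicalSpace F] {T S : Set E}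
    {g : E → F} (hg : IsEmbedding g) (h : IsTranche T S) : IsTranche (g '' T) (g '' S) := by
  obtain ⟨⟨hS1, hS2⟩, Y, _, φ, hφ, y, rfl, hT⟩ := h
  obtain ⟨e, he⟩ : ∃ e : S ≃ₜ g '' S, ∀ x, (e x : F) = g x :=
    ⟨hg.homeomorphImage S, fun _ => rfl⟩
  refine ⟨⟨e.compactSpace, e.surjective.connectedSpace e.continuous⟩, Y, inferInstance,
    φ ∘ e.symm, ⟨hφ.graph, hφ.continuous.comp e.symm.continuous, fun z => ?_, ?_⟩, y, ?_,
    hT.image hg.injective⟩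
  · rw [preimage_comp]
    exact e.symm.isConnected_preimage.2 (hφ.monotone z)
  · have h1 : {z | ((φ ∘ e.symm) ⁻¹' {z}).Subsingleton} = {z | (φ ⁻¹' {z}).Subsingleton} := by
      ext z
      rw [mem_ofPred_eq, mem_ofPred_eq, preimage_comp]
      exact ⟨fun h => by
        simpa only [image_preimage_eq _ e.symm.surjective] using h.image e.symm,
        fun h => h.preimage e.symm.injective⟩
    rw [h1, preimage_comp]
    exact hφ.dense.preimage e.symm.isOpenMap
  · rw [preimage_comp, ← e.image_eq_preimage_symm, image_image, image_image]
    simp only [he]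

namespace WarsawTower

open HilbertCube

/-! ### Uniqueness of the tranche -/

theorem limitContinuum_subset_closure_Ioo : limitContinuum ⊆ closure (circuit '' Ioo 0 1) := by
  intro x hx
  rcases mem_limitContinuum_cases hx with h | h
  · exact subset_closure h
  · refine closure_mono (image_mono ?_) (halfShift_image_subset_closure
      (show (1 / 2 : ℝ) < 1 by norm_num) h)
    exact fun d hd => ⟨by linarith [hd.1], hd.2⟩

section Uniqueness

variable {Y : Type*} [TopologicalSpace Y] {φ : limitContinuum → Y}

theorem isConnected_val_image {A : Set limitContinuum} (h : IsConnected A) :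
    IsConnected ((↑) '' A : Set HilbertCube) := h.image _ continuous_subtype_val.continuousOn

theorem val_image_subset (A : Set limitContinuum) :
    ((↑) '' A : Set HilbertCube) ⊆ limitContinuum := by
  rintro _ ⟨x, -, rfl⟩
  exact x.2

/-- The points of the open circuit have degenerate fibers. -/
theorem fiber_subsingleton (hφ : IsTranchingMap φ) {y : Y} {d : ℝ} (hd : d ∈ Ioo (0 : ℝ) 1)
    (h : circuit d ∈ ((↑) '' (φ ⁻¹' {y}) : Set HilbertCube)) :
    ∀ x ∈ ((↑) '' (φ ⁻¹' {y}) : Set HilbertCube), x = circuit d := by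
  have hF := isConnected_val_image (hφ.monotone y)
  have hFX := val_image_subset (φ ⁻¹' {y})
  have hgap : ∀ p q : ℝ, 0 < p → p < q → q < 1 →
      ∃ e ∈ Ioo p q, circuit e ∉ ((↑) '' (φ ⁻¹' {y}) : Set HilbertCube) := by
    intro p q hp hpq hq
    -- If the fiber contained a whole open arc of the circuit, density would give a point of that
    -- arc with degenerate fiber. That fiber is the given one, which contains many points of the
    -- arc.
    by_contra! hall
    have hB : IsClosed (loop '' (Icc 0 p ∪ Icc q 1)) :=
      ((isCompact_Icc.union isCompact_Icc).image continuous_loop).isClosed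
    have hU : IsOpen {x : limitContinuum | proj x ∉ loop '' (Icc 0 p ∪ Icc q 1)} :=
      hB.isOpen_compl.preimage (continuous_proj.comp continuous_subtype_val)
    have hmem : ∀ e ∈ Ioo p q, e ∈ Ioo (0 : ℝ) 1 := fun e he => ⟨hp.trans he.1, he.2.trans hq⟩
    have hne : ((p + q) / 2) ∈ Ioo p q := ⟨by linarith, by linarith⟩
    have hne2 : ((2 * p + q) / 3) ∈ Ioo p q := ⟨by linarith, by linarith⟩
    have hin : ∀ e ∈ Ioo p q, loop e ∉ loop '' (Icc 0 p ∪ Icc q 1) := by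
      rintro e he ⟨f, hf, h1⟩
      have hf' : f ∈ Icc (0 : ℝ) 1 := by
        rcases hf with hf | hf
        · exact ⟨hf.1, by linarith [hf.2]⟩
        · exact ⟨by linarith [hf.1], hf.2⟩
      have h2 := eq_of_loop_eq hf' (hmem e he) h1
      rcases hf with hf | hf
      · linarith [hf.2, he.1]
      · linarith [hf.1, he.2]
    obtain ⟨x, hxU, hx⟩ := hφ.dense.inter_open_nonempty _ hU
      ⟨⟨circuit ((p + q) / 2), circuit_mem ⟨(hmem _ hne).1.le, (hmem _ hne).2⟩⟩, by
        rw [mem_ofPred_eq, proj_circuit ⟨(hmem _ hne).1.le, (hmem _ hne).2⟩]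
        exact hin _ hne⟩
    obtain ⟨e, he, hxe⟩ := proj_mem_loop x.2
    have he2 : e ∈ Ioo p q := by
      rw [mem_ofPred_eq, hxe] at hxU
      constructor
      · by_contra! h1
        exact hxU ⟨e, Or.inl ⟨he.1, h1⟩, rfl⟩
      · by_contra! h1
        exact hxU ⟨e, Or.inr ⟨h1, he.2.le⟩, rfl⟩
    have hxc := eq_circuit_of_proj_eq x.2 (hmem e he2) hxe
    obtain ⟨x', hx'1, hx'2⟩ := hall e he2
    have hxx : x = x' := Subtype.ext (hxc.trans hx'2.symm)
    have hxy : φ x = y := hxx ▸ hx'1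
    rw [mem_preimage, mem_ofPred_eq, hxy] at hx
    obtain ⟨u, hu1, hu2⟩ := hall _ hne
    obtain ⟨v, hv1, hv2⟩ := hall _ hne2
    have h3 := hx hu1 hv1
    rw [h3] at hu2
    have h4 := circuit_injOn ⟨(hmem _ hne).1.le, (hmem _ hne).2⟩
      ⟨(hmem _ hne2).1.le, (hmem _ hne2).2⟩ (hu2.symm.trans hv2)
    linarith
  intro x hx
  obtain ⟨p, hp, hpF⟩ := hgap (d / 2) d (by linarith [hd.1]) (by linarith [hd.1]) hd.2
  obtain ⟨q, hq, hqF⟩ := hgap d ((d + 1) / 2) hd.1 (by linarith [hd.2]) (by linarith [hd.2])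
  have hp0 : 0 < p := by linarith [hp.1, hd.1]
  have hq1 : q < 1 := by linarith [hq.2, hd.2]
  have hbetween : ∀ p' q' : ℝ, 0 < p' → p' < d → d < q' → q' < 1 →
      circuit p' ∉ ((↑) '' (φ ⁻¹' {y}) : Set HilbertCube) →
      circuit q' ∉ ((↑) '' (φ ⁻¹' {y}) : Set HilbertCube) →
      ((↑) '' (φ ⁻¹' {y}) : Set HilbertCube) ⊆ circuit '' Ioo p' q' :=
    fun p' q' h1 h2 h3 h4 h5 h6 => (subset_or_forall_notMem hF.2 hFX h1 (h2.trans h3).le h4 h5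
      h6).resolve_right fun h7 => h7 d ⟨h2.le, h3.le⟩ h
  obtain ⟨e, he, rfl⟩ := hbetween p q hp0 hp.2 hq.1 hq1 hpF hqF hx
  have he0 : 0 < e := hp0.trans he.1
  have he1 : e < 1 := he.2.trans hq1
  -- Another point of the fiber would be cut off from `circuit d` by a missed point between them.
  rcases lt_trichotomy e d with h1 | rfl | h1
  · obtain ⟨p', hp', hp'F⟩ := hgap e d he0 h1 hd.2
    obtain ⟨f, hf, hfe⟩ := hbetween p' q (he0.trans hp'.1) hp'.2 hq.1 hq1 hp'F hqF hx
    have := circuit_injOn ⟨((he0.trans hp'.1).trans hf.1).le, hf.2.trans hq1⟩ ⟨he0.le, he1⟩ hfe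
    linarith [hf.1, hp'.1]
  · rfl
  · obtain ⟨q', hq', hq'F⟩ := hgap d e hd.1 h1 he1
    obtain ⟨f, hf, hfe⟩ := hbetween p q' hp0 hp.2 hq'.1 (hq'.2.trans he1) hpF hq'F hx
    have := circuit_injOn ⟨(hp0.trans hf.1).le, hf.2.trans (hq'.2.trans he1)⟩ ⟨he0.le, he1⟩ hfe
    linarith [hf.2, hq'.2]

/-- The limit set of the ray lies in one fiber. -/
theorem eq_of_mem_halfShift_image (hφ : IsTranchingMap φ) {a b : limitContinuum}
    (ha : (a : HilbertCube) ∈ halfShift '' limitContinuum)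
    (hb : (b : HilbertCube) ∈ halfShift '' limitContinuum) : φ a = φ b := by
  by_contra hne
  have := hφ.graph.1
  have : CompactSpace limitContinuum := isCompact_iff_compactSpace.1 isCompact_limitContinuum
  obtain ⟨O, O', hO, hO', haO, hbO', hdisj⟩ := t2_separation hne
  obtain ⟨V, hV, hVc, hVconn, hVO⟩ := hφ.graph.exists_connected_nhds hO haO
  have hU := isConnected_val_image (hφ.isConnected_preimage hVc hVconn)
  have hUX := val_image_subset (φ ⁻¹' V)
  have h1 : φ ⁻¹' V ∈ 𝓝 a := hφ.continuous.continuousAt.preimage_mem_nhds hV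
  have h2 : φ ⁻¹' O' ∈ 𝓝 b :=
    hφ.continuous.continuousAt.preimage_mem_nhds (hO'.mem_nhds hbO')
  have hfind : ∀ {z : limitContinuum} {N : Set limitContinuum}, N ∈ 𝓝 z →
      (z : HilbertCube) ∈ halfShift '' limitContinuum → ∀ c : ℝ, 0 < c → c < 1 →
      ∃ d ∈ Ico c 1, circuit d ∈ ((↑) '' N : Set HilbertCube) := by
    intro z N hN hz c hc0 hc1
    rw [nhds_subtype, mem_comap] at hN
    obtain ⟨W, hW, hWN⟩ := hN
    obtain ⟨_, hx, d, hd, rfl⟩ :=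
      mem_closure_iff_nhds.1 (halfShift_image_subset_closure hc1 hz) W hW
    exact ⟨d, hd, ⟨circuit d, circuit_mem ⟨hc0.le.trans hd.1, hd.2⟩⟩, hWN hx, rfl⟩
  have hnot : ∀ d : ℝ, circuit d ∈ ((↑) '' (φ ⁻¹' O') : Set HilbertCube) →
      circuit d ∉ ((↑) '' (φ ⁻¹' V) : Set HilbertCube) := by
    rintro d ⟨u, hu, hu2⟩ ⟨v, hv, hv2⟩
    have : u = v := Subtype.ext (hu2.trans hv2.symm)
    subst this
    exact disjoint_left.1 hdisj (hVO hv) hu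
  -- The ray passes near `b`, then near `a`, then near `b` again. The connected preimage of `V`
  -- avoids the outer two points and contains the middle one, so it would lie between them; but it
  -- also contains `a`, which is off the open circuit.
  obtain ⟨p, hp, hp2⟩ := hfind h2 hb (1 / 2) (by norm_num) (by norm_num)
  have hp0 : 0 < p := by linarith [hp.1]
  obtain ⟨q, hq, hq2⟩ := hfind h1 ha p hp0 hp.2
  obtain ⟨r, hr, hr2⟩ := hfind h2 hb q (hp0.trans_le hq.1) hq.2
  rcases subset_or_forall_notMem hU.2 hUX hp0 (hq.1.trans hr.1) hr.2 (hnot p hp2) (hnot r hr2)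
    with h3 | h3
  · obtain ⟨d, hd, h4⟩ := h3 ⟨a, mem_of_mem_nhds h1, rfl⟩
    obtain ⟨z, -, hz⟩ := ha
    exact circuit_ne_halfShift ⟨hp0.trans hd.1, hd.2.trans hr.2⟩ z (h4.trans hz.symm)
  · exact h3 q ⟨hq.1, hr.1⟩ hq2

/-- For an arbitrary tranching map, fibers through the open circuit are degenerate and the limit set
lies in a single fiber; a nondegenerate fiber is therefore the limit set itself. -/
theorem eq_of_isTranche {T : Set HilbertCube} (h : IsTranche T limitContinuum) :
    T = halfShift '' limitContinuum := by
  obtain ⟨-, Y, _, φ, hφ, y, rfl, hT⟩ := h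
  have hsub : ((↑) '' (φ ⁻¹' {y}) : Set HilbertCube) ⊆ halfShift '' limitContinuum := by
    intro x hx
    refine (mem_limitContinuum_cases (val_image_subset _ hx)).resolve_left ?_
    rintro ⟨d, hd, rfl⟩
    have h1 := fiber_subsingleton hφ hd hx
    exact hT.not_subsingleton fun u hu v hv => (h1 u hu).trans (h1 v hv).symm
  refine Subset.antisymm hsub fun x hx => ?_
  obtain ⟨_, ⟨z, hz, rfl⟩⟩ := hT.nonempty
  have hxX : x ∈ limitContinuum := by
    obtain ⟨u, hu, rfl⟩ := hx
    exact halfShift_mem hu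
  refine ⟨⟨x, hxX⟩, ?_, rfl⟩
  rw [mem_preimage, eq_of_mem_halfShift_image hφ (a := ⟨x, hxX⟩) (b := z) hx
    (hsub (mem_image_of_mem _ hz))]
  exact hz

end Uniqueness

/-! ### The tranching map -/

/-- The simple closed curve below the limit continuum. -/
def loopSpace : Set (ℝ × ℝ) := loop '' Icc 0 1

/-- Two arcs, the images of the halves of the parameter interval; they meet at both ends. -/
theorem isTopologicalGraph_loopSpace : IsTopologicalGraph loopSpace := by
  have hmem : ∀ (i : Fin 2) (t : unitInterval), ((i : ℕ) + (t : ℝ)) / 2 ∈ Icc (0 : ℝ) 1 := by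
    intro i t
    have h0 := t.2.1
    have h1 := t.2.2
    have h2 : ((i : ℕ) : ℝ) ≤ 1 := by exact_mod_cast Nat.lt_succ_iff.1 i.2
    have h3 : (0 : ℝ) ≤ (i : ℕ) := by positivity
    exact ⟨by linarith, by linarith⟩
  let e : Fin 2 → unitInterval → loopSpace := fun i t =>
    ⟨loop (((i : ℕ) + (t : ℝ)) / 2), mem_image_of_mem _ (hmem i t)⟩
  have he : ∀ i t, (e i t : ℝ × ℝ) = loop (((i : ℕ) + (t : ℝ)) / 2) := fun _ _ => rfl
  have hinter : ∀ t s : unitInterval, e 0 t = e 1 s → t = 0 ∧ s = 1 ∨ t = 1 ∧ s = 0 := by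
    intro t s h
    have h1 := congrArg Subtype.val h
    rw [he, he] at h1
    have ht0 := t.2.1
    have ht1 := t.2.2
    have hs0 := s.2.1
    have hs1 := s.2.2
    have h2 := loop_injOn (hmem 0 t) (hmem 1 s) h1
    simp only [Fin.isValue, Fin.coe_ofNat_eq_mod, Nat.zero_mod, Nat.one_mod, Nat.cast_zero,
      Nat.cast_one] at h2
    rcases h2 with h2 | h2 | h2
    · exact Or.inr ⟨Subtype.ext (by simp only [Set.Icc.coe_one]; linarith),
        Subtype.ext (by simp only [Set.Icc.coe_zero]; linarith)⟩
    · exact Or.inl ⟨Subtype.ext (by simp only [Set.Icc.coe_zero]; linarith),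
        Subtype.ext (by simp only [Set.Icc.coe_one]; linarith)⟩
    · linarith
  refine ⟨inferInstance, 2, e, fun i => ?_, ?_, ?_⟩
  · have hcont : Continuous (e i) :=
      (continuous_loop.comp (by fun_prop)).subtype_mk _
    refine (hcont.isClosedEmbedding fun t s h => ?_).isEmbedding
    have h1 := congrArg Subtype.val h
    rw [he, he] at h1
    have ht0 := t.2.1
    have ht1 := t.2.2
    have hs0 := s.2.1
    have hs1 := s.2.2
    have h3 : (0 : ℝ) ≤ (i : ℕ) := by positivity
    refine Subtype.ext ?_
    rcases loop_injOn (hmem i t) (hmem i s) h1 with h2 | h2 | h2 <;> linarith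
  · refine eq_univ_of_forall ?_
    rintro ⟨_, d, hd, rfl⟩
    rcases le_total d (1 / 2) with h | h
    · refine mem_iUnion.2 ⟨0, ⟨2 * d, by linarith [hd.1], by linarith⟩, Subtype.ext ?_⟩
      rw [he]
      congr 1
      simp
    · refine mem_iUnion.2 ⟨1, ⟨2 * d - 1, by linarith, by linarith [hd.2]⟩, Subtype.ext ?_⟩
      rw [he]
      congr 1
      simp
  · intro i j hij x hx
    obtain ⟨⟨t, rfl⟩, ⟨s, hs⟩⟩ := hx
    fin_cases i <;> fin_cases j
    · exact absurd rfl hij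
    · rcases hinter t s hs.symm with ⟨rfl, rfl⟩ | ⟨rfl, rfl⟩
      · exact ⟨Or.inl rfl, Or.inr hs.symm⟩
      · exact ⟨Or.inr rfl, Or.inl hs.symm⟩
    · rcases hinter s t hs with ⟨rfl, rfl⟩ | ⟨rfl, rfl⟩
      · exact ⟨Or.inr rfl, Or.inl hs.symm⟩
      · exact ⟨Or.inl rfl, Or.inr hs.symm⟩
    · exact absurd rfl hij

/-- The tranching map of the limit continuum. -/
noncomputable def tranching (x : limitContinuum) : loopSpace :=
  ⟨proj x, by
    obtain ⟨d, hd, h⟩ := proj_mem_loop x.2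
    exact ⟨d, ⟨hd.1, hd.2.le⟩, h.symm⟩⟩

theorem tranching_coe (x : limitContinuum) : (tranching x : ℝ × ℝ) = proj x := rfl

theorem continuous_tranching : Continuous tranching :=
  (continuous_proj.comp continuous_subtype_val).subtype_mk _

theorem tranching_fiber_circuit {y : loopSpace} {d : ℝ} (hd : d ∈ Ioo (0 : ℝ) 1)
    (h : (y : ℝ × ℝ) = loop d) : ((↑) '' (tranching ⁻¹' {y}) : Set HilbertCube) = {circuit d} := by
  have hd' : d ∈ Ico (0 : ℝ) 1 := ⟨hd.1.le, hd.2⟩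
  ext x
  constructor
  · rintro ⟨x, hx, rfl⟩
    refine eq_circuit_of_proj_eq x.2 hd ?_
    rw [← tranching_coe, (hx : tranching x = y), h]
  · rintro rfl
    refine ⟨⟨circuit d, circuit_mem hd'⟩, Subtype.ext ?_, rfl⟩
    rw [tranching_coe, h]
    exact proj_circuit hd'

theorem tranching_fiber_zero {y : loopSpace} (h : (y : ℝ × ℝ) = 0) :
    ((↑) '' (tranching ⁻¹' {y}) : Set HilbertCube) = halfShift '' limitContinuum := by
  ext x
  constructor
  · rintro ⟨x, hx, rfl⟩
    have hx0 : proj x = 0 := by rw [← tranching_coe, (hx : tranching x = y), h]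
    refine (mem_limitContinuum_cases x.2).resolve_left ?_
    rintro ⟨d, hd, hdx⟩
    rw [← hdx, proj_circuit ⟨hd.1.le, hd.2⟩] at hx0
    exact (height_pos hd.1 hd.2).ne' (congrArg Prod.fst hx0)
  · rintro ⟨x, hx, rfl⟩
    refine ⟨⟨_, halfShift_mem hx⟩, Subtype.ext ?_, rfl⟩
    rw [tranching_coe, h]
    exact proj_halfShift x

theorem loopSpace_cases (y : loopSpace) : (y : ℝ × ℝ) = 0 ∨ ∃ d ∈ Ioo (0 : ℝ) 1,
    (y : ℝ × ℝ) = loop d := by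
  obtain ⟨y, d, hd, rfl⟩ := y
  rcases eq_or_lt_of_le hd.1 with rfl | h0
  · exact Or.inl loop_zero
  rcases eq_or_lt_of_le hd.2 with rfl | h1
  · exact Or.inl loop_one
  · exact Or.inr ⟨d, ⟨h0, h1⟩, rfl⟩

theorem isConnected_of_val_image {A : Set limitContinuum}
    (h : IsConnected ((↑) '' A : Set HilbertCube)) : IsConnected A :=
  ⟨h.1.of_image, IsInducing.subtypeVal.isPreconnected_image.1 h.2⟩

theorem isConnected_halfShift_image : IsConnected (halfShift '' limitContinuum) :=
  isConnected_limitContinuum.image _ continuous_halfShift.continuousOn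

theorem dense_circuit : Dense {x : limitContinuum | ∃ d ∈ Ioo (0 : ℝ) 1, circuit d = x} := by
  intro x
  rw [closure_subtype]
  refine closure_mono ?_ (limitContinuum_subset_closure_Ioo x.2)
  rintro _ ⟨d, hd, rfl⟩
  exact ⟨⟨circuit d, circuit_mem ⟨hd.1.le, hd.2⟩⟩, ⟨d, hd, rfl⟩, rfl⟩

theorem isTranchingMap_tranching : IsTranchingMap tranching where
  graph := isTopologicalGraph_loopSpace
  continuous := continuous_tranching
  monotone y := by
    refine isConnected_of_val_image ?_
    rcases loopSpace_cases y with h | ⟨d, hd, h⟩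
    · rw [tranching_fiber_zero h]
      exact isConnected_halfShift_image
    · rw [tranching_fiber_circuit hd h]
      exact isConnected_singleton
  dense := by
    refine dense_circuit.mono ?_
    rintro x ⟨d, hd, hx⟩
    have h1 : ((tranching x : loopSpace) : ℝ × ℝ) = loop d := by
      rw [tranching_coe, ← hx, proj_circuit ⟨hd.1.le, hd.2⟩]
    rw [mem_preimage, mem_ofPred_eq, ← Subtype.val_injective.subsingleton_image_iff,
      tranching_fiber_circuit hd h1]
    exact subsingleton_singleton

theorem isContinuum_limitContinuum : IsContinuum limitContinuum :=
  ⟨isCompact_iff_compactSpace.1 isCompact_limitContinuum,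
    isConnected_iff_connectedSpace.1 isConnected_limitContinuum⟩

theorem isTranchedGraph_limitContinuum : IsTranchedGraph limitContinuum :=
  ⟨isContinuum_limitContinuum, loopSpace, inferInstance, tranching, isTranchingMap_tranching⟩

theorem origin_ne_edgePoint_one : origin ≠ edgePoint 1 := fun h => by
  have h1 := congrArg (fun z : HilbertCube => (z 0 : ℝ)) h
  simp only [edgePoint_zero le_rfl zero_le_one, edgePoint_zero zero_le_one le_rfl] at h1
  exact zero_ne_one h1

theorem nontrivial_limitContinuum : limitContinuum.Nontrivial :=
  ⟨_, origin_mem, _, edgePoint_mem (by simp), origin_ne_edgePoint_one⟩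

theorem isTranche_limitContinuum : IsTranche (halfShift '' limitContinuum) limitContinuum :=
  ⟨isContinuum_limitContinuum, loopSpace, inferInstance, tranching, isTranchingMap_tranching,
    ⟨0, 0, by simp, loop_zero⟩, (tranching_fiber_zero rfl).symm,
    nontrivial_limitContinuum.image halfShift_injective⟩

theorem isNowhereDense_fiber (y : loopSpace) : IsNowhereDense (tranching ⁻¹' {y}) := by
  have hclosed : IsClosed (tranching ⁻¹' {y}) := isClosed_singleton.preimage continuous_tranching
  rw [hclosed.isNowhereDense_iff, interior_eq_empty_iff_dense_compl]
  rcases loopSpace_cases y with h | ⟨d, hd, h⟩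
  · refine dense_circuit.mono ?_
    rintro x ⟨d, hd, hx⟩ hxy
    have h1 := mem_image_of_mem ((↑) : limitContinuum → HilbertCube) hxy
    rw [tranching_fiber_zero h, ← hx] at h1
    obtain ⟨z, -, hz⟩ := h1
    exact circuit_ne_halfShift hd z hz.symm
  · have := isContinuum_limitContinuum.2
    have : Nontrivial limitContinuum := nontrivial_limitContinuum.coe_sort
    have h1 : tranching ⁻¹' {y} = {⟨circuit d, circuit_mem ⟨hd.1.le, hd.2⟩⟩} := by
      refine Subtype.val_injective.image_injective ?_
      change ((↑) '' (tranching ⁻¹' {y}) : Set HilbertCube) = _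
      rw [tranching_fiber_circuit hd h, image_singleton]
    rw [h1]
    exact dense_compl_singleton _

/-- The arc of the simple closed curve below an arc of the circuit. -/
theorem exists_isArc {a b : ℝ} (ha : 0 < a) (hab : a < b) (hb : b < 1) :
    ∃ J : Set loopSpace, IsArc J ∧
      ((↑) '' (tranching ⁻¹' J) : Set HilbertCube) = circuit '' Icc a b := by
  have hmem : ∀ t : unitInterval, a + t * (b - a) ∈ Icc a b := fun t => by
    have h0 := t.2.1
    have h1 := t.2.2
    constructor <;> nlinarith
  have h01 : ∀ d ∈ Icc a b, d ∈ Ioo (0 : ℝ) 1 := fun d hd =>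
    ⟨ha.trans_le hd.1, hd.2.trans_lt hb⟩
  have h01' : ∀ d ∈ Icc a b, d ∈ Icc (0 : ℝ) 1 := fun d hd => Ioo_subset_Icc_self (h01 d hd)
  let γ : unitInterval → loopSpace := fun t =>
    ⟨loop (a + t * (b - a)), mem_image_of_mem _ (h01' _ (hmem t))⟩
  have hγ : Continuous γ := (continuous_loop.comp (by fun_prop)).subtype_mk _
  refine ⟨range γ, ⟨γ, (hγ.isClosedEmbedding fun t s h => ?_).isEmbedding, rfl⟩, ?_⟩
  · have h2 := eq_of_loop_eq (h01' _ (hmem t)) (h01 _ (hmem s)) (congrArg Subtype.val h)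
    exact Subtype.ext (mul_right_cancel₀ (sub_pos.2 hab).ne' (add_left_cancel h2))
  · ext x
    constructor
    · rintro ⟨x, ⟨t, ht⟩, rfl⟩
      exact ⟨_, hmem t, (eq_circuit_of_proj_eq x.2 (h01 _ (hmem t))
        (congrArg Subtype.val ht).symm).symm⟩
    · rintro ⟨d, hd, rfl⟩
      have hd2 : d ∈ Ico (0 : ℝ) 1 := ⟨(h01 d hd).1.le, (h01 d hd).2⟩
      have hba := sub_pos.2 hab
      refine ⟨⟨circuit d, circuit_mem hd2⟩, ⟨⟨(d - a) / (b - a), ?_, ?_⟩, Subtype.ext ?_⟩, rfl⟩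
      · exact div_nonneg (by linarith [hd.1]) hba.le
      · rw [div_le_one hba]
        linarith [hd.2]
      · rw [tranching_coe]
        change loop (a + (d - a) / (b - a) * (b - a)) = proj (circuit d)
        rw [div_mul_cancel₀ _ hba.ne', add_sub_cancel, proj_circuit hd2]

theorem isGeneralizedSinContinuum_limitContinuum : IsGeneralizedSinContinuum limitContinuum := by
  refine ⟨isContinuum_limitContinuum, loopSpace, inferInstance, tranching,
    isTranchingMap_tranching, isNowhereDense_fiber, fun y K hKy hK1 hK2 ε hε => ?_⟩
  have hK3 : IsCompact ((↑) '' K : Set HilbertCube) := hK1.image continuous_subtype_val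
  have hK4 : IsConnected ((↑) '' K : Set HilbertCube) := isConnected_val_image hK2
  have hK5 : ((↑) '' K : Set HilbertCube) ⊆ (↑) '' (tranching ⁻¹' {y}) := image_mono hKy
  obtain ⟨a, b, ha, hab, hb, hclose⟩ : ∃ a b : ℝ, 0 < a ∧ a < b ∧ b < 1 ∧
      HausdorffClose (ε / 2) (circuit '' Icc a b) ((↑) '' K : Set HilbertCube) := by
    rcases loopSpace_cases y with h | ⟨d, hd, h⟩
    · rw [tranching_fiber_zero h] at hK5
      obtain ⟨L, hL1, hL2, hL3, hL4⟩ := exists_eq_halfShift_image hK3.isClosed hK4 hK5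
      rw [hL4]
      exact exists_close (half_pos hε) hL2 hL3 hL1
    · rw [tranching_fiber_circuit hd h] at hK5
      rw [hK4.1.subset_singleton_iff.1 hK5]
      have h3 : Tendsto circuit (𝓝[≥] d) (𝓝 (circuit d)) := by
        refine (continuousOn_circuit d ⟨hd.1.le, hd.2⟩).mono_left ?_
        rw [← nhdsWithin_Ico_eq_nhdsGE hd.2]
        exact nhdsWithin_mono _ fun f hf => ⟨hd.1.le.trans hf.1, hf.2⟩
      obtain ⟨f, hf, hf2⟩ := mem_nhdsGE_iff_exists_Icc_subset.1
        (h3.eventually (Metric.ball_mem_nhds _ (half_pos hε)))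
      have hdf : d < min f ((d + 1) / 2) := lt_min hf (by linarith [hd.2])
      refine ⟨d, min f ((d + 1) / 2), hd.1, hdf, (min_le_right _ _).trans_lt (by linarith [hd.2]),
        ?_, ?_⟩
      · rintro _ ⟨g, hg, rfl⟩
        exact ⟨_, rfl, hf2 ⟨hg.1, hg.2.trans (min_le_left _ _)⟩⟩
      · rintro _ rfl
        exact ⟨_, mem_image_of_mem _ ⟨le_rfl, hdf.le⟩, by rw [dist_self]; positivity⟩
  obtain ⟨J, hJ, hJ2⟩ := exists_isArc ha hab hb
  refine ⟨J, hJ, ?_⟩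
  rw [← Metric.hausdorffDist_image isometry_subtype_coe, hJ2]
  linarith [hclose.hausdorffDist_le (half_pos hε).le]

/-! ### Arcwise connectedness -/

theorem isClosedEmbedding_iterate (n : ℕ) : IsClosedEmbedding (halfShift^[n]) :=
  (continuous_halfShift.iterate n).isClosedEmbedding (halfShift_injective.iterate n)

/-- The copy of the circuit at the `n`-th level. -/
noncomputable def branch (n : ℕ) (d : ℝ) : HilbertCube := halfShift^[n] (circuit d)

theorem branch_zero (n : ℕ) : branch n 0 = origin := by
  rw [branch, circuit_zero, Function.iterate_fixed halfShift_edgePoint_zero]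

theorem iterate_mem {x : HilbertCube} (hx : x ∈ limitContinuum) (n : ℕ) :
    halfShift^[n] x ∈ limitContinuum := by
  induction n with
  | zero => exact hx
  | succ n ih =>
    rw [Function.iterate_succ_apply']
    exact halfShift_mem ih

theorem branch_mem (n : ℕ) {d : ℝ} (hd : d ∈ Ico (0 : ℝ) 1) : branch n d ∈ limitContinuum :=
  iterate_mem (circuit_mem hd) n

theorem branch_injOn (n : ℕ) : InjOn (branch n) (Ico 0 1) :=
  (halfShift_injective.iterate n).comp_injOn circuit_injOn

theorem continuousOn_branch (n : ℕ) : ContinuousOn (branch n) (Ico 0 1) :=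
  (continuous_halfShift.iterate n).comp_continuousOn continuousOn_circuit

theorem branch_ne_of_lt {i j : ℕ} (hij : i < j) {a b : ℝ} (ha : a ∈ Ioo (0 : ℝ) 1) :
    branch i a ≠ branch j b := fun h => by
  obtain ⟨k, rfl⟩ := Nat.exists_eq_add_of_lt hij
  rw [branch, branch, add_assoc, Function.iterate_add_apply] at h
  have h2 := halfShift_injective.iterate i h
  rw [Function.iterate_succ_apply'] at h2
  exact circuit_ne_halfShift ha _ h2

/-- Unscaling a point of the scaled copy moves a nonzero coordinate down by one index, and at index
0 it forces the point onto the circuit. Thus only the origin survives in all the nested copies. -/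
theorem exists_branch_eq_of_coord_ne_zero (i : ℕ) {x : HilbertCube} (hx : x ∈ limitContinuum)
    (h : (x i : ℝ) ≠ 0) : ∃ n, ∃ d ∈ Ico (0 : ℝ) 1, branch n d = x := by
  induction i generalizing x with
  | zero =>
    rcases mem_limitContinuum_cases hx with ⟨d, hd, rfl⟩ | ⟨y, -, rfl⟩
    · exact ⟨0, d, ⟨hd.1.le, hd.2⟩, rfl⟩
    · exact absurd (halfShift_zero y) h
  | succ i ih =>
    rcases mem_limitContinuum_cases hx with ⟨d, hd, rfl⟩ | ⟨y, hy, rfl⟩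
    · exact ⟨0, d, ⟨hd.1.le, hd.2⟩, rfl⟩
    · rw [halfShift_succ] at h
      obtain ⟨n, d, hd, rfl⟩ := ih hy fun h2 => h (by rw [h2, zero_div])
      exact ⟨n + 1, d, hd, by rw [branch, Function.iterate_succ_apply', branch]⟩

theorem exists_branch_eq {x : HilbertCube} (hx : x ∈ limitContinuum) :
    ∃ n, ∃ d ∈ Ico (0 : ℝ) 1, branch n d = x := by
  by_cases h : ∃ i, (x i : ℝ) ≠ 0
  · obtain ⟨i, hi⟩ := h
    exact exists_branch_eq_of_coord_ne_zero i hx hi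
  · push Not at h
    refine ⟨0, 0, by simp, ?_⟩
    rw [branch_zero]
    refine ext_coord fun i => ?_
    rw [h i]
    cases i with
    | zero => exact edgePoint_zero le_rfl zero_le_one
    | succ i => rfl

/-- Two branches, joined at the origin. -/
noncomputable def doubleBranch (i j : ℕ) (u : ℝ) : HilbertCube :=
  if u ≤ 0 then branch i (-u) else branch j u

section DoubleBranch

variable {i j : ℕ} {u v : ℝ}

theorem doubleBranch_neg (hu : 0 ≤ u) : doubleBranch i j (-u) = branch i u := by
  rw [doubleBranch, if_pos (by linarith), neg_neg]

theorem doubleBranch_of_nonneg (hu : 0 ≤ u) : doubleBranch i j u = branch j u := by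
  rcases eq_or_lt_of_le hu with rfl | h
  · rw [doubleBranch, if_pos le_rfl, neg_zero, branch_zero, branch_zero]
  · rw [doubleBranch, if_neg (not_le.2 h)]

theorem doubleBranch_mem (hu : u ∈ Ioo (-1 : ℝ) 1) : doubleBranch i j u ∈ limitContinuum := by
  rcases le_total u 0 with h | h
  · rw [← neg_neg u, doubleBranch_neg (by linarith)]
    exact branch_mem i ⟨by linarith, by linarith [hu.1]⟩
  · rw [doubleBranch_of_nonneg h]
    exact branch_mem j ⟨h, hu.2⟩

theorem continuousOn_doubleBranch (i j : ℕ) :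
    ContinuousOn (doubleBranch i j) (Ioo (-1) 1) := by
  unfold doubleBranch
  refine ContinuousOn.if ?_ ?_ ?_
  · rintro u ⟨-, hu⟩
    rw [show {a : ℝ | a ≤ 0} = Iic 0 from rfl, frontier_Iic] at hu
    rw [mem_singleton_iff.1 hu, neg_zero, branch_zero, branch_zero]
  · refine (continuousOn_branch i).comp (by fun_prop) ?_
    rintro u ⟨hu, hu2⟩
    rw [show {a : ℝ | a ≤ 0} = Iic 0 from rfl, closure_Iic] at hu2
    exact ⟨neg_nonneg.2 hu2, by linarith [hu.1]⟩
  · refine (continuousOn_branch j).mono ?_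
    rintro u ⟨hu, hu2⟩
    simp only [not_le] at hu2
    rw [show {a : ℝ | 0 < a} = Ioi 0 from rfl, closure_Ioi] at hu2
    exact ⟨hu2, hu.2⟩

theorem branch_ne (hij : i ≠ j) (hu : u ∈ Ico (0 : ℝ) 1) (hv : v ∈ Ioo (0 : ℝ) 1) :
    branch i u ≠ branch j v := fun h => by
  rcases eq_or_lt_of_le hu.1 with rfl | hu0
  · rw [branch_zero, ← branch_zero j] at h
    exact hv.1.ne (branch_injOn j ⟨le_rfl, hu.2⟩ ⟨hv.1.le, hv.2⟩ h)
  rcases lt_or_gt_of_ne hij with h1 | h1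
  · exact branch_ne_of_lt h1 ⟨hu0, hu.2⟩ h
  · exact branch_ne_of_lt h1 hv h.symm

theorem doubleBranch_injOn (hij : i ≠ j) : InjOn (doubleBranch i j) (Ioo (-1) 1) := by
  intro u hu v hv h
  unfold doubleBranch at h
  split_ifs at h with h1 h2 h2
  · exact neg_injective (branch_injOn i ⟨by linarith, by linarith [hu.1]⟩
      ⟨by linarith, by linarith [hv.1]⟩ h)
  · exact absurd h (branch_ne hij ⟨by linarith, by linarith [hu.1]⟩ ⟨not_le.1 h2, hv.2⟩)
  · exact absurd h.symm (branch_ne hij ⟨by linarith, by linarith [hv.1]⟩ ⟨not_le.1 h1, hu.2⟩)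
  · exact branch_injOn j ⟨(not_le.1 h1).le, hu.2⟩ ⟨(not_le.1 h2).le, hv.2⟩ h

end DoubleBranch

theorem isArcwiseConnected_limitContinuum : IsArcwiseConnected limitContinuum := by
  refine ⟨⟨⟨origin, origin_mem⟩⟩, fun x y hxy => ?_⟩
  obtain ⟨i, j, hij, u, hu, v, hv, hux, hvy⟩ : ∃ i j : ℕ, i ≠ j ∧ ∃ u ∈ Ioo (-1 : ℝ) 1,
      ∃ v ∈ Ioo (-1 : ℝ) 1, doubleBranch i j u = x ∧ doubleBranch i j v = y := by
    obtain ⟨i, a, ha, hax⟩ := exists_branch_eq x.2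
    obtain ⟨j, b, hb, hby⟩ := exists_branch_eq y.2
    by_cases hij : i = j
    · subst hij
      -- For two points of one branch, a second branch is chosen only to reuse the same embedded
      -- open interval.
      exact ⟨i, i + 1, by omega, -a, ⟨by linarith [ha.2], by linarith [ha.1]⟩, -b,
        ⟨by linarith [hb.2], by linarith [hb.1]⟩, (doubleBranch_neg ha.1).trans hax,
        (doubleBranch_neg hb.1).trans hby⟩
    · exact ⟨i, j, hij, -a, ⟨by linarith [ha.2], by linarith [ha.1]⟩, b,
        ⟨by linarith [hb.1], hb.2⟩, (doubleBranch_neg ha.1).trans hax,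
        (doubleBranch_of_nonneg hb.1).trans hby⟩
  have huv : v - u ≠ 0 := fun h => hxy (Subtype.ext (by
    rw [← hux, ← hvy, sub_eq_zero.1 h]))
  have hmem : ∀ t : unitInterval, u + t * (v - u) ∈ Ioo (-1 : ℝ) 1 := fun t => by
    have h := (convex_Ioo (-1 : ℝ) 1).add_smul_sub_mem hu hv t.2
    simpa only [smul_eq_mul] using h
  have hcont : Continuous fun t : unitInterval =>
      (⟨doubleBranch i j (u + t * (v - u)), doubleBranch_mem (hmem t)⟩ : limitContinuum) :=
    ((continuousOn_doubleBranch i j).comp_continuous (by fun_prop) hmem).subtype_mk _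
  refine ⟨_, (hcont.isClosedEmbedding fun t s h => ?_).isEmbedding, Subtype.ext ?_,
    Subtype.ext ?_⟩
  · have h1 := doubleBranch_injOn hij (hmem t) (hmem s) (congrArg Subtype.val h)
    exact Subtype.ext (mul_right_cancel₀ huv (add_left_cancel h1))
  · simpa using hux
  · simpa using hvy

/-! ### Depth and order -/

theorem iterate_mem_level (n : ℕ) : halfShift^[n] '' limitContinuum ∈ level limitContinuum n := by
  induction n with
  | zero => simp [level]
  | succ n ih =>
    refine ⟨_, ih, ?_⟩
    have h := isTranche_limitContinuum.image (isClosedEmbedding_iterate n).isEmbedding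
    rwa [image_image] at h

theorem depth_limitContinuum : depth limitContinuum = ⊤ := by
  rw [ENat.eq_top_iff_forall_ge]
  intro n
  exact le_iSup₂ (f := fun (n : ℕ) (_ : n ∈ {n : ℕ | (level limitContinuum n).Nonempty}) =>
    (n : ℕ∞)) n ⟨_, iterate_mem_level n⟩

theorem image_limitSet_subset {E F : Type*} [TopologicalSpace E] [TopologicalSpace F] {g : E → F}
    (hg : Continuous g) (γ : ℝ≥0 → E) : g '' limitSet γ ⊆ limitSet (g ∘ γ) := by
  rintro _ ⟨x, hx, rfl⟩
  refine mem_iInter.2 fun m => ?_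
  rw [image_comp]
  exact image_closure_subset_closure_image hg (mem_image_of_mem _ (mem_iInter.1 hx m))

/-- A point of the limit set of the image has a nonempty compact preimage in each closure of a tail;
these are nested, so they have a common point. -/
theorem limitSet_comp {E F : Type*} [TopologicalSpace E] [CompactSpace E] [TopologicalSpace F]
    [T2Space F] {g : E → F} (hg : Continuous g) (γ : ℝ≥0 → E) :
    limitSet (g ∘ γ) = g '' limitSet γ := by
  refine Subset.antisymm (fun x hx => ?_) (image_limitSet_subset hg γ)
  have hclosed : ∀ m : ℝ≥0, IsClosed (closure (γ '' Ici m) ∩ g ⁻¹' {x}) := fun m =>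
    isClosed_closure.inter (isClosed_singleton.preimage hg)
  obtain ⟨z, hz⟩ := IsCompact.nonempty_iInter_of_directed_nonempty_isCompact_isClosed
    (fun m : ℝ≥0 => closure (γ '' Ici m) ∩ g ⁻¹' {x})
    (directed_of_isDirected_le fun m m' h => inter_subset_inter_left _
      (closure_mono (image_mono (Ici_subset_Ici.2 h))))
    (fun m => by
      have h := mem_iInter.1 hx m
      rw [image_comp, ← image_closure_of_isCompact isClosed_closure.isCompact hg.continuousOn] at h
      obtain ⟨z, hz, hzx⟩ := h
      exact ⟨z, hz, hzx⟩)
    (fun m => (hclosed m).isCompact) hclosed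
  rw [mem_iInter] at hz
  exact ⟨z, mem_iInter.2 fun m => (hz m).1, (hz 0).2⟩

theorem injective_quasiArc : Function.Injective quasiArc := fun s s' h => by
  have h1 := congrArg (fun z : HilbertCube => (z 0 : ℝ)) h
  simp only [quasiArc] at h1
  rw [ray_zero (rayParam s).2.1 (rayParam s).2.2, ray_zero (rayParam s').2.1 (rayParam s').2.2]
    at h1
  exact injective_rayParam (Subtype.ext h1)

/-- The chain consists of the iterated scaled copies of the ray: the ray lies in the continuum whose
scaled copy is its limit set. -/
theorem isInftyOrder_quasiArc : IsInftyOrder quasiArc := by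
  have hlim : ∀ i : ℕ, halfShift^[i] '' (halfShift '' limitContinuum) ⊆
      limitSet (halfShift^[i] ∘ quasiArc) := fun i => by
    rw [← limitSet_quasiArc]
    exact image_limitSet_subset (isClosedEmbedding_iterate i).continuous _
  intro n
  refine ⟨fun i => halfShift^[i] ∘ quasiArc, rfl, fun i => ⟨?_, ?_, ?_⟩, fun i => ?_⟩
  · exact (isClosedEmbedding_iterate i).continuous.comp continuous_quasiArc
  · exact (isClosedEmbedding_iterate i).injective.comp injective_quasiArc
  · exact ((nontrivial_limitContinuum.image halfShift_injective).image
      (isClosedEmbedding_iterate i).injective).mono (hlim i)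
  · rintro _ ⟨s, rfl⟩
    refine hlim i ⟨_, mem_image_of_mem _ (ray_mem (rayParam s).2), ?_⟩
    simp only [Function.comp_apply, Fin.val_succ, Function.iterate_succ_apply]
    rfl

/-! ### The finite stages -/

theorem edgeUnionClosure_trunc (n : ℕ) :
    edgeUnionClosure (fun t => trunc (n + 1) (ray t)) = trunc (n + 1) '' limitContinuum := by
  rw [limitContinuum, edgeUnionClosure, edgeUnionClosure, image_union]
  congr 1
  · ext x
    constructor
    · exact fun hx => ⟨x, hx, trunc_eq_self_of_mem_baseEdge (by omega) hx⟩
    · rintro ⟨x, hx, rfl⟩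
      rwa [trunc_eq_self_of_mem_baseEdge (by omega) hx]
  · rw [image_closure_of_isCompact isClosed_closure.isCompact (continuous_trunc _).continuousOn,
      ← range_comp]
    rfl

theorem limitSet_trunc (n : ℕ) :
    limitSet (trunc (n + 1) ∘ quasiArc) = halfShift '' (trunc n '' limitContinuum) := by
  rw [limitSet_comp (continuous_trunc _), limitSet_quasiArc, image_image, image_image]
  simp only [trunc_halfShift]

theorem isOscillatoryQuasiArc_trunc (n : ℕ) :
    IsOscillatoryQuasiArc (trunc (n + 2) ∘ quasiArc) := by
  refine ⟨(continuous_trunc _).comp continuous_quasiArc, fun s s' h => ?_, ?_⟩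
  · have h1 := congrArg (fun z : HilbertCube => (z 0 : ℝ)) h
    simp only [Function.comp_apply, trunc_of_lt (show 0 < n + 2 by omega), quasiArc] at h1
    rw [ray_zero (rayParam s).2.1 (rayParam s).2.2, ray_zero (rayParam s').2.1 (rayParam s').2.2]
      at h1
    exact injective_rayParam (Subtype.ext h1)
  · rw [limitSet_trunc]
    refine Set.Nontrivial.image ?_ halfShift_injective
    have hedge : ∀ u ∈ Icc (0 : ℝ) 1, edgePoint u ∈ trunc (n + 1) '' limitContinuum := fun u hu =>
      ⟨_, edgePoint_mem hu, trunc_eq_self_of_mem_baseEdge (by omega)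
        (baseEdge_eq_image ▸ mem_image_of_mem _ hu)⟩
    exact ⟨_, hedge 0 (by simp), _, hedge 1 (by simp), origin_ne_edgePoint_one⟩

theorem tendsto_half_pow : Tendsto (fun n : ℕ => (1 / 2 : ℝ) ^ (n + 2)) atTop (𝓝 0) :=
  (tendsto_add_atTop_iff_nat 2).2
    (tendsto_pow_atTop_nhds_zero_of_lt_one (by norm_num) (by norm_num))

theorem tendstoUniformly_trunc :
    TendstoUniformly (fun (n : ℕ) (t : Ioc (0 : ℝ) 1) => trunc (n + 2) (ray t)) (fun t => ray t)
      atTop := by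
  rw [Metric.tendstoUniformly_iff]
  intro ε hε
  filter_upwards [tendsto_half_pow.eventually_lt_const hε] with n hn t
  rw [dist_comm]
  exact (dist_trunc_le _ _).trans_lt hn

theorem tendsto_hausdorffDist_trunc :
    Tendsto (fun n : ℕ => Metric.hausdorffDist (trunc (n + 2) '' limitContinuum) limitContinuum)
      atTop (𝓝 0) := by
  refine squeeze_zero (fun n => Metric.hausdorffDist_nonneg) (fun n => ?_) tendsto_half_pow
  refine Metric.hausdorffDist_le_of_mem_dist (by positivity) ?_ ?_
  · rintro _ ⟨x, hx, rfl⟩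
    exact ⟨x, hx, dist_trunc_le _ _⟩
  · intro x hx
    exact ⟨_, mem_image_of_mem _ hx, by rw [dist_comm]; exact dist_trunc_le _ _⟩

end WarsawTower

theorem mainTheorem4 :
    ∃ (φ : ℕ → Ioc (0 : ℝ) 1 → HilbertCube) (φ_lim : Ioc (0 : ℝ) 1 → HilbertCube)
      (X : ℕ → Set HilbertCube) (X_lim : Set HilbertCube),
      (∀ n, X n = edgeUnionClosure (φ n)) ∧
      X_lim = edgeUnionClosure φ_lim ∧
      -- the iteration starts with the Warsaw circle
      (∀ t : Ioc (0 : ℝ) 1, ((φ 0 t) 0 : ℝ) = t ∧ ((φ 0 t) 1 : ℝ) = warsawFun t) ∧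
      -- at each step one new oscillating coordinate is added
      (∀ n t i, n + 1 < i → (φ n t) i = 0) ∧
      (∀ n t i, i ≤ n + 1 → (φ (n + 1) t) i = (φ n t) i) ∧
      (∀ n, IsOscillatoryQuasiArc (φ n ∘ rayParam)) ∧
      (∀ n, limitSet (φ (n + 1) ∘ rayParam) = HilbertCube.halfShift '' X n) ∧
      -- passage to the limit
      TendstoUniformly φ φ_lim atTop ∧
      Tendsto (fun n => Metric.hausdorffDist (X n) X_lim) atTop (𝓝 0) ∧
      -- the limit continuum
      IsArcwiseConnected X_lim ∧
      IsGeneralizedSinContinuum X_lim ∧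
      IsTranchedGraph X_lim ∧
      depth X_lim = ⊤ ∧
      -- its unique tranche is a scaled copy of itself and the limit set of its quasi-arc
      (∀ T : Set HilbertCube, IsTranche T X_lim ↔ T = HilbertCube.halfShift '' X_lim) ∧
      limitSet (φ_lim ∘ rayParam) = HilbertCube.halfShift '' X_lim ∧
      IsInftyOrder (φ_lim ∘ rayParam) := by
  -- Stage `n` keeps the indices up to `n + 1`, the time included, hence the `n + 2`.
  refine ⟨fun n t => HilbertCube.trunc (n + 2) (WarsawTower.ray t), fun t => WarsawTower.ray t,
    fun n => HilbertCube.trunc (n + 2) '' WarsawTower.limitContinuum, WarsawTower.limitContinuum,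
    fun n => (WarsawTower.edgeUnionClosure_trunc (n + 1)).symm, rfl, fun t => ⟨?_, ?_⟩,
    fun n t i hi => HilbertCube.trunc_of_le (by omega) _, fun n t i hi => ?_,
    WarsawTower.isOscillatoryQuasiArc_trunc, fun n => WarsawTower.limitSet_trunc (n + 2),
    WarsawTower.tendstoUniformly_trunc, WarsawTower.tendsto_hausdorffDist_trunc,
    WarsawTower.isArcwiseConnected_limitContinuum,
    WarsawTower.isGeneralizedSinContinuum_limitContinuum,
    WarsawTower.isTranchedGraph_limitContinuum, WarsawTower.depth_limitContinuum,
    fun T => ⟨WarsawTower.eq_of_isTranche, ?_⟩, WarsawTower.limitSet_quasiArc,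
    WarsawTower.isInftyOrder_quasiArc⟩
  · exact (congrArg Subtype.val (HilbertCube.trunc_of_lt (by omega) _)).trans
      (WarsawTower.ray_zero t.2.1 t.2.2)
  · exact (congrArg Subtype.val (HilbertCube.trunc_of_lt (by omega) _)).trans
      (WarsawTower.ray_succ t.2.1 t.2.2 0)
  · exact (HilbertCube.trunc_of_lt (by omega) _).trans (HilbertCube.trunc_of_lt (by omega) _).symm
  · rintro rfl
    exact WarsawTower.isTranche_limitContinuum
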